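/- Let $k$ be a field, let $A$ be a finite-dimensional Hopf algebra over $k$ with comultiplication $\Delta a=\sum a_{(1)}\otimes a_{(2)}$ and antipode $S$, and let $V$ be a finite-dimensional left $A$-module, with corresponding representation $\tau:A\to\operatorname{End}_k V$. The dual space $C=\operatorname{Coend}V=(\operatorname{End}_k V)^*$ is a coalgebra whose comultiplication and counit are dual to the multiplication and the unit of $\operatorname{End}_k V$. It is a right $A$-module coalgebra with respect to the action $(ca)(\beta)=c(a\vartriangleright\beta)$, where $$a\vartriangleright\beta=\sum\tau(a_{(1)})\circ\beta\circ\tau(S(a_{(2)})),\qquad a\in A,\ \beta\in\operatorname{End}_k V,\ c\in C.$$ Let $H(C,A)$ be the free Hopf algebra on the right $A$-module coalgebra $C$, with its canonical maps $\imath:C\to H(C,A)$ and $\jmath:A\to H(C,A)$. That is, $(H(C,A),\imath,\jmath)$ is the initial object in the category of triples $(H,f,\varphi)$, where $H$ is a Hopf algebra over $k$, $f:C\to H$ is a homomorphism of coalgebras and $\varphi:A\to H$ is a homomorphism of Hopf algebras such that $f(ca)=f(c)\varphi(a)$ for all $c\in C$ and $a\in A$; a morphism $(H,f,\varphi)\to(H',f',\varphi')$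 is a homomorphism of Hopf algebras $t:H\to H'$ with $f'=t\circ f$ and $\varphi'=t\circ\varphi$. Suppose that $V$ contains an element with zero annihilator in $A$, i.e. there is $v\in V$ such that $av=0$ implies $a=0$ for $a\in A$. Then the canonical maps $\imath:C\to H(C,A)$ and $\jmath:A\to H(C,A)$ are both injective. -/

import Mathlib

open scoped TensorProduct

noncomputable section

namespace HopfFree

open WithConv

/-! ### Convolution inverses -/

section Conv

variable {k : Type*} [CommRing k]
variable {D : Type*} [AddCommGroup D] [Module k D] [Coalgebra k D]
variable {B : Type*} [Ring B] [Algebra k B]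
variable {B' : Type*} [Ring B'] [Algebra k B']

/-- `f` and `g` are two-sided inverses of each other in the convolution algebra
`Hom_k(D, B)`. -/
def ConvInverse (f g : D →ₗ[k] B) : Prop :=
  (∀ d, LinearMap.mul' k B (TensorProduct.map f g (Coalgebra.comul d)) =
    algebraMap k B (Coalgebra.counit d)) ∧
  (∀ d, LinearMap.mul' k B (TensorProduct.map g f (Coalgebra.comul d)) =
    algebraMap k B (Coalgebra.counit d))

theorem convInverse_iff (f g : D →ₗ[k] B) :
    ConvInverse f g ↔ toConv f * toConv g = 1 ∧ toConv g * toConv f = 1 := by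
  constructor
  · rintro ⟨h1, h2⟩
    constructor
    · ext d; exact h1 d
    · ext d; exact h2 d
  · rintro ⟨h1, h2⟩
    constructor
    · intro d; exact congrArg (fun F : WithConv (D →ₗ[k] B) => F d) h1
    · intro d; exact congrArg (fun F : WithConv (D →ₗ[k] B) => F d) h2

theorem ConvInverse.unique {f g g' : D →ₗ[k] B} (h : ConvInverse f g)
    (h' : ConvInverse f g') : g = g' := by
  rw [convInverse_iff] at h h'
  have := left_inv_eq_right_inv h.2 h'.1
  exact congrArg ofConv this

theorem ConvInverse.algHom_comp {f g : D →ₗ[k] B} (h : ConvInverse f g) (t : B →ₐ[k] B') :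
    ConvInverse (t.toLinearMap ∘ₗ f) (t.toLinearMap ∘ₗ g) := by
  have key : ∀ (u v : D →ₗ[k] B) (w : D ⊗[k] D),
      LinearMap.mul' k B' (TensorProduct.map (t.toLinearMap ∘ₗ u) (t.toLinearMap ∘ₗ v) w) =
        t (LinearMap.mul' k B (TensorProduct.map u v w)) := by
    intro u v w
    induction w with
    | zero => simp
    | tmul x y => simp
    | add x y hx hy => simp only [map_add, hx, hy]
  constructor
  · intro d; rw [key, h.1]; simp
  · intro d; rw [key, h.2]; simp

theorem ConvInverse.comp_coalgHom {E : Type*} [AddCommGroup E] [Module k E] [Coalgebra k E]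
    {f g : D →ₗ[k] B} (h : ConvInverse f g) (p : E →ₗc[k] D) :
    ConvInverse (f ∘ₗ p.toLinearMap) (g ∘ₗ p.toLinearMap) := by
  have key : ∀ (u v : D →ₗ[k] B) (e : E),
      LinearMap.mul' k B (TensorProduct.map (u ∘ₗ p.toLinearMap) (v ∘ₗ p.toLinearMap)
        (Coalgebra.comul e)) =
        LinearMap.mul' k B (TensorProduct.map u v (Coalgebra.comul (p e))) := by
    intro u v e
    rw [← CoalgHomClass.map_comp_comul_apply, TensorProduct.map_comp]
    rfl
  constructor
  · intro d; rw [key, h.1]; simp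
  · intro d; rw [key, h.2]; simp

theorem ConvInverse.mul {f g f' g' : D →ₗ[k] B} (h : ConvInverse f g) (h' : ConvInverse f' g') :
    ConvInverse (LinearMap.mul' k B ∘ₗ TensorProduct.map f f' ∘ₗ Coalgebra.comul)
      (LinearMap.mul' k B ∘ₗ TensorProduct.map g' g ∘ₗ Coalgebra.comul) := by
  rw [convInverse_iff] at *
  change (toConv f * toConv f') * (toConv g' * toConv g) = 1 ∧
    (toConv g' * toConv g) * (toConv f * toConv f') = 1
  constructor
  · rw [mul_assoc, ← mul_assoc (toConv f'), h'.1, one_mul, h.1]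
  · rw [mul_assoc, ← mul_assoc (toConv g), h.2, one_mul, h'.2]

/-- If `g` is the convolution inverse of `f`, then `c ↦ g c₂ ⊗ g c₁` is the convolution inverse
of `c ↦ f c₁ ⊗ f c₂`. -/
theorem ConvInverse.tensor {f g : D →ₗ[k] B} (h : ConvInverse f g) :
    ConvInverse (B := B ⊗[k] B) (TensorProduct.map f f ∘ₗ Coalgebra.comul)
      (TensorProduct.map g g ∘ₗ (TensorProduct.comm k D D).toLinearMap ∘ₗ Coalgebra.comul) := by
  have h1 := h.algHom_comp (Algebra.TensorProduct.includeLeft : B →ₐ[k] B ⊗[k] B)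
  have h2 := h.algHom_comp (Algebra.TensorProduct.includeRight : B →ₐ[k] B ⊗[k] B)
  have e1 : TensorProduct.map f f =
      LinearMap.mul' k (B ⊗[k] B) ∘ₗ TensorProduct.map
        ((Algebra.TensorProduct.includeLeft : B →ₐ[k] B ⊗[k] B).toLinearMap ∘ₗ f)
        ((Algebra.TensorProduct.includeRight : B →ₐ[k] B ⊗[k] B).toLinearMap ∘ₗ f) := by
    ext x y; simp
  have e2 : TensorProduct.map g g ∘ₗ (TensorProduct.comm k D D).toLinearMap =
      LinearMap.mul' k (B ⊗[k] B) ∘ₗ TensorProduct.map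
        ((Algebra.TensorProduct.includeRight : B →ₐ[k] B ⊗[k] B).toLinearMap ∘ₗ g)
        ((Algebra.TensorProduct.includeLeft : B →ₐ[k] B ⊗[k] B).toLinearMap ∘ₗ g) := by
    ext x y; simp
  have := h1.mul h2
  rw [← LinearMap.comp_assoc, ← LinearMap.comp_assoc, ← e1, ← e2] at this
  exact this

variable (k) in
theorem convInverse_antipode (H : Type*) [Ring H] [HopfAlgebra k H] :
    ConvInverse (LinearMap.id : H →ₗ[k] H) (HopfAlgebra.antipode k) := by
  rw [convInverse_iff]
  exact ⟨LinearMap.id_mul_antipode, LinearMap.antipode_mul_id⟩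

end Conv

/-! ### Right module coalgebras -/

/-- A right `A`-module coalgebra over a bialgebra `A`: a coalgebra `C` with a right `A`-module
structure whose structure map `C ⊗ A → C`, `c ⊗ a ↦ ca`, is a homomorphism of coalgebras. -/
class RightModuleCoalgebra (k A C : Type*) [CommRing k] [Ring A] [Bialgebra k A]
    [AddCommGroup C] [Module k C] [Coalgebra k C] where
  /-- The structure map `c ⊗ a ↦ ca`. -/
  act : C ⊗[k] A →ₗc[k] C
  act_one : ∀ c : C, act (c ⊗ₜ[k] (1 : A)) = c
  act_mul : ∀ (c : C) (a b : A), act (c ⊗ₜ[k] (a * b)) = act (act (c ⊗ₜ[k] a) ⊗ₜ[k] b)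

/-! ### The iterated co-opposite coalgebras -/

section ComulAt

variable (k C : Type*) [CommRing k] [AddCommGroup C] [Module k C] [Coalgebra k C]

/-- The comultiplication of `C` if `n` is even, and the opposite one if `n` is odd. -/
def comulAt (n : ℕ) : C →ₗ[k] C ⊗[k] C :=
  if Even n then Coalgebra.comul
  else (TensorProduct.comm k C C).toLinearMap ∘ₗ Coalgebra.comul

theorem comulAt_zero : comulAt k C 0 = Coalgebra.comul := by simp [comulAt]

theorem comulAt_succ (n : ℕ) :
    comulAt k C (n + 1) = (TensorProduct.comm k C C).toLinearMap ∘ₗ comulAt k C n := by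
  by_cases h : Even n
  · have h' : ¬ Even (n + 1) := by simpa [Nat.even_add_one] using h
    simp [comulAt, h, h']
  · have h' : Even (n + 1) := by simpa [Nat.even_add_one] using h
    rw [comulAt, comulAt, if_neg h, if_pos h', ← LinearMap.comp_assoc]
    ext x
    simp

/-- The co-opposite of a coalgebra structure. -/
@[reducible] def coopCoalgebra (i : Coalgebra k C) : Coalgebra k C where
  comul := (TensorProduct.comm k C C).toLinearMap ∘ₗ i.comul
  counit := i.counit
  coassoc := by
    ext c
    have key : ∀ w : C ⊗[k] C,
        TensorProduct.assoc k C C C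
          ((((TensorProduct.comm k C C).toLinearMap ∘ₗ i.comul).rTensor C)
            (TensorProduct.comm k C C w)) =
        (TensorProduct.leftComm k C C C).trans
          ((TensorProduct.assoc k C C C).symm.trans
            ((TensorProduct.comm k (C ⊗[k] C) C).trans
              (TensorProduct.congr (LinearEquiv.refl k C) (LinearEquiv.refl k (C ⊗[k] C)))))
          (LinearMap.lTensor C i.comul w) := by
      intro w
      induction w with
      | zero => simp
      | add x y hx hy => simp only [map_add, hx, hy]
      | tmul x y =>
        simp only [TensorProduct.comm_tmul, LinearMap.rTensor_tmul, LinearMap.comp_apply,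
          LinearMap.lTensor_tmul, LinearEquiv.coe_coe]
        generalize i.comul y = z
        induction z with
        | zero => simp
        | add x y hx hy => simp only [map_add, TensorProduct.add_tmul, TensorProduct.tmul_add, hx, hy]
        | tmul p q => simp
    have key2 : ∀ w : C ⊗[k] C,
        LinearMap.lTensor C ((TensorProduct.comm k C C).toLinearMap ∘ₗ i.comul)
            (TensorProduct.comm k C C w) =
        (TensorProduct.leftComm k C C C).trans
          ((TensorProduct.assoc k C C C).symm.trans
            ((TensorProduct.comm k (C ⊗[k] C) C).trans
              (TensorProduct.congr (LinearEquiv.refl k C) (LinearEquiv.refl k (C ⊗[k] C)))))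
          (TensorProduct.assoc k C C C (LinearMap.rTensor C i.comul w)) := by
      intro w
      induction w with
      | zero => simp
      | add x y hx hy => simp only [map_add, hx, hy]
      | tmul x y =>
        simp only [TensorProduct.comm_tmul, LinearMap.rTensor_tmul, LinearMap.comp_apply,
          LinearMap.lTensor_tmul, LinearEquiv.coe_coe]
        generalize i.comul x = z
        induction z with
        | zero => simp
        | add x y hx hy => simp only [map_add, TensorProduct.add_tmul, TensorProduct.tmul_add, hx, hy]
        | tmul p q => simp
    have h := i.coassoc
    have h' := LinearMap.congr_fun h c
    simp only [LinearMap.comp_apply, LinearEquiv.coe_coe] at h' ⊢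
    erw [key, key2, h']
  rTensor_counit_comp_comul := by
    ext c
    have h := LinearMap.congr_fun i.lTensor_counit_comp_comul c
    have key : ∀ w : C ⊗[k] C, LinearMap.rTensor C i.counit (TensorProduct.comm k C C w) =
        TensorProduct.comm k C k (LinearMap.lTensor C i.counit w) := by
      intro w
      induction w with
      | zero => simp
      | add x y hx hy => simp only [map_add, hx, hy]
      | tmul x y => simp
    simp only [LinearMap.comp_apply, LinearEquiv.coe_coe] at h ⊢
    rw [key, h]; simp
  lTensor_counit_comp_comul := by
    ext c
    have h := LinearMap.congr_fun i.rTensor_counit_comp_comul c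
    have key : ∀ w : C ⊗[k] C, LinearMap.lTensor C i.counit (TensorProduct.comm k C C w) =
        TensorProduct.comm k k C (LinearMap.rTensor C i.counit w) := by
      intro w
      induction w with
      | zero => simp
      | add x y hx hy => simp only [map_add, hx, hy]
      | tmul x y => simp
    simp only [LinearMap.comp_apply, LinearEquiv.coe_coe] at h ⊢
    rw [key, h]; simp

/-- The coalgebra structure with comultiplication `comulAt k C n`. -/
@[reducible] def coalgAt (n : ℕ) : Coalgebra k C where
  comul := comulAt k C n
  counit := Coalgebra.counit
  coassoc := by
    unfold comulAt
    split_ifs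
    · exact Coalgebra.coassoc
    · exact (coopCoalgebra k C inferInstance).coassoc
  rTensor_counit_comp_comul := by
    unfold comulAt
    split_ifs
    · exact Coalgebra.rTensor_counit_comp_comul
    · exact (coopCoalgebra k C inferInstance).rTensor_counit_comp_comul
  lTensor_counit_comp_comul := by
    unfold comulAt
    split_ifs
    · exact Coalgebra.lTensor_counit_comp_comul
    · exact (coopCoalgebra k C inferInstance).lTensor_counit_comp_comul

variable {k C} in
/-- `g` is the inverse of `f` in the convolution algebra `Hom_k(C, B)` if `n` is even, and in the
twist convolution algebra if `n` is odd. -/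
def InverseAt {B : Type*} [Ring B] [Algebra k B] (n : ℕ) (f g : C →ₗ[k] B) : Prop :=
  @ConvInverse k _ C _ _ (coalgAt k C n) B _ _ f g

end ComulAt

/-! ### The free Hopf algebra on a right module coalgebra -/

section FreeHopf

variable (k A C : Type*) [CommRing k] [Ring A] [HopfAlgebra k A]
  [AddCommGroup C] [Module k C] [Coalgebra k C] [RightModuleCoalgebra k A C]

namespace FreeHopf

/-- The tensor algebra on countably many copies of `C` and one copy of `A`. -/
abbrev Pre : Type _ := TensorAlgebra k ((ℕ →₀ C) × A)

/-- The `n`-th copy of `C` inside the tensor algebra. -/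
def preX (n : ℕ) : C →ₗ[k] Pre k A C :=
  TensorAlgebra.ι k ∘ₗ LinearMap.inl k (ℕ →₀ C) A ∘ₗ Finsupp.lsingle n

/-- The copy of `A` inside the tensor algebra. -/
def preJ : A →ₗ[k] Pre k A C :=
  TensorAlgebra.ι k ∘ₗ LinearMap.inr k (ℕ →₀ C) A

/-- The defining relations. The copy of `A` is multiplicative and unital, the zeroth copy
`X 0` of `C` satisfies `X 0 (ca) = X 0 c * J a`, and `X (n + 1)` is the convolution inverse of
`X n` when `n` is even and its twist convolution inverse when `n` is odd. -/
inductive Rel : Pre k A C → Pre k A C → Prop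
  | one : Rel (preJ k A C 1) 1
  | mul (a b : A) : Rel (preJ k A C (a * b)) (preJ k A C a * preJ k A C b)
  | act (c : C) (a : A) :
      Rel (preX k A C 0 (RightModuleCoalgebra.act (c ⊗ₜ[k] a))) (preX k A C 0 c * preJ k A C a)
  | inv_right (n : ℕ) (c : C) :
      Rel (LinearMap.mul' k _ (TensorProduct.map (preX k A C n) (preX k A C (n + 1))
        (comulAt k C n c))) (algebraMap k _ (Coalgebra.counit c))
  | inv_left (n : ℕ) (c : C) :
      Rel (LinearMap.mul' k _ (TensorProduct.map (preX k A C (n + 1)) (preX k A C n)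
        (comulAt k C n c))) (algebraMap k _ (Coalgebra.counit c))

end FreeHopf

/-- The algebra underlying the free Hopf algebra `H(C, A)` on the right `A`-module coalgebra
`C`, by generators and relations. -/
def FreeHopf : Type _ := RingQuot (FreeHopf.Rel k A C)

namespace FreeHopf

instance : Ring (FreeHopf k A C) := inferInstanceAs (Ring (RingQuot (Rel k A C)))
instance : Algebra k (FreeHopf k A C) := inferInstanceAs (Algebra k (RingQuot (Rel k A C)))

/-- The quotient map. -/
def mk : Pre k A C →ₐ[k] FreeHopf k A C := RingQuot.mkAlgHom k (Rel k A C)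

variable {k A C} in
theorem mk_rel {x y : Pre k A C} (h : Rel k A C x y) : mk k A C x = mk k A C y :=
  RingQuot.mkAlgHom_rel k h

/-- The `n`-th copy of `C` in `H(C, A)`; it is the image of `C` under the `n`-th power of the
antipode. -/
def X (n : ℕ) : C →ₗ[k] FreeHopf k A C := (mk k A C).toLinearMap ∘ₗ preX k A C n

/-- The canonical map `A → H(C, A)` as an algebra homomorphism. -/
def J : A →ₐ[k] FreeHopf k A C :=
  AlgHom.ofLinearMap ((mk k A C).toLinearMap ∘ₗ preJ k A C)
    (by simpa using mk_rel (Rel.one (k := k) (A := A) (C := C)))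
    (fun a b => by simpa using mk_rel (Rel.mul (k := k) (A := A) (C := C) a b))

theorem X_zero_act (c : C) (a : A) :
    X k A C 0 (RightModuleCoalgebra.act (c ⊗ₜ[k] a)) = X k A C 0 c * J k A C a := by
  simpa [X, J] using mk_rel (Rel.act (k := k) c a)

theorem mk_mul_map (f g : C →ₗ[k] Pre k A C) (w : C ⊗[k] C) :
    mk k A C (LinearMap.mul' k _ (TensorProduct.map f g w)) =
    LinearMap.mul' k _ (TensorProduct.map ((mk k A C).toLinearMap ∘ₗ f)
      ((mk k A C).toLinearMap ∘ₗ g) w) := by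
  induction w with
  | zero => simp
  | tmul x y => simp
  | add x y hx hy => simp only [map_add, hx, hy]

theorem X_convInverse (n : ℕ) :
    InverseAt n (X k A C n) (X k A C (n + 1)) := by
  refine ⟨fun c => ?_, fun c => ?_⟩
  · have := mk_rel (Rel.inv_right (k := k) (A := A) n c)
    rw [mk_mul_map, AlgHom.commutes] at this
    exact this
  · have := mk_rel (Rel.inv_left (k := k) (A := A) n c)
    rw [mk_mul_map, AlgHom.commutes] at this
    exact this

section Lift

variable {k A C}
variable {B : Type*} [Ring B] [Algebra k B]

/-- A sequence of iterated inverses together with a compatible homomorphism of algebras defines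
a homomorphism of algebras on `H(C, A)`. -/
def lift (x : ℕ → C →ₗ[k] B) (φ : A →ₐ[k] B)
    (hact : ∀ c a, x 0 (RightModuleCoalgebra.act (c ⊗ₜ[k] a)) = x 0 c * φ a)
    (hinv : ∀ n, InverseAt n (x n) (x (n + 1))) :
    FreeHopf k A C →ₐ[k] B :=
  RingQuot.liftAlgHom k ⟨TensorAlgebra.lift k
      (LinearMap.coprod (Finsupp.lsum k x) φ.toLinearMap), by
    have hX : ∀ n c, TensorAlgebra.lift k (LinearMap.coprod (Finsupp.lsum k x) φ.toLinearMap)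
        (preX k A C n c) = x n c := by
      intro n c; simp [preX]
    have hJ : ∀ a, TensorAlgebra.lift k (LinearMap.coprod (Finsupp.lsum k x) φ.toLinearMap)
        (preJ k A C a) = φ a := by
      intro a; simp [preJ]
    have hM : ∀ (n m : ℕ) (w : C ⊗[k] C),
        TensorAlgebra.lift k (LinearMap.coprod (Finsupp.lsum k x) φ.toLinearMap)
          (LinearMap.mul' k _ (TensorProduct.map (preX k A C n) (preX k A C m) w)) =
        LinearMap.mul' k _ (TensorProduct.map (x n) (x m) w) := by
      intro n m w
      induction w with
      | zero => simp
      | tmul p q => simp [hX]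
      | add p q hp hq => simp only [map_add, hp, hq]
    intro p q h
    induction h with
    | one => rw [hJ]; simp
    | mul a b => rw [hJ, map_mul φ, map_mul, hJ, hJ]
    | act c a => rw [map_mul, hX, hX, hJ, hact]
    | inv_right n c => rw [hM, AlgHom.commutes]; exact (hinv n).1 c
    | inv_left n c => rw [hM, AlgHom.commutes]; exact (hinv n).2 c⟩

variable (x : ℕ → C →ₗ[k] B) (φ : A →ₐ[k] B)
    (hact : ∀ c a, x 0 (RightModuleCoalgebra.act (c ⊗ₜ[k] a)) = x 0 c * φ a)
    (hinv : ∀ n, InverseAt n (x n) (x (n + 1)))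

@[simp] theorem lift_X (n : ℕ) (c : C) : lift x φ hact hinv (X k A C n c) = x n c := by
  refine (RingQuot.liftAlgHom_mkAlgHom_apply k _ _ (preX k A C n c)).trans ?_
  simp [preX]

@[simp] theorem lift_J (a : A) : lift x φ hact hinv (J k A C a) = φ a := by
  refine (RingQuot.liftAlgHom_mkAlgHom_apply k _ _ (preJ k A C a)).trans ?_
  simp [preJ]

theorem algHom_ext {B : Type*} [Semiring B] [Algebra k B] {s t : FreeHopf k A C →ₐ[k] B}
    (hX : ∀ n c, s (X k A C n c) = t (X k A C n c))
    (hJ : ∀ a, s (J k A C a) = t (J k A C a)) : s = t := by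
  apply RingQuot.ringQuot_ext' (S := k) (s := Rel k A C)
  apply TensorAlgebra.hom_ext
  apply LinearMap.prod_ext
  · apply Finsupp.lhom_ext
    intro n c
    exact hX n c
  · ext a
    exact hJ a

theorem induction {P : FreeHopf k A C → Prop} (hX : ∀ n c, P (X k A C n c))
    (hJ : ∀ a, P (J k A C a)) (hs : ∀ r : k, P (algebraMap k _ r))
    (hadd : ∀ x y, P x → P y → P (x + y)) (hmul : ∀ x y, P x → P y → P (x * y))
    (h : FreeHopf k A C) : P h := by
  obtain ⟨w, rfl⟩ := RingQuot.mkAlgHom_surjective k (Rel k A C) h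
  change P (mk k A C w)
  induction w using TensorAlgebra.induction with
  | algebraMap r => rw [AlgHom.commutes]; exact hs r
  | add x y hx hy => rw [map_add]; exact hadd _ _ hx hy
  | mul x y hx hy => rw [map_mul]; exact hmul _ _ hx hy
  | ι p =>
    obtain ⟨f, a⟩ := p
    have : ((f, a) : (ℕ →₀ C) × A) = (f, 0) + (0, a) := by simp
    rw [this, map_add, map_add]
    refine hadd _ _ ?_ (hJ a)
    induction f using Finsupp.induction_linear with
    | zero =>
      have h0 : ((0, 0) : (ℕ →₀ C) × A) = 0 := rfl
      rw [h0, map_zero, map_zero, ← map_zero (algebraMap k (FreeHopf k A C))]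
      exact hs 0
    | add f g hf hg =>
      have h1 : ((f + g, 0) : (ℕ →₀ C) × A) = (f, 0) + (g, 0) := by simp
      rw [h1, map_add, map_add]
      exact hadd _ _ (hf (by simp)) (hg (by simp))
    | single n c => exact hX n c

end Lift

/-! #### The bialgebra structure -/

/-- The comultiplication of `H(C, A)`. -/
def comulHom : FreeHopf k A C →ₐ[k] FreeHopf k A C ⊗[k] FreeHopf k A C :=
  lift (fun n => TensorProduct.map (X k A C n) (X k A C n) ∘ₗ comulAt k C n)
    ((Algebra.TensorProduct.map (J k A C) (J k A C)).comp (Bialgebra.comulAlgHom k A))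
    (by
      intro c a
      have key : ∀ (u : C ⊗[k] C) (w : A ⊗[k] A),
          TensorProduct.map (X k A C 0) (X k A C 0)
            (TensorProduct.map (RightModuleCoalgebra.act (k := k) (A := A) (C := C)).toLinearMap
              (RightModuleCoalgebra.act (k := k) (A := A) (C := C)).toLinearMap
              (TensorProduct.AlgebraTensorModule.tensorTensorTensorComm k k k k C C A A
                (u ⊗ₜ w))) =
          TensorProduct.map (X k A C 0) (X k A C 0) u *
            TensorProduct.map (J k A C).toLinearMap (J k A C).toLinearMap w := by
        intro u w
        induction u with
        | zero => simp
        | add p q hp hq => simp only [TensorProduct.add_tmul, map_add, hp, hq, add_mul]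
        | tmul p q =>
          induction w with
          | zero => simp
          | add r s hr hs => simp only [TensorProduct.tmul_add, map_add, hr, hs, mul_add]
          | tmul r s =>
            simpa using congrArg₂ (fun x y => x ⊗ₜ[k] y) (X_zero_act k A C p r)
              (X_zero_act k A C q s)
      rw [comulAt_zero]
      have h := CoalgHomClass.map_comp_comul_apply
        (RightModuleCoalgebra.act (k := k) (A := A) (C := C)) (c ⊗ₜ[k] a)
      have := key (Coalgebra.comul c) (Coalgebra.comul a)
      rw [LinearMap.comp_apply, ← h]
      exact this)
    (by
      intro n
      have := @ConvInverse.tensor k _ C _ _ (coalgAt k C n) _ _ _ _ _ (X_convInverse k A C n)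
      rw [comulAt_succ]
      exact this)

/-- The counit of `H(C, A)`. -/
def counitHom : FreeHopf k A C →ₐ[k] k :=
  lift (fun _ => Coalgebra.counit) (Bialgebra.counitAlgHom k A)
    (by intro c a; simp [mul_comm])
    (by
      intro n
      let _ := coalgAt k C n
      have h : ∀ c : C, LinearMap.mul' k k
          (TensorProduct.map Coalgebra.counit Coalgebra.counit (Coalgebra.comul c)) =
          algebraMap k k (Coalgebra.counit c) := by
        intro c
        have h1 := Coalgebra.rTensor_counit_comul (R := k) c
        have key : ∀ w : C ⊗[k] C, LinearMap.mul' k k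
          (TensorProduct.map Coalgebra.counit Coalgebra.counit w) =
            TensorProduct.lid k k (LinearMap.lTensor k Coalgebra.counit
              (LinearMap.rTensor C Coalgebra.counit w)) := by
          intro w
          induction w with
          | zero => simp
          | tmul x y => simp
          | add x y hx hy => simp only [map_add, hx, hy]
        rw [key, h1]; simp
      exact ⟨h, h⟩)

theorem comulHom_X (n : ℕ) (c : C) : comulHom k A C (X k A C n c) =
    TensorProduct.map (X k A C n) (X k A C n) (comulAt k C n c) := by
  simp [comulHom]

theorem comulHom_J (a : A) : comulHom k A C (J k A C a) =
    TensorProduct.map (J k A C).toLinearMap (J k A C).toLinearMap (Coalgebra.comul a) := by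
  simp [comulHom]; rfl

@[simp] theorem counitHom_X (n : ℕ) (c : C) :
    counitHom k A C (X k A C n c) = Coalgebra.counit c := by
  exact lift_X _ _ _ _ n c

@[simp] theorem counitHom_J (a : A) : counitHom k A C (J k A C a) = Coalgebra.counit a := by
  exact lift_J _ _ _ _ a

section Aux

variable {k}
variable {D H : Type*} [AddCommGroup D] [Module k D] [Coalgebra k D] [Ring H] [Algebra k H]
  (f : D →ₗ[k] H) (Δ : H →ₐ[k] H ⊗[k] H) (e : H →ₐ[k] k)

theorem aux_coassoc (h : ∀ d, Δ (f d) = TensorProduct.map f f (Coalgebra.comul d)) (d : D) :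
    Algebra.TensorProduct.assoc k k k H H H
      (Algebra.TensorProduct.map Δ (.id k H) (Δ (f d))) =
    Algebra.TensorProduct.map (.id k H) Δ (Δ (f d)) := by
  have h1 : ∀ w : D ⊗[k] D, Algebra.TensorProduct.assoc k k k H H H
      (Algebra.TensorProduct.map Δ (.id k H) (TensorProduct.map f f w)) =
      TensorProduct.map f (TensorProduct.map f f)
        (TensorProduct.assoc k D D D (LinearMap.rTensor D Coalgebra.comul w)) := by
    intro w
    induction w with
    | zero => simp
    | add x y hx hy => simp only [map_add, hx, hy]
    | tmul x y =>
      simp only [TensorProduct.map_tmul, Algebra.TensorProduct.map_tmul, h,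
        LinearMap.rTensor_tmul, AlgHom.coe_id, id_eq]
      generalize (Coalgebra.comul x : D ⊗[k] D) = z
      induction z with
      | zero => simp
      | add x y hx hy => simp only [map_add, TensorProduct.add_tmul, hx, hy]
      | tmul p q => simp
  have h2 : ∀ w : D ⊗[k] D,
      Algebra.TensorProduct.map (.id k H) Δ (TensorProduct.map f f w) =
      TensorProduct.map f (TensorProduct.map f f) (LinearMap.lTensor D Coalgebra.comul w) := by
    intro w
    induction w with
    | zero => simp
    | add x y hx hy => simp only [map_add, hx, hy]
    | tmul x y => simp [h]
  rw [h, h1, h2, Coalgebra.coassoc_apply]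

theorem aux_rTensor (h : ∀ d, Δ (f d) = TensorProduct.map f f (Coalgebra.comul d))
    (he : ∀ d, e (f d) = Coalgebra.counit d) (d : D) :
    Algebra.TensorProduct.map e (.id k H) (Δ (f d)) = 1 ⊗ₜ f d := by
  have h1 : ∀ w : D ⊗[k] D,
      Algebra.TensorProduct.map e (.id k H) (TensorProduct.map f f w) =
      LinearMap.lTensor k f (LinearMap.rTensor D Coalgebra.counit w) := by
    intro w
    induction w with
    | zero => simp
    | add x y hx hy => simp only [map_add, hx, hy]
    | tmul x y => simp [he]
  rw [h, h1, Coalgebra.rTensor_counit_comul]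
  simp

theorem aux_lTensor (h : ∀ d, Δ (f d) = TensorProduct.map f f (Coalgebra.comul d))
    (he : ∀ d, e (f d) = Coalgebra.counit d) (d : D) :
    Algebra.TensorProduct.map (.id k H) e (Δ (f d)) = f d ⊗ₜ 1 := by
  have h1 : ∀ w : D ⊗[k] D,
      Algebra.TensorProduct.map (.id k H) e (TensorProduct.map f f w) =
      LinearMap.rTensor k f (LinearMap.lTensor D Coalgebra.counit w) := by
    intro w
    induction w with
    | zero => simp
    | add x y hx hy => simp only [map_add, hx, hy]
    | tmul x y => simp [he]
  rw [h, h1, Coalgebra.lTensor_counit_comul]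
  simp

end Aux

instance instBialgebra : Bialgebra k (FreeHopf k A C) :=
  Bialgebra.ofAlgHom (comulHom k A C) (counitHom k A C)
    (by
      apply algHom_ext
      · intro n c
        exact @aux_coassoc k _ C _ _ _ (coalgAt k C n) _ _ (X k A C n) (comulHom k A C) (comulHom_X k A C n) c
      · intro a
        exact aux_coassoc (J k A C).toLinearMap (comulHom k A C) (comulHom_J k A C) a)
    (by
      apply algHom_ext
      · intro n c
        exact @aux_rTensor k _ C _ _ _ (coalgAt k C n) _ _ (X k A C n) (comulHom k A C) (counitHom k A C) (comulHom_X k A C n)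
          (counitHom_X k A C n) c
      · intro a
        exact aux_rTensor (J k A C).toLinearMap (comulHom k A C) (counitHom k A C)
          (comulHom_J k A C) (counitHom_J k A C) a)
    (by
      apply algHom_ext
      · intro n c
        exact @aux_lTensor k _ C _ _ _ (coalgAt k C n) _ _ (X k A C n) (comulHom k A C) (counitHom k A C) (comulHom_X k A C n)
          (counitHom_X k A C n) c
      · intro a
        exact aux_lTensor (J k A C).toLinearMap (comulHom k A C) (counitHom k A C)
          (comulHom_J k A C) (counitHom_J k A C) a)

/-! #### The antipode -/

/-- `X 1 (ca) = J (S a) * X 1 c`. -/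
theorem X_one_act (c : C) (a : A) :
    X k A C 1 (RightModuleCoalgebra.act (c ⊗ₜ[k] a)) =
      J k A C (HopfAlgebra.antipode k a) * X k A C 1 c := by
  have h0 : ConvInverse (X k A C 0) (X k A C 1) := by
    have h := X_convInverse k A C 0
    refine ⟨fun d => ?_, fun d => ?_⟩
    · have := h.1 d
      rw [← comulAt_zero]; exact this
    · have := h.2 d
      rw [← comulAt_zero]; exact this
  have hJ := (convInverse_antipode k A).algHom_comp (J k A C)
  let p : C ⊗[k] A →ₗc[k] C :=
    (Coalgebra.TensorProduct.rid k k C : C ⊗[k] k →ₗc[k] C).comp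
      (Coalgebra.TensorProduct.map (CoalgHom.id k C) (Coalgebra.counitCoalgHom k A))
  let q : C ⊗[k] A →ₗc[k] A :=
    (Coalgebra.TensorProduct.lid k A : k ⊗[k] A →ₗc[k] A).comp
      (Coalgebra.TensorProduct.map (Coalgebra.counitCoalgHom k C) (CoalgHom.id k A))
  have hp : ∀ c a, p (c ⊗ₜ[k] a) = (Coalgebra.counit a : k) • c := fun c a => rfl
  have hq : ∀ c a, q (c ⊗ₜ[k] a) = (Coalgebra.counit c : k) • a := fun c a => rfl
  have h1 := h0.comp_coalgHom p
  have h2 := hJ.comp_coalgHom q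
  have h3 := h1.mul h2
  have h4 := h0.comp_coalgHom (RightModuleCoalgebra.act (k := k) (A := A) (C := C))
  have key : ∀ (f : C →ₗ[k] FreeHopf k A C) (g : A →ₗ[k] FreeHopf k A C) (c : C) (a : A),
      LinearMap.mul' k _ (TensorProduct.map (f ∘ₗ p.toLinearMap) (g ∘ₗ q.toLinearMap)
        (Coalgebra.comul (c ⊗ₜ[k] a))) = f c * g a := by
    intro f g c a
    have : ∀ (u : C ⊗[k] C) (w : A ⊗[k] A),
      LinearMap.mul' k _ (TensorProduct.map (f ∘ₗ p.toLinearMap) (g ∘ₗ q.toLinearMap)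
        (TensorProduct.AlgebraTensorModule.tensorTensorTensorComm k k k k C C A A (u ⊗ₜ w))) =
      f (TensorProduct.rid k C (LinearMap.lTensor C Coalgebra.counit u)) *
        g (TensorProduct.lid k A (LinearMap.rTensor A Coalgebra.counit w)) := by
      intro u w
      induction u with
      | zero => simp
      | add p q hp hq => simp only [TensorProduct.add_tmul, map_add, hp, hq, add_mul]
      | tmul r s =>
        induction w with
        | zero => simp
        | add r s hr hs => simp only [TensorProduct.tmul_add, map_add, hr, hs, mul_add]
        | tmul y z =>
          simp [hp, hq, smul_smul, mul_comm]
    rw [TensorProduct.comul_tmul, this]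
    simp
  have key' : ∀ (f : C →ₗ[k] FreeHopf k A C) (g : A →ₗ[k] FreeHopf k A C) (c : C) (a : A),
      LinearMap.mul' k _ (TensorProduct.map (g ∘ₗ q.toLinearMap) (f ∘ₗ p.toLinearMap)
        (Coalgebra.comul (c ⊗ₜ[k] a))) = g a * f c := by
    intro f g c a
    have : ∀ (u : C ⊗[k] C) (w : A ⊗[k] A),
      LinearMap.mul' k _ (TensorProduct.map (g ∘ₗ q.toLinearMap) (f ∘ₗ p.toLinearMap)
        (TensorProduct.AlgebraTensorModule.tensorTensorTensorComm k k k k C C A A (u ⊗ₜ w))) =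
        g (TensorProduct.rid k A (LinearMap.lTensor A Coalgebra.counit w)) *
      f (TensorProduct.lid k C (LinearMap.rTensor C Coalgebra.counit u)) := by
      intro u w
      induction u with
      | zero => simp
      | add p q hp hq => simp only [TensorProduct.add_tmul, map_add, hp, hq, mul_add]
      | tmul r s =>
        induction w with
        | zero => simp
        | add r s hr hs => simp only [TensorProduct.tmul_add, map_add, hr, hs, add_mul]
        | tmul y z =>
          simp [hp, hq, smul_smul, mul_comm]
    rw [TensorProduct.comul_tmul, this]
    simp
  have e : LinearMap.mul' k _ ∘ₗ TensorProduct.map (X k A C 0 ∘ₗ p.toLinearMap)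
      (((J k A C).toLinearMap ∘ₗ LinearMap.id) ∘ₗ q.toLinearMap) ∘ₗ Coalgebra.comul =
      X k A C 0 ∘ₗ (RightModuleCoalgebra.act (k := k) (A := A) (C := C)).toLinearMap := by
    apply TensorProduct.ext'
    intro c a
    exact (key (X k A C 0) ((J k A C).toLinearMap ∘ₗ LinearMap.id) c a).trans
      (X_zero_act k A C c a).symm
  rw [e] at h3
  have h5 := LinearMap.congr_fun (h4.unique h3) (c ⊗ₜ[k] a)
  exact h5.trans (key' (X k A C 1) ((J k A C).toLinearMap ∘ₗ HopfAlgebra.antipode k) c a)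

/-- The antipode of `H(C, A)`, as a homomorphism into the opposite algebra. -/
def antipodeHom : FreeHopf k A C →ₐ[k] (FreeHopf k A C)ᵐᵒᵖ :=
  lift (fun n => (MulOpposite.opLinearEquiv k).toLinearMap ∘ₗ X k A C (n + 1))
    ((AlgHom.op (J k A C)).comp (HopfAlgebra.antipodeAlgHomOp k A))
    (by
      intro c a
      simpa using congrArg MulOpposite.op (X_one_act k A C c a))
    (by
      intro n
      have key : ∀ (f g : C →ₗ[k] FreeHopf k A C) (w : C ⊗[k] C),
          LinearMap.mul' k _ (TensorProduct.map
            ((MulOpposite.opLinearEquiv k).toLinearMap ∘ₗ f)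
            ((MulOpposite.opLinearEquiv k).toLinearMap ∘ₗ g) w) =
          MulOpposite.op (LinearMap.mul' k _ (TensorProduct.map g f
            (TensorProduct.comm k C C w))) := by
        intro f g w
        induction w with
        | zero => simp
        | tmul x y => simp
        | add x y hx hy => simp only [map_add, hx, hy, MulOpposite.op_add]
      have h := X_convInverse k A C (n + 1)
      refine ⟨fun c => (key _ _ _).trans ?_, fun c => (key _ _ _).trans ?_⟩
      · have := h.2 c
        change LinearMap.mul' k _ (TensorProduct.map _ _ (comulAt k C (n + 1) c)) = _ at this
        rw [comulAt_succ] at this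
        exact congrArg MulOpposite.op this
      · have := h.1 c
        change LinearMap.mul' k _ (TensorProduct.map _ _ (comulAt k C (n + 1) c)) = _ at this
        rw [comulAt_succ] at this
        exact congrArg MulOpposite.op this)

/-- The antipode of `H(C, A)` as a linear map. -/
def antipodeLin : FreeHopf k A C →ₗ[k] FreeHopf k A C :=
  (MulOpposite.opLinearEquiv k).symm.toLinearMap ∘ₗ (antipodeHom k A C).toLinearMap

@[simp] theorem antipodeLin_X (n : ℕ) (c : C) :
    antipodeLin k A C (X k A C n c) = X k A C (n + 1) c := by
  exact congrArg MulOpposite.unop (lift_X _ _ _ _ n c)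

@[simp] theorem antipodeLin_J (a : A) :
    antipodeLin k A C (J k A C a) = J k A C (HopfAlgebra.antipode k a) := by
  exact congrArg MulOpposite.unop (lift_J _ _ _ _ a)

@[simp] theorem antipodeLin_one : antipodeLin k A C 1 = 1 := by
  simp [antipodeLin]

theorem antipodeLin_mul (x y : FreeHopf k A C) :
    antipodeLin k A C (x * y) = antipodeLin k A C y * antipodeLin k A C x := by
  simp [antipodeLin]

@[simp] theorem antipodeLin_algebraMap (r : k) :
    antipodeLin k A C (algebraMap k _ r) = algebraMap k _ r := by
  simp [antipodeLin]

theorem antipode_left (h : FreeHopf k A C) :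
    LinearMap.mul' k _ (LinearMap.rTensor _ (antipodeLin k A C) (comulHom k A C h)) =
      algebraMap k _ (counitHom k A C h) := by
  induction h using induction with
  | hX n c =>
    have h := (X_convInverse k A C n).2 c
    have e : antipodeLin k A C ∘ₗ X k A C n = X k A C (n + 1) := by ext; simp
    rw [comulHom_X, counitHom_X, ← LinearMap.comp_apply (LinearMap.rTensor _ _),
      LinearMap.rTensor_comp_map, e]
    exact h
  | hJ a =>
    have h := ((convInverse_antipode k A).algHom_comp (J k A C)).2 a
    have e : antipodeLin k A C ∘ₗ (J k A C).toLinearMap =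
      (J k A C).toLinearMap ∘ₗ HopfAlgebra.antipode k := by ext; simp
    rw [comulHom_J, counitHom_J, ← LinearMap.comp_apply (LinearMap.rTensor _ _),
      LinearMap.rTensor_comp_map, e]
    exact h
  | hs r => simp [Algebra.TensorProduct.algebraMap_apply, -AlgHom.map_algebraMap]
  | hadd x y hx hy => simp only [map_add, hx, hy]
  | hmul x y hx hy =>
    have key : ∀ (u : FreeHopf k A C ⊗[k] FreeHopf k A C) (a b : FreeHopf k A C),
        LinearMap.mul' k _ (LinearMap.rTensor _ (antipodeLin k A C) (u * (a ⊗ₜ b))) =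
        antipodeLin k A C a *
          LinearMap.mul' k _ (LinearMap.rTensor _ (antipodeLin k A C) u) * b := by
      intro u a b
      induction u with
      | zero => simp
      | tmul p q => simp [antipodeLin_mul, mul_assoc]
      | add p q hp hq => simp only [add_mul, map_add, hp, hq, mul_add]
    have key2 : ∀ (w : FreeHopf k A C ⊗[k] FreeHopf k A C),
        LinearMap.mul' k _ (LinearMap.rTensor _ (antipodeLin k A C) (comulHom k A C x * w)) =
        counitHom k A C x •
          LinearMap.mul' k _ (LinearMap.rTensor _ (antipodeLin k A C) w) := by
      intro w
      induction w with
      | zero => simp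
      | tmul p q =>
        rw [key, hx]
        simp [Algebra.algebraMap_eq_smul_one]
      | add p q hp hq => simp only [mul_add, map_add, hp, hq, smul_add]
    rw [map_mul, key2, hy, map_mul, map_mul, Algebra.smul_def]

theorem antipode_right (h : FreeHopf k A C) :
    LinearMap.mul' k _ (LinearMap.lTensor _ (antipodeLin k A C) (comulHom k A C h)) =
      algebraMap k _ (counitHom k A C h) := by
  induction h using induction with
  | hX n c =>
    have h := (X_convInverse k A C n).1 c
    have e : antipodeLin k A C ∘ₗ X k A C n = X k A C (n + 1) := by ext; simp
    rw [comulHom_X, counitHom_X, ← LinearMap.comp_apply (LinearMap.lTensor _ _),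
      LinearMap.lTensor_comp_map, e]
    exact h
  | hJ a =>
    have h := ((convInverse_antipode k A).algHom_comp (J k A C)).1 a
    have e : antipodeLin k A C ∘ₗ (J k A C).toLinearMap =
      (J k A C).toLinearMap ∘ₗ HopfAlgebra.antipode k := by ext; simp
    rw [comulHom_J, counitHom_J, ← LinearMap.comp_apply (LinearMap.lTensor _ _),
      LinearMap.lTensor_comp_map, e]
    exact h
  | hs r => simp [Algebra.TensorProduct.algebraMap_apply, -AlgHom.map_algebraMap]
  | hadd x y hx hy => simp only [map_add, hx, hy]
  | hmul x y hx hy =>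
    have key : ∀ (u : FreeHopf k A C ⊗[k] FreeHopf k A C) (a b : FreeHopf k A C),
        LinearMap.mul' k _ (LinearMap.lTensor _ (antipodeLin k A C) ((a ⊗ₜ b) * u)) =
        a * LinearMap.mul' k _ (LinearMap.lTensor _ (antipodeLin k A C) u) *
          antipodeLin k A C b := by
      intro u a b
      induction u with
      | zero => simp
      | tmul p q => simp [antipodeLin_mul, mul_assoc]
      | add p q hp hq => simp only [mul_add, map_add, hp, hq, add_mul]
    have key2 : ∀ (w : FreeHopf k A C ⊗[k] FreeHopf k A C),
        LinearMap.mul' k _ (LinearMap.lTensor _ (antipodeLin k A C) (w * comulHom k A C y)) =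
        counitHom k A C y •
          LinearMap.mul' k _ (LinearMap.lTensor _ (antipodeLin k A C) w) := by
      intro w
      induction w with
      | zero => simp
      | tmul p q =>
        rw [key, hy]
        simp [Algebra.algebraMap_eq_smul_one]
      | add p q hp hq => simp only [add_mul, map_add, hp, hq, smul_add]
    rw [map_mul, key2, hx, map_mul, map_mul, Algebra.smul_def, Algebra.commutes]

instance : HopfAlgebra k (FreeHopf k A C) where
  antipode := antipodeLin k A C
  mul_antipode_rTensor_comul := by ext h; exact antipode_left k A C h
  mul_antipode_lTensor_comul := by ext h; exact antipode_right k A C h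

/-! #### The canonical maps and the universal property -/

/-- The canonical homomorphism of coalgebras `C → H(C, A)`. -/
def ofCoalgebra : C →ₗc[k] FreeHopf k A C where
  __ := X k A C 0
  counit_comp := by ext c; exact counitHom_X k A C 0 c
  map_comp_comul := by
    ext c
    have h := comulHom_X k A C 0 c
    rw [comulAt_zero] at h
    exact h.symm

/-- The canonical homomorphism of Hopf algebras `A → H(C, A)`. -/
def ofHopf : A →ₐc[k] FreeHopf k A C :=
  BialgHom.ofAlgHom (J k A C)
    (by ext a; exact counitHom_J k A C a)
    (by ext a; exact (comulHom_J k A C a).symm)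

theorem ofCoalgebra_act (c : C) (a : A) :
    ofCoalgebra k A C (RightModuleCoalgebra.act (c ⊗ₜ[k] a)) =
      ofCoalgebra k A C c * ofHopf k A C a :=
  X_zero_act k A C c a

/-- `H(C, A)` with its canonical maps is the initial object in the category of triples
`(H, f, φ)`, where `H` is a Hopf algebra, `f : C → H` is a homomorphism of coalgebras and
`φ : A → H` is a homomorphism of Hopf algebras such that `f (ca) = f c * φ a`. -/
theorem existsUnique_hom {H : Type*} [Ring H] [HopfAlgebra k H] (f : C →ₗc[k] H)
    (φ : A →ₐc[k] H)
    (hf : ∀ (c : C) (a : A), f (RightModuleCoalgebra.act (c ⊗ₜ[k] a)) = f c * φ a) :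
    ∃! t : FreeHopf k A C →ₐc[k] H,
      (∀ c, t (ofCoalgebra k A C c) = f c) ∧ (∀ a, t (ofHopf k A C a) = φ a) := by
  let S : H →ₗ[k] H := HopfAlgebra.antipode k
  let x : ℕ → C →ₗ[k] H := fun n => (S ^ n) ∘ₗ f.toLinearMap
  have xs : ∀ n c, x (n + 1) c = S (x n c) := by
    intro n c
    simp [x, pow_succ']
  have hSmul : ∀ a b, S (a * b) = S b * S a := HopfAlgebra.antipode_mul_antidistrib
  have hinv : ∀ n, InverseAt n (x n) (x (n + 1)) := by
    intro n
    induction n with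
    | zero =>
      have h := (convInverse_antipode k H).comp_coalgHom f
      refine ⟨fun c => ?_, fun c => ?_⟩
      · have := h.1 c
        rw [← comulAt_zero] at this
        exact this
      · have := h.2 c
        rw [← comulAt_zero] at this
        exact this
    | succ n ih =>
      have key : ∀ (p q : ℕ) (w : C ⊗[k] C),
          LinearMap.mul' k _ (TensorProduct.map (x (p + 1)) (x (q + 1))
            (TensorProduct.comm k C C w)) =
          S (LinearMap.mul' k _ (TensorProduct.map (x q) (x p) w)) := by
        intro p q w
        induction w with
        | zero => simp
        | tmul y z => simp [xs, hSmul]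
        | add y z hy hz => simp only [map_add, hy, hz]
      have hS : ∀ r : k, S (algebraMap k H r) = algebraMap k H r := by
        intro r; simp [S, Algebra.algebraMap_eq_smul_one]
      refine ⟨fun c => ?_, fun c => ?_⟩
      · change LinearMap.mul' k _ (TensorProduct.map _ _ (comulAt k C (n + 1) c)) = _
        rw [comulAt_succ]
        refine (key n (n + 1) _).trans ?_
        exact (congrArg S (ih.2 c)).trans (hS _)
      · change LinearMap.mul' k _ (TensorProduct.map _ _ (comulAt k C (n + 1) c)) = _
        rw [comulAt_succ]
        refine (key (n + 1) n _).trans ?_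
        exact (congrArg S (ih.1 c)).trans (hS _)
  have hSΔ : ∀ h : H, Coalgebra.comul (S h) =
      TensorProduct.map S S (TensorProduct.comm k H H (Coalgebra.comul h)) := by
    intro h
    have h1 := (convInverse_antipode k H).tensor
    have h2 := (convInverse_antipode k H).algHom_comp (Bialgebra.comulAlgHom k H)
    have e : TensorProduct.map (LinearMap.id : H →ₗ[k] H) (LinearMap.id : H →ₗ[k] H) ∘ₗ
        Coalgebra.comul = (Bialgebra.comulAlgHom k H).toLinearMap ∘ₗ LinearMap.id := by
      ext z; simp
    rw [e] at h1
    exact LinearMap.congr_fun (h2.unique h1) h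
  have xΔ : ∀ n c, Coalgebra.comul (x n c) =
      TensorProduct.map (x n) (x n) (comulAt k C n c) := by
    intro n
    induction n with
    | zero =>
      intro c
      rw [comulAt_zero]
      exact (CoalgHomClass.map_comp_comul_apply f c).symm
    | succ n ih =>
      intro c
      rw [xs, hSΔ, ih, comulAt_succ, LinearMap.comp_apply]
      generalize comulAt k C n c = w
      induction w with
      | zero => simp
      | tmul y z => simp [xs]
      | add y z hy hz => simp only [map_add, hy, hz]
  have xε : ∀ n c, (Coalgebra.counit (x n c) : k) = Coalgebra.counit c := by
    intro n
    induction n with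
    | zero => intro c; exact CoalgHomClass.counit_comp_apply f c
    | succ n ih => intro c; rw [xs]; simp [S, ih]
  let t0 : FreeHopf k A C →ₐ[k] H := lift x φ.toAlgHom hf hinv
  have t0X : ∀ n c, t0 (X k A C n c) = x n c := lift_X x φ.toAlgHom hf hinv
  have t0J : ∀ a, t0 (J k A C a) = φ a := lift_J x φ.toAlgHom hf hinv
  refine ⟨BialgHom.ofAlgHom t0 ?_ ?_, ⟨fun c => t0X 0 c, fun a => t0J a⟩, ?_⟩
  · apply algHom_ext
    · intro n c
      have e1 : (Bialgebra.counitAlgHom k (FreeHopf k A C)) (X k A C n c) =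
        Coalgebra.counit c := counitHom_X k A C n c
      rw [e1]
      simp [t0X, xε]
    · intro a
      have e1 : (Bialgebra.counitAlgHom k (FreeHopf k A C)) (J k A C a) =
        Coalgebra.counit a := counitHom_J k A C a
      rw [e1]
      simp [t0J]
  · apply algHom_ext
    · intro n c
      have e1 : (Bialgebra.comulAlgHom k (FreeHopf k A C)) (X k A C n c) = _ :=
        comulHom_X k A C n c
      simp only [AlgHom.comp_apply, e1, t0X, Bialgebra.comulAlgHom_apply, xΔ]
      generalize comulAt k C n c = w
      induction w with
      | zero => simp
      | tmul y z => simp [t0X]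
      | add y z hy hz => simp only [map_add, hy, hz]
    · intro a
      have e1 : (Bialgebra.comulAlgHom k (FreeHopf k A C)) (J k A C a) = _ :=
        comulHom_J k A C a
      simp only [AlgHom.comp_apply, e1, t0J, Bialgebra.comulAlgHom_apply]
      rw [← CoalgHomClass.map_comp_comul_apply φ a]
      generalize (Coalgebra.comul a : A ⊗[k] A) = w
      induction w with
      | zero => simp
      | tmul y z => simp [t0J]
      | add y z hy hz => simp only [map_add, hy, hz]
  · rintro t ⟨htC, htA⟩
    have hX : ∀ n, (t : FreeHopf k A C →ₐ[k] H).toLinearMap ∘ₗ X k A C n = x n := by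
      intro n
      induction n with
      | zero => ext c; exact htC c
      | succ n ih =>
        have h1 := @ConvInverse.algHom_comp k _ C _ _ (coalgAt k C n) _ _ _ _ _ _ _ _
          (X_convInverse k A C n) (t : FreeHopf k A C →ₐ[k] H)
        rw [ih] at h1
        exact @ConvInverse.unique k _ C _ _ (coalgAt k C n) _ _ _ _ _ _ h1 (hinv n)
    have : (t : FreeHopf k A C →ₐ[k] H) = t0 := by
      apply algHom_ext
      · intro n c
        rw [t0X, ← hX n]; rfl
      · intro a
        rw [t0J, ← htA a]; rfl
    ext z
    exact congrArg (fun s : FreeHopf k A C →ₐ[k] H => s z) this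

end FreeHopf

end FreeHopf

/-! ### The coendomorphism coalgebra of a finite-dimensional module -/

section Coend

variable (k : Type*) [Field k] (V : Type*) [AddCommGroup V] [Module k V]

/-- The dual space `Coend V = (End_k V)^*`. -/
def Coend : Type _ := Module.Dual k (Module.End k V)

namespace Coend

instance : AddCommGroup (Coend k V) := inferInstanceAs (AddCommGroup (Module.Dual k _))
instance : Module k (Coend k V) := inferInstanceAs (Module k (Module.Dual k _))

/-- The identification of `Coend V` with the dual space of `End_k V`. -/
def toDual : Coend k V ≃ₗ[k] Module.Dual k (Module.End k V) := LinearEquiv.refl k _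

variable [FiniteDimensional k V]

/-- The identification of `Coend V ⊗ Coend V` with the dual space of `End_k V ⊗ End_k V`. -/
def dualTensor : Coend k V ⊗[k] Coend k V ≃ₗ[k]
    Module.Dual k (Module.End k V ⊗[k] Module.End k V) :=
  (TensorProduct.congr (toDual k V) (toDual k V)).trans
    (TensorProduct.dualDistribEquiv k (Module.End k V) (Module.End k V))

theorem dualTensor_tmul (c d : Coend k V) (x y : Module.End k V) :
    dualTensor k V (c ⊗ₜ d) (x ⊗ₜ y) = toDual k V c x * toDual k V d y := rfl

/-- The comultiplication dual to the multiplication of `End_k V` and the counit dual to its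
unit. -/
instance : CoalgebraStruct k (Coend k V) where
  comul := (dualTensor k V).symm.toLinearMap ∘ₗ
    (LinearMap.mul' k (Module.End k V)).dualMap ∘ₗ (toDual k V).toLinearMap
  counit := LinearMap.applyₗ (1 : Module.End k V) ∘ₗ (toDual k V).toLinearMap

theorem dualTensor_comul (c : Coend k V) (x y : Module.End k V) :
    dualTensor k V (Coalgebra.comul c) (x ⊗ₜ y) = toDual k V c (x * y) := by
  change dualTensor k V ((dualTensor k V).symm _) (x ⊗ₜ y) = _
  rw [LinearEquiv.apply_symm_apply]
  simp

theorem counit_apply (c : Coend k V) :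
    (Coalgebra.counit c : k) = toDual k V c 1 := rfl

theorem ext_tensor {u w : Coend k V ⊗[k] Coend k V}
    (h : ∀ x y, dualTensor k V u (x ⊗ₜ y) = dualTensor k V w (x ⊗ₜ y)) : u = w := by
  apply (dualTensor k V).injective
  apply TensorProduct.ext'
  exact h

/-- The identification of the triple tensor product with a dual space. -/
def dualTensor₃ : Coend k V ⊗[k] (Coend k V ⊗[k] Coend k V) ≃ₗ[k]
    Module.Dual k (Module.End k V ⊗[k] (Module.End k V ⊗[k] Module.End k V)) :=
  (TensorProduct.congr (toDual k V) (dualTensor k V)).trans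
    (TensorProduct.dualDistribEquiv k (Module.End k V) (Module.End k V ⊗[k] Module.End k V))

theorem dualTensor₃_tmul (c : Coend k V) (d : Coend k V ⊗[k] Coend k V) (x : Module.End k V)
    (y : Module.End k V ⊗[k] Module.End k V) :
    dualTensor₃ k V (c ⊗ₜ d) (x ⊗ₜ y) = toDual k V c x * dualTensor k V d y := rfl

instance : Coalgebra k (Coend k V) where
  coassoc := by
    ext c
    apply (dualTensor₃ k V).injective
    apply TensorProduct.ext'
    intro x w
    induction w with
    | zero => simp
    | add p q hp hq => simp only [TensorProduct.tmul_add, map_add, hp, hq]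
    | tmul y z =>
      have h1 : ∀ w : Coend k V ⊗[k] Coend k V,
          dualTensor₃ k V (TensorProduct.assoc k _ _ _ (Coalgebra.comul.rTensor _ w))
            (x ⊗ₜ (y ⊗ₜ z)) = dualTensor k V w ((x * y) ⊗ₜ z) := by
        intro w
        induction w with
        | zero => simp
        | add p q hp hq => simp only [map_add, LinearMap.add_apply, hp, hq]
        | tmul c d =>
          rw [LinearMap.rTensor_tmul, dualTensor_tmul, ← dualTensor_comul]
          generalize (Coalgebra.comul c : Coend k V ⊗[k] Coend k V) = e
          induction e with
          | zero => simp
          | add p q hp hq =>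
            simp only [TensorProduct.add_tmul, map_add, LinearMap.add_apply, hp, hq, add_mul]
          | tmul c1 c2 =>
            rw [TensorProduct.assoc_tmul, dualTensor₃_tmul, dualTensor_tmul, dualTensor_tmul,
              mul_assoc]
      have h2 : ∀ w : Coend k V ⊗[k] Coend k V,
          dualTensor₃ k V (Coalgebra.comul.lTensor _ w)
            (x ⊗ₜ (y ⊗ₜ z)) = dualTensor k V w (x ⊗ₜ (y * z)) := by
        intro w
        induction w with
        | zero => simp
        | add p q hp hq => simp only [map_add, LinearMap.add_apply, hp, hq]
        | tmul c d =>
          rw [LinearMap.lTensor_tmul, dualTensor_tmul, dualTensor₃_tmul, dualTensor_comul]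
      exact (h1 _).trans (((dualTensor_comul k V c _ _).trans
        (by rw [mul_assoc, dualTensor_comul])).trans (h2 _).symm)
  rTensor_counit_comp_comul := by
    ext c
    apply (TensorProduct.lid k (Coend k V)).injective
    apply (toDual k V).injective
    ext x : 1
    have h1 : ∀ w : Coend k V ⊗[k] Coend k V,
        toDual k V (TensorProduct.lid k _ (Coalgebra.counit.rTensor _ w)) x =
          dualTensor k V w (1 ⊗ₜ x) := by
      intro w
      induction w with
      | zero => simp
      | add p q hp hq => simp only [map_add, LinearMap.add_apply, hp, hq]
      | tmul c d => simp [dualTensor_tmul, counit_apply]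
    exact (h1 _).trans ((dualTensor_comul k V c _ _).trans (by simp))
  lTensor_counit_comp_comul := by
    ext c
    apply (TensorProduct.rid k (Coend k V)).injective
    apply (toDual k V).injective
    ext x : 1
    have h1 : ∀ w : Coend k V ⊗[k] Coend k V,
        toDual k V (TensorProduct.rid k _ (Coalgebra.counit.lTensor _ w)) x =
          dualTensor k V w (x ⊗ₜ 1) := by
      intro w
      induction w with
      | zero => simp
      | add p q hp hq => simp only [map_add, LinearMap.add_apply, hp, hq]
      | tmul c d => simp [dualTensor_tmul, counit_apply, mul_comm]
    exact (h1 _).trans ((dualTensor_comul k V c _ _).trans (by simp))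

end Coend

section Action

variable (A : Type*) [Ring A] [HopfAlgebra k A] [Module A V] [IsScalarTower k A V]

/-- The map `a ⊗ b ↦ (β ↦ τ(a) ∘ β ∘ τ(S b))`, where `τ : A → End_k V` is the representation
of `A` on the left `A`-module `V`. -/
def sandwich : A ⊗[k] A →ₗ[k] Module.End k V →ₗ[k] Module.End k V :=
  TensorProduct.lift
    (LinearMap.mk₂ k
      (fun a b => LinearMap.mulLeft k (Algebra.lsmul k k V a) ∘ₗ
        LinearMap.mulRight k (Algebra.lsmul k k V (HopfAlgebra.antipode k b)))
      (by intros; ext; simp) (by intros; ext; simp)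
      (by intros; ext; simp) (by intros; ext; simp))

theorem sandwich_tmul (a b : A) (β : Module.End k V) :
    sandwich k V A (a ⊗ₜ b) β =
      Algebra.lsmul k k V a * β * Algebra.lsmul k k V (HopfAlgebra.antipode k b) :=
  (mul_assoc _ _ _).symm

/-- The left action `a ▷ β = ∑ τ(a₁) ∘ β ∘ τ(S a₂)` of a Hopf algebra `A` on `End_k V`, where
`τ : A → End_k V` is the representation of `A` on the left `A`-module `V`. -/
def endAct : A →ₗ[k] Module.End k V →ₗ[k] Module.End k V :=
  sandwich k V A ∘ₗ Coalgebra.comul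

variable {k V A}

theorem endAct_one (β : Module.End k V) : endAct k V A 1 β = β := by
  rw [endAct, LinearMap.comp_apply, Bialgebra.comul_one, Algebra.TensorProduct.one_def,
    sandwich_tmul]
  simp

theorem endAct_mul (a b : A) (β : Module.End k V) :
    endAct k V A (a * b) β = endAct k V A a (endAct k V A b β) := by
  have key : ∀ u w : A ⊗[k] A,
      sandwich k V A (u * w) β = sandwich k V A u (sandwich k V A w β) := by
    intro u w
    induction u with
    | zero => simp
    | add p q hp hq => simp only [add_mul, map_add, LinearMap.add_apply, hp, hq]
    | tmul a b =>
      induction w with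
      | zero => simp
      | add p q hp hq => simp only [mul_add, map_add, LinearMap.add_apply, hp, hq]
      | tmul c d =>
        rw [Algebra.TensorProduct.tmul_mul_tmul, sandwich_tmul, sandwich_tmul, sandwich_tmul,
          HopfAlgebra.antipode_mul_antidistrib, map_mul, map_mul]
        simp only [mul_assoc]
  rw [endAct, LinearMap.comp_apply, Bialgebra.comul_mul, key]
  rfl

theorem endAct_apply_one (a : A) :
    endAct k V A a 1 = algebraMap k _ (Coalgebra.counit a) := by
  have key : ∀ w : A ⊗[k] A, sandwich k V A w 1 = Algebra.lsmul k k V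
      (LinearMap.mul' k A (LinearMap.lTensor A (HopfAlgebra.antipode k) w)) := by
    intro w
    induction w with
    | zero => simp
    | add p q hp hq => simp only [map_add, LinearMap.add_apply, hp, hq]
    | tmul c d => rw [sandwich_tmul, LinearMap.lTensor_tmul, LinearMap.mul'_apply, map_mul, mul_one]
  rw [endAct, LinearMap.comp_apply, key, HopfAlgebra.mul_antipode_lTensor_comul_apply,
    AlgHom.commutes]

/-- `a ▷ (β γ) = ∑ (a₁ ▷ β) (a₂ ▷ γ)`. -/
theorem endAct_apply_mul (a : A) (β γ : Module.End k V) :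
    endAct k V A a (β * γ) = LinearMap.mul' k _ (TensorProduct.map
      ((endAct k V A).flip β) ((endAct k V A).flip γ) (Coalgebra.comul a)) := by
  let P : A →ₗ[k] Module.End k V := (Algebra.lsmul k k V).toLinearMap ∘ₗ LinearMap.id
  let Q : A →ₗ[k] Module.End k V := (Algebra.lsmul k k V).toLinearMap ∘ₗ HopfAlgebra.antipode k
  have hPQ : toConv Q * toConv P = 1 :=
    ((convInverse_iff _ _).1 ((convInverse_antipode k A).algHom_comp
      (Algebra.lsmul k k V : A →ₐ[k] Module.End k V))).2
  have hflip : ∀ β : Module.End k V, toConv ((endAct k V A).flip β) =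
      toConv P * toConv (LinearMap.mulLeft k β ∘ₗ Q) := by
    intro β
    have key : ∀ w : A ⊗[k] A, sandwich k V A w β = LinearMap.mul' k _
        (TensorProduct.map P (LinearMap.mulLeft k β ∘ₗ Q) w) := by
      intro w
      induction w with
      | zero => simp
      | add p q hp hq => simp only [map_add, LinearMap.add_apply, hp, hq]
      | tmul c d => rw [sandwich_tmul, mul_assoc]; rfl
    exact WithConv.ext (LinearMap.ext fun a => key _)
  have hleft : ∀ (β : Module.End k V) (f g : A →ₗ[k] Module.End k V),
      toConv (LinearMap.mulLeft k β ∘ₗ f) * toConv g =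
        toConv (LinearMap.mulLeft k β ∘ₗ (toConv f * toConv g).ofConv) := by
    intro β f g
    have key : ∀ w : A ⊗[k] A, LinearMap.mul' k _
        (TensorProduct.map (LinearMap.mulLeft k β ∘ₗ f) g w) =
        β * LinearMap.mul' k _ (TensorProduct.map f g w) := by
      intro w
      induction w with
      | zero => simp
      | add p q hp hq => simp only [map_add, mul_add, hp, hq]
      | tmul c d => exact mul_assoc β (f c) (g d)
    exact WithConv.ext (LinearMap.ext fun a => key _)
  have h : toConv ((endAct k V A).flip (β * γ)) =
      toConv ((endAct k V A).flip β) * toConv ((endAct k V A).flip γ) := by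
    rw [hflip, hflip, hflip, mul_assoc, ← mul_assoc _ (toConv P), hleft β Q P, hPQ,
      hleft β, toConv_ofConv, one_mul]
    congr 2
  exact congrArg (fun F : WithConv (A →ₗ[k] Module.End k V) => F a) h

variable (k V A) in
/-- The right action of `A` on `Coend V` dual to the left action on `End_k V`:
`(ca)(β) = c(a ▷ β)`. -/
def coendAct : Coend k V ⊗[k] A →ₗ[k] Coend k V :=
  TensorProduct.lift
    (((LinearMap.llcomp k (Module.End k V) (Module.End k V) k).flip ∘ₗ endAct k V A).flip ∘ₗ
      (Coend.toDual k V).toLinearMap)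

theorem coendAct_apply (c : Coend k V) (a : A) (β : Module.End k V) :
    Coend.toDual k V (coendAct k V A (c ⊗ₜ a)) β = Coend.toDual k V c (endAct k V A a β) := rfl

variable [FiniteDimensional k V]

/-- For a left `A`-module `V`, the coalgebra `Coend V` is a right `A`-module coalgebra. -/
instance : RightModuleCoalgebra k A (Coend k V) where
  act :=
    { coendAct k V A with
      counit_comp := by
        apply TensorProduct.ext'
        intro c a
        change Coend.toDual k V c (endAct k V A a 1) = _
        rw [endAct_apply_one]
        simp [Algebra.algebraMap_eq_smul_one, Coend.counit_apply]
      map_comp_comul := by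
        apply TensorProduct.ext'
        intro c a
        apply Coend.ext_tensor
        intro β γ
        have h := Coend.dualTensor_comul k V (coendAct k V A (c ⊗ₜ a)) β γ
        refine Eq.trans ?_ h.symm
        rw [coendAct_apply, endAct_apply_mul]
        have key : ∀ (u : Coend k V ⊗[k] Coend k V) (w : A ⊗[k] A),
            Coend.dualTensor k V (TensorProduct.map (coendAct k V A) (coendAct k V A)
              (TensorProduct.AlgebraTensorModule.tensorTensorTensorComm k k k k _ _ A A
                (u ⊗ₜ w))) (β ⊗ₜ γ) =
            Coend.dualTensor k V u (TensorProduct.map ((endAct k V A).flip β)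
              ((endAct k V A).flip γ) w) := by
          intro u w
          induction w with
          | zero => simp
          | add p q hp hq =>
            simp only [TensorProduct.tmul_add, map_add, LinearMap.add_apply, hp, hq]
          | tmul a b =>
            induction u with
            | zero => simp
            | add p q hp hq =>
              simp only [TensorProduct.add_tmul, map_add, LinearMap.add_apply, hp, hq]
            | tmul c d =>
              simp [Coend.dualTensor_tmul, coendAct_apply]
        refine (key _ _).trans ?_
        generalize (Coalgebra.comul a : A ⊗[k] A) = w
        induction w with
        | zero => simp
        | add p q hp hq => simp only [map_add, hp, hq]
        | tmul a b => simp [Coend.dualTensor_comul] }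
  act_one c := by
    apply (Coend.toDual k V).injective
    ext β : 1
    exact (coendAct_apply c 1 β).trans (by rw [endAct_one])
  act_mul c a b := by
    apply (Coend.toDual k V).injective
    ext β : 1
    exact (coendAct_apply c (a * b) β).trans (by rw [endAct_mul]; rfl)

end Action

end Coend
end HopfFree

end

/-!
Both maps are detected by a single representation. By the universal property of `H(C, A)` as an
algebra it is enough to find an algebra `R`, an injective homomorphism `φ : A → R`, and maps
`x n : C → R` such that `x 0` is equivariant and `x (n + 1)` inverts `x n` in the convolution
algebra or its twist, according to the parity of `n`. This settles `A`. For `C` one needs in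
addition an injective equivariant map `δ : C → R`, which need not be invertible: over the dual
numbers `R[ε]`, `x 0 + ε δ` extends to a chain of iterated inverses
(`FreeHopf.injective_of_chain`).

Infinite chains come from finite ones, in a product modulo eventual equality
(`FreeHopf.injective_of_finite_chains`). Finite chains come from approximate ones: if
`e n : C → B` is equivariant with inverse `f n`, and `f n - e (n + 1)` takes values in an ideal
that is locally finite, like the operators of finite rank, then an honest chain `x 0, …, x m`
exists over a purely transcendental extension of the field (`exists_finite_chain`). Nakayama's
lemma shows that invertibility survives infinitesimal perturbations of finite rank
(`ConvInverse.exists_perturb`). The point `x m + s (e m - x m)` of the line through `x m` and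
`e m` is a perturbation of `x m` near `s = 0`, so that it ends a chain of length `m`, and of `e m`
near `s = 1`, so that it is invertible; hence both hold for an indeterminate `s`. Equivariance is
inherited by inverses in both directions (`ActAt.succ_iff`), so it has to be ensured for the last
term only, and there it is a linear condition.

It remains to construct a single invertible equivariant `e` with inverse `f` and an
antiendomorphism `τ` of `B` that extends the antipode of `A` and satisfies `f ≡ τ e` modulo the
ideal; the approximate chain is then `e, τ e, τ² e, …`. Here `B` is the algebra of operators with
an adjoint on a space `L` of countable dimension, in which `A` acts on `A ⊕ L ≃ L` by left
multiplication and the counit, and `τ` is the adjoint with respect to a form that restricts to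
`l(S(a) a')` on `A`. Such an `l` exists since `A` is a Frobenius algebra (`exists_frobenius`); for
the same reason the vector `v₀` with zero annihilator gives an `A`-linear retraction `ρ` of `V`
onto `A`. With the projections `π v = ρ(v) v₀` and `π' = 1 - π`, which are fixed by the action of
`A`, the operator `e c` is the isometry from `A ⊕ L` to `V ⊕ L` that is the identity on `L`, with
weight `c π`, plus the isometry from the summand `L` of `A ⊕ L ≃ L` onto the whole of `L`, with
weight `c π'`, plus a correction of finite rank from `A` to `V` that makes the sum invertible
(`convInverse_equivMap`). The inverses of these isometries are their adjoints up to finite rank,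
whence `f ≡ τ e`.
-/

noncomputable section

namespace HopfFree

open WithConv

/-! ### Perturbing convolution inverses -/

section Perturb

/-- If `t` lies in the Jacobson radical of `O` and `N` is a finitely generated, multiplicatively
closed `O`-submodule of an `O`-algebra, then every element of `1 + tN` has an inverse in `1 + tN`:
by Nakayama's lemma, multiplication by it is onto on `N`. -/
theorem exists_inverse_one_add_smul {O Γ : Type*} [CommRing O] [Ring Γ] [Algebra O Γ] {t : O}
    (ht : t ∈ Ideal.jacobson (⊥ : Ideal O)) {N : Submodule O Γ} (hN : N.FG)
    (hmul : ∀ x ∈ N, ∀ y ∈ N, x * y ∈ N) {Φ : Γ} (hΦ : Φ ∈ N) :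
    ∃ Ψ ∈ N, (1 + t • Φ) * (1 + t • Ψ) = 1 ∧ (1 + t • Ψ) * (1 + t • Φ) = 1 := by
  have hI : Ideal.span {t} ≤ Ideal.jacobson (⊥ : Ideal O) :=
    (Ideal.span_singleton_le_iff_mem _).2 ht
  have surj : ∀ T : Γ →ₗ[O] Γ, (∀ x ∈ N, T x ∈ N) →
      ∃ Ψ ∈ N, Ψ + t • T Ψ = -Φ := by
    intro T hT
    have hle : N ≤ N.map (LinearMap.id + t • T) := by
      refine Submodule.le_of_le_smul_of_le_jacobson_bot hN hI fun x hx => ?_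
      have hx' : x = (LinearMap.id + t • T : Γ →ₗ[O] Γ) x + t • (-T x) := by simp
      rw [hx']
      exact Submodule.add_mem_sup (Submodule.mem_map_of_mem hx)
        (Submodule.smul_mem_smul (Ideal.mem_span_singleton_self t) (N.neg_mem (hT x hx)))
    obtain ⟨Ψ, hΨ, h⟩ := hle (N.neg_mem hΦ)
    exact ⟨Ψ, hΨ, by simpa using h⟩
  obtain ⟨Ψ, hΨ, h⟩ := surj (LinearMap.mulLeft O Φ) fun x hx => hmul _ hΦ _ hx
  obtain ⟨Ψ', -, h'⟩ := surj (LinearMap.mulRight O Φ) fun x hx => hmul _ hx _ hΦ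
  have e : (1 + t • Φ) * (1 + t • Ψ) = 1 := by
    have : (1 + t • Φ) * (1 + t • Ψ) = 1 + t • Φ + t • (Ψ + t • (Φ * Ψ)) := by
      simp only [mul_add, add_mul, one_mul, mul_one, smul_add, smul_mul_assoc, mul_smul_comm]
    rw [this]
    simp only [LinearMap.mulLeft_apply] at h
    rw [h, smul_neg, add_neg_cancel_right]
  have e' : (1 + t • Ψ') * (1 + t • Φ) = 1 := by
    have : (1 + t • Ψ') * (1 + t • Φ) = 1 + t • Φ + t • (Ψ' + t • (Ψ' * Φ)) := by
      simp only [mul_add, add_mul, one_mul, mul_one, smul_add, smul_mul_assoc, mul_smul_comm]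
      abel
    rw [this]
    simp only [LinearMap.mulRight_apply] at h'
    rw [h', smul_neg, add_neg_cancel_right]
  refine ⟨Ψ, hΨ, e, ?_⟩
  rwa [← left_inv_eq_right_inv e' e]

/-- A two-sided ideal, over the scalars `O`, in which every finite subset is contained in a
finitely generated subalgebra without unit. The guiding example is the ideal of operators of
finite rank. -/
structure LocallyFiniteIdeal (O R : Type*) [CommRing O] [Ring R] [Algebra O R] where
  /-- The underlying submodule. -/
  carrier : Submodule O R
  mul_left : ∀ r : R, ∀ x ∈ carrier, r * x ∈ carrier
  mul_right : ∀ r : R, ∀ x ∈ carrier, x * r ∈ carrier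
  exists_fg : ∀ s : Finset R, (s : Set R) ⊆ carrier → ∃ J ≤ carrier, J.FG ∧ (s : Set R) ⊆ J ∧
    ∀ x ∈ J, ∀ y ∈ J, x * y ∈ J

variable {k : Type*} [Field k]
variable {D : Type*} [AddCommGroup D] [Module k D] [Coalgebra k D]

theorem ConvInverse.symm {R : Type*} [Ring R] [Algebra k R] {u v : D →ₗ[k] R}
    (h : ConvInverse u v) : ConvInverse v u := ⟨h.2, h.1⟩

variable {O R : Type*} [CommRing O] [Ring R] [Algebra k R] [Algebra O R]

theorem conv_mul_mem {f g : WithConv (D →ₗ[k] R)} {J : AddSubgroup R}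
    (h : ∀ a b, f a * g b ∈ J) (d : D) : (f * g) d ∈ J := by
  rw [(Coalgebra.Repr.arbitrary k d).convMul_apply]
  exact J.sum_mem fun i _ => h _ _

variable [Algebra k O] [IsScalarTower k O R]

/-- Invertibility in a convolution algebra is stable under infinitesimal perturbations: this is
where finiteness of rank enters. -/
theorem ConvInverse.exists_perturb [FiniteDimensional k D] {t : O}
    (ht : t ∈ Ideal.jacobson (⊥ : Ideal O))
    (I : LocallyFiniteIdeal O R) {u v Ψ : D →ₗ[k] R} (h : ConvInverse u v)
    (hΨ : ∀ d, Ψ d ∈ I.carrier) :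
    ∃ Ψ' : D →ₗ[k] R, (∀ d, Ψ' d ∈ I.carrier) ∧ ConvInverse (u + t • Ψ') (v + t • Ψ) := by
  classical
  rw [convInverse_iff] at h
  set Φ : WithConv (D →ₗ[k] R) := toConv u * toConv Ψ with hΦdef
  have hΦ : ∀ d, Φ d ∈ I.carrier := fun d =>
    conv_mul_mem (J := I.carrier.toAddSubgroup) (fun a b => I.mul_left _ _ (hΨ b)) d
  let b := Module.finBasis k D
  obtain ⟨J, hJI, hJfg, hJ, hJmul⟩ := I.exists_fg (Finset.univ.image fun i => Φ (b i)) (by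
    intro x hx
    simp only [Finset.coe_image, Finset.coe_univ, Set.image_univ, Set.mem_range] at hx
    obtain ⟨i, rfl⟩ := hx
    exact hΦ _)
  let e : (Fin (Module.finrank k D) → R) ≃ₗ[O] WithConv (D →ₗ[k] R) :=
    (b.constr O).trans (WithConv.linearEquiv O _).symm
  let N : Submodule O (WithConv (D →ₗ[k] R)) :=
    (Submodule.pi Set.univ fun _ => J).map e.toLinearMap
  have memN : ∀ Θ : WithConv (D →ₗ[k] R), Θ ∈ N ↔ ∀ i, Θ (b i) ∈ J := by
    intro Θ
    constructor
    · rintro ⟨f, hf, rfl⟩ i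
      have : (e f) (b i) = f i := by
        change (b.constr O f) (b i) = f i
        simp
      exact this ▸ hf i trivial
    · intro hΘ
      refine ⟨fun i => Θ (b i), fun i _ => hΘ i, ?_⟩
      apply WithConv.ext
      apply b.ext
      intro i
      change (b.constr O _) (b i) = _
      simp
  have memN' : ∀ Θ : WithConv (D →ₗ[k] R), Θ ∈ N → ∀ d, Θ d ∈ J := by
    intro Θ hΘ d
    rw [← b.sum_repr d]
    change Θ.ofConv _ ∈ J
    rw [map_sum]
    refine J.sum_mem fun i _ => ?_
    rw [map_smul, ← algebraMap_smul O]
    exact J.smul_mem _ ((memN Θ).1 hΘ i)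
  have hN : N.FG := Submodule.FG.map _ (Submodule.fg_pi fun _ => hJfg)
  have hNmul : ∀ x ∈ N, ∀ y ∈ N, x * y ∈ N := fun x hx y hy => (memN _).2 fun i =>
    conv_mul_mem (J := J.toAddSubgroup)
      (fun a c => hJmul _ (memN' x hx a) _ (memN' y hy c)) _
  have hΦN : Φ ∈ N := (memN Φ).2 fun i => hJ (by simp)
  obtain ⟨Ψ₁, hΨ₁, e1, e2⟩ := exists_inverse_one_add_smul ht hN hNmul hΦN
  refine ⟨(Ψ₁ * toConv u).ofConv, fun d => ?_, ?_⟩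
  · exact conv_mul_mem (J := I.carrier.toAddSubgroup)
      (fun a c => I.mul_right _ _ (hJI (memN' _ hΨ₁ a))) d
  · rw [convInverse_iff]
    have hu : toConv (u + t • (Ψ₁ * toConv u).ofConv) = (1 + t • Ψ₁) * toConv u := by
      rw [add_mul, one_mul, smul_mul_assoc]; rfl
    have hv : toConv (v + t • Ψ) = toConv v * (1 + t • Φ) := by
      rw [mul_add, mul_one, mul_smul_comm, hΦdef, ← mul_assoc, h.2, one_mul]; rfl
    rw [hu, hv]
    constructor
    · rw [mul_assoc, ← mul_assoc (toConv u), h.1, one_mul, e2]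
    · rw [mul_assoc, ← mul_assoc (1 + t • Φ), e1, one_mul, h.2]

end Perturb

/-! ### Equivariant maps and iterated convolution inverses -/

section Anti

variable {k : Type*} [CommRing k] {C : Type*} [AddCommGroup C] [Module k C] [Coalgebra k C]
variable {R : Type*} [Ring R] [Algebra k R] {R' : Type*} [Ring R'] [Algebra k R']

/-- An antihomomorphism of algebras turns convolution inverses into twist convolution inverses, and
vice versa. -/
theorem InverseAt.anti {n : ℕ} {x y : C →ₗ[k] R} (h : InverseAt n x y) (τ : R →ₗ[k] R')
    (hmul : ∀ a b, τ (a * b) = τ b * τ a) (hone : τ 1 = 1) :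
    InverseAt (n + 1) (τ ∘ₗ x) (τ ∘ₗ y) := by
  have key : ∀ (f g : C →ₗ[k] R) (w : C ⊗[k] C),
      LinearMap.mul' k R' (TensorProduct.map (τ ∘ₗ f) (τ ∘ₗ g) (TensorProduct.comm k C C w)) =
        τ (LinearMap.mul' k R (TensorProduct.map g f w)) := by
    intro f g w
    induction w with
    | zero => simp
    | tmul y z => simp [hmul]
    | add y z hy hz => simp only [map_add, hy, hz]
  have hr : ∀ r : k, τ (algebraMap k R r) = algebraMap k R' r := by
    intro r; simp [Algebra.algebraMap_eq_smul_one, hone]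
  refine ⟨fun c => ?_, fun c => ?_⟩
  · change LinearMap.mul' k _ (TensorProduct.map _ _ (comulAt k C (n + 1) c)) = _
    rw [comulAt_succ]
    exact (key x y _).trans ((congrArg τ (h.2 c)).trans (hr _))
  · change LinearMap.mul' k _ (TensorProduct.map _ _ (comulAt k C (n + 1) c)) = _
    rw [comulAt_succ]
    exact (key y x _).trans ((congrArg τ (h.1 c)).trans (hr _))

theorem inverseAt_of_even {n : ℕ} (hn : Even n) {x y : C →ₗ[k] R} :
    InverseAt n x y ↔ ConvInverse x y := by
  have h : comulAt k C n = Coalgebra.comul := if_pos hn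
  constructor
  · intro H
    refine ⟨fun c => ?_, fun c => ?_⟩
    · rw [← h]; exact H.1 c
    · rw [← h]; exact H.2 c
  · intro H
    refine ⟨fun c => ?_, fun c => ?_⟩
    · change LinearMap.mul' k _ (TensorProduct.map _ _ (comulAt k C n c)) = _
      rw [h]; exact H.1 c
    · change LinearMap.mul' k _ (TensorProduct.map _ _ (comulAt k C n c)) = _
      rw [h]; exact H.2 c

theorem InverseAt.algHom_comp {n : ℕ} {x y : C →ₗ[k] R} (h : InverseAt n x y) (t : R →ₐ[k] R') :
    InverseAt n (t.toLinearMap ∘ₗ x) (t.toLinearMap ∘ₗ y) :=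
  @ConvInverse.algHom_comp k _ C _ _ (coalgAt k C n) _ _ _ _ _ _ _ _ h t

theorem InverseAt.exists_perturb {k : Type*} [Field k] {C : Type*} [AddCommGroup C] [Module k C]
    [Coalgebra k C] [FiniteDimensional k C] {O R : Type*} [CommRing O] [Ring R] [Algebra k R]
    [Algebra O R] [Algebra k O] [IsScalarTower k O R] {t : O}
    (ht : t ∈ Ideal.jacobson (⊥ : Ideal O)) (I : LocallyFiniteIdeal O R) {n : ℕ}
    {u v Ψ : C →ₗ[k] R} (h : InverseAt n u v) (hΨ : ∀ d, Ψ d ∈ I.carrier) :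
    ∃ Ψ' : C →ₗ[k] R, (∀ d, Ψ' d ∈ I.carrier) ∧ InverseAt n (u + t • Ψ') (v + t • Ψ) :=
  @ConvInverse.exists_perturb k _ C _ _ (coalgAt k C n) O R _ _ _ _ _ _ _ t ht I u v Ψ h hΨ

theorem InverseAt.symm {n : ℕ} {x y : C →ₗ[k] R} (h : InverseAt n x y) : InverseAt n y x :=
  ⟨h.2, h.1⟩

end Anti

section ActAt

variable {k A C : Type*} [CommRing k] [Ring A] [HopfAlgebra k A]
  [AddCommGroup C] [Module k C] [Coalgebra k C] [RightModuleCoalgebra k A C]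
variable {R : Type*} [Ring R] [Algebra k R]

open RightModuleCoalgebra (act)

/-- Passing to convolution inverses turns right equivariance into left equivariance. -/
theorem ConvInverse.act_iff {x y : C →ₗ[k] R} {ψ ψ' : A →ₗ[k] R} (h : ConvInverse x y)
    (hψ : ConvInverse ψ ψ') :
    (∀ c a, x (act (c ⊗ₜ[k] a)) = x c * ψ a) ↔ ∀ c a, y (act (c ⊗ₜ[k] a)) = ψ' a * y c := by
  let p : C ⊗[k] A →ₗc[k] C :=
    (Coalgebra.TensorProduct.rid k k C : C ⊗[k] k →ₗc[k] C).comp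
      (Coalgebra.TensorProduct.map (CoalgHom.id k C) (Coalgebra.counitCoalgHom k A))
  let q : C ⊗[k] A →ₗc[k] A :=
    (Coalgebra.TensorProduct.lid k A : k ⊗[k] A →ₗc[k] A).comp
      (Coalgebra.TensorProduct.map (Coalgebra.counitCoalgHom k C) (CoalgHom.id k A))
  have hp : ∀ c a, p (c ⊗ₜ[k] a) = (Coalgebra.counit a : k) • c := fun c a => rfl
  have hq : ∀ c a, q (c ⊗ₜ[k] a) = (Coalgebra.counit c : k) • a := fun c a => rfl
  have key : ∀ (f : C →ₗ[k] R) (g : A →ₗ[k] R) (c : C) (a : A),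
      LinearMap.mul' k _ (TensorProduct.map (f ∘ₗ p.toLinearMap) (g ∘ₗ q.toLinearMap)
        (Coalgebra.comul (c ⊗ₜ[k] a))) = f c * g a := by
    intro f g c a
    have : ∀ (u : C ⊗[k] C) (w : A ⊗[k] A),
      LinearMap.mul' k _ (TensorProduct.map (f ∘ₗ p.toLinearMap) (g ∘ₗ q.toLinearMap)
        (TensorProduct.AlgebraTensorModule.tensorTensorTensorComm k k k k C C A A (u ⊗ₜ w))) =
      f (TensorProduct.rid k C (LinearMap.lTensor C Coalgebra.counit u)) *
        g (TensorProduct.lid k A (LinearMap.rTensor A Coalgebra.counit w)) := by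
      intro u w
      induction u with
      | zero => simp
      | add p q hp hq => simp only [TensorProduct.add_tmul, map_add, hp, hq, add_mul]
      | tmul r s =>
        induction w with
        | zero => simp
        | add r s hr hs => simp only [TensorProduct.tmul_add, map_add, hr, hs, mul_add]
        | tmul y z => simp [hp, hq, smul_smul, mul_comm]
    rw [TensorProduct.comul_tmul, this]
    simp
  have key' : ∀ (f : C →ₗ[k] R) (g : A →ₗ[k] R) (c : C) (a : A),
      LinearMap.mul' k _ (TensorProduct.map (g ∘ₗ q.toLinearMap) (f ∘ₗ p.toLinearMap)
        (Coalgebra.comul (c ⊗ₜ[k] a))) = g a * f c := by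
    intro f g c a
    have : ∀ (u : C ⊗[k] C) (w : A ⊗[k] A),
      LinearMap.mul' k _ (TensorProduct.map (g ∘ₗ q.toLinearMap) (f ∘ₗ p.toLinearMap)
        (TensorProduct.AlgebraTensorModule.tensorTensorTensorComm k k k k C C A A (u ⊗ₜ w))) =
        g (TensorProduct.rid k A (LinearMap.lTensor A Coalgebra.counit w)) *
      f (TensorProduct.lid k C (LinearMap.rTensor C Coalgebra.counit u)) := by
      intro u w
      induction u with
      | zero => simp
      | add p q hp hq => simp only [TensorProduct.add_tmul, map_add, hp, hq, mul_add]
      | tmul r s =>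
        induction w with
        | zero => simp
        | add r s hr hs => simp only [TensorProduct.tmul_add, map_add, hr, hs, add_mul]
        | tmul y z => simp [hp, hq, smul_smul, mul_comm]
    rw [TensorProduct.comul_tmul, this]
    simp
  have h3 := (h.comp_coalgHom p).mul (hψ.comp_coalgHom q)
  have h4 := h.comp_coalgHom (act (k := k) (A := A) (C := C))
  constructor
  · intro H c a
    have e : LinearMap.mul' k _ ∘ₗ TensorProduct.map (x ∘ₗ p.toLinearMap)
        (ψ ∘ₗ q.toLinearMap) ∘ₗ Coalgebra.comul =
        x ∘ₗ (act (k := k) (A := A) (C := C)).toLinearMap := by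
      apply TensorProduct.ext'
      intro c a
      exact (key x ψ c a).trans (H c a).symm
    rw [e] at h3
    exact (LinearMap.congr_fun (h4.unique h3) (c ⊗ₜ[k] a)).trans (key' y ψ' c a)
  · intro H c a
    have e : LinearMap.mul' k _ ∘ₗ TensorProduct.map (ψ' ∘ₗ q.toLinearMap)
        (y ∘ₗ p.toLinearMap) ∘ₗ Coalgebra.comul =
        y ∘ₗ (act (k := k) (A := A) (C := C)).toLinearMap := by
      apply TensorProduct.ext'
      intro c a
      exact (key' y ψ' c a).trans (H c a).symm
    rw [e] at h3
    have h3' : ConvInverse _ _ := ⟨h3.2, h3.1⟩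
    have h4' : ConvInverse _ _ := ⟨h4.2, h4.1⟩
    exact (LinearMap.congr_fun (h4'.unique h3') (c ⊗ₜ[k] a)).trans (key x ψ c a)

/-- The equivariance that the `n`-th term of a sequence of iterated inverses inherits from
`x₀ (ca) = x₀ c * φ a`: on the right for `n` even, on the left for `n` odd, in either case twisted
by the `n`-th power of the antipode. -/
def ActAt (φ : A →ₐ[k] R) (n : ℕ) (x : C →ₗ[k] R) : Prop :=
  ∀ c a, x (act (c ⊗ₜ[k] a)) =
    if Even n then x c * φ ((HopfAlgebra.antipode k (A := A) ^ n) a)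
    else φ ((HopfAlgebra.antipode k (A := A) ^ n) a) * x c

theorem inverseAt_antipode_pow (n : ℕ) :
    InverseAt n (HopfAlgebra.antipode k (A := A) ^ n)
      (HopfAlgebra.antipode k (A := A) ^ (n + 1)) := by
  induction n with
  | zero =>
    rw [inverseAt_of_even (by simp)]
    simp only [pow_zero, zero_add, pow_one]
    exact convInverse_antipode k A
  | succ n ih =>
    have := ih.anti (HopfAlgebra.antipode k (A := A)) HopfAlgebra.antipode_mul_antidistrib (by simp)
    rw [pow_succ' _ (n + 1)]
    rw [pow_succ' _ n] at this ⊢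
    exact this

theorem ActAt.succ_iff {φ : A →ₐ[k] R} {n : ℕ} {x y : C →ₗ[k] R} (h : InverseAt n x y) :
    ActAt φ (n + 1) y ↔ ActAt φ n x := by
  have hS := (inverseAt_antipode_pow (k := k) (A := A) n).algHom_comp φ
  by_cases hn : Even n
  · have hn' : ¬ Even (n + 1) := by simpa [Nat.even_add_one] using hn
    rw [inverseAt_of_even hn] at h hS
    simp only [ActAt, hn, hn', if_true, if_false]
    exact (h.act_iff hS).symm
  · have hn' : Even (n + 1) := by simpa [Nat.even_add_one] using hn
    have h' := h.anti (MulOpposite.opLinearEquiv k (M := R)).toLinearMap (by simp) (by simp)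
    have hS' := hS.anti (MulOpposite.opLinearEquiv k (M := R)).toLinearMap (by simp) (by simp)
    rw [inverseAt_of_even hn'] at h' hS'
    have := h'.act_iff hS'
    simp only [ActAt, hn, hn', if_true, if_false]
    refine Iff.trans ?_ (Iff.trans this.symm ?_)
    · refine forall_congr' fun c => forall_congr' fun a => ?_
      exact MulOpposite.op_injective.eq_iff.symm
    · refine forall_congr' fun c => forall_congr' fun a => ?_
      exact MulOpposite.op_injective.eq_iff

theorem ActAt.anti {φ : A →ₐ[k] R} {n : ℕ} {x : C →ₗ[k] R} (h : ActAt φ n x) (τ : R →ₗ[k] R)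
    (hmul : ∀ a b, τ (a * b) = τ b * τ a) (hφ : ∀ a, τ (φ a) = φ (HopfAlgebra.antipode k a)) :
    ActAt φ (n + 1) (τ ∘ₗ x) := by
  intro c a
  have := congrArg τ (h c a)
  rw [LinearMap.comp_apply, this]
  by_cases hn : Even n
  · have hn' : ¬ Even (n + 1) := by simpa [Nat.even_add_one] using hn
    simp [hn, hn', hmul, hφ, pow_succ']
  · have hn' : Even (n + 1) := by simpa [Nat.even_add_one] using hn
    simp [hn, hn', hmul, hφ, pow_succ']

theorem ActAt.algHom_comp {φ : A →ₐ[k] R} {n : ℕ} {x : C →ₗ[k] R} (h : ActAt φ n x)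
    {R' : Type*} [Ring R'] [Algebra k R'] (t : R →ₐ[k] R') :
    ActAt (t.comp φ) n (t.toLinearMap ∘ₗ x) := by
  intro c a
  have := congrArg t (h c a)
  by_cases hn : Even n <;> simp_all

end ActAt

/-! ### Deforming finite chains of iterated inverses -/

section BaseChange

variable {k B : Type*} [Field k] [Ring B] [Algebra k B]

/-- The ideal generated by a locally finite ideal after an extension of scalars. -/
def LocallyFiniteIdeal.baseChange (I : LocallyFiniteIdeal k B) (O : Type*) [CommRing O]
    [Algebra k O] : LocallyFiniteIdeal O (O ⊗[k] B) where
  carrier := I.carrier.baseChange O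
  mul_left r x hx := by
    rw [Submodule.baseChange_eq_span] at hx ⊢
    induction hx using Submodule.span_induction with
    | zero => simp
    | add x y _ _ hx hy => rw [mul_add]; exact add_mem hx hy
    | smul o x _ hx => rw [mul_smul_comm]; exact Submodule.smul_mem _ _ hx
    | mem x hx =>
      obtain ⟨b, hb, rfl⟩ := hx
      rw [← Submodule.baseChange_eq_span]
      induction r with
      | zero => simp
      | add r s hr hs => rw [add_mul]; exact add_mem hr hs
      | tmul o r =>
        rw [TensorProduct.mk_apply, Algebra.TensorProduct.tmul_mul_tmul]
        exact Submodule.tmul_mem_baseChange_of_mem _ (I.mul_left r b hb)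
  mul_right r x hx := by
    rw [Submodule.baseChange_eq_span] at hx ⊢
    induction hx using Submodule.span_induction with
    | zero => simp
    | add x y _ _ hx hy => rw [add_mul]; exact add_mem hx hy
    | smul o x _ hx => rw [smul_mul_assoc]; exact Submodule.smul_mem _ _ hx
    | mem x hx =>
      obtain ⟨b, hb, rfl⟩ := hx
      rw [← Submodule.baseChange_eq_span]
      induction r with
      | zero => simp
      | add r s hr hs => rw [mul_add]; exact add_mem hr hs
      | tmul o r =>
        rw [TensorProduct.mk_apply, Algebra.TensorProduct.tmul_mul_tmul]
        exact Submodule.tmul_mem_baseChange_of_mem _ (I.mul_right r b hb)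
  exists_fg s hs := by
    classical
    have h : ∃ F : Finset B, (F : Set B) ⊆ I.carrier ∧
        (s : Set (O ⊗[k] B)) ⊆ Submodule.span O ((fun b => (1 : O) ⊗ₜ[k] b) '' (F : Set B)) := by
      induction s using Finset.induction_on with
      | empty => exact ⟨∅, by simp, by simp⟩
      | insert a s _ ih =>
        obtain ⟨F, hF, hsF⟩ := ih fun x hx => hs (by simp_all)
        have ha : a ∈ I.carrier.baseChange O := hs (by simp)
        rw [Submodule.baseChange_eq_span] at ha
        obtain ⟨T, hT, haT⟩ := Submodule.mem_span_finite_of_mem_span ha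
        obtain ⟨F', hF', rfl⟩ := Finset.subset_set_image_iff.1
          (show (T : Set (O ⊗[k] B)) ⊆ (fun b => (1 : O) ⊗ₜ[k] b) '' (I.carrier : Set B) from hT)
        refine ⟨F ∪ F', by simp [hF, hF'], fun x hx => ?_⟩
        rw [Finset.coe_insert] at hx
        rcases hx with rfl | hx
        · exact Submodule.span_mono (by
            rw [Finset.coe_image, Finset.coe_union]
            exact Set.image_mono Set.subset_union_right) haT
        · exact Submodule.span_mono (Set.image_mono (by simp)) (hsF hx)
    obtain ⟨F, hF, hsF⟩ := h
    obtain ⟨J, hJI, hJfg, hFJ, hJmul⟩ := I.exists_fg F hF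
    refine ⟨J.baseChange O, ?_, ?_, ?_, ?_⟩
    · exact Submodule.baseChange_mono O hJI
    · obtain ⟨T, rfl⟩ := hJfg
      rw [Submodule.baseChange_span]
      exact Submodule.fg_span (T.finite_toSet.image _)
    · refine hsF.trans ?_
      rw [Submodule.baseChange_eq_span]
      exact Submodule.span_mono (Set.image_mono hFJ)
    · intro x hx y hy
      rw [Submodule.baseChange_eq_span] at hx hy
      induction hx using Submodule.span_induction with
      | zero => simp
      | add x z _ _ hx hz => rw [add_mul]; exact add_mem hx hz
      | smul o x _ hx => rw [smul_mul_assoc]; exact Submodule.smul_mem _ _ hx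
      | mem x hx =>
        obtain ⟨b, hb, rfl⟩ := hx
        induction hy using Submodule.span_induction with
        | zero => simp
        | add x z _ _ hx hz => rw [mul_add]; exact add_mem hx hz
        | smul o x _ hx => rw [mul_smul_comm]; exact Submodule.smul_mem _ _ hx
        | mem y hy =>
          obtain ⟨c, hc, rfl⟩ := hy
          have : ((TensorProduct.mk k O B) 1) b * ((TensorProduct.mk k O B) 1) c =
            (1 : O) ⊗ₜ[k] (b * c) := by simp
          rw [this]
          exact Submodule.tmul_mem_baseChange_of_mem _ (hJmul b hb c hc)

variable (B) in
/-- Extension of scalars along `h : O → L`, as a homomorphism `O ⊗ B → L ⊗ B`. -/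
abbrev scalarMap {O L : Type*} [CommRing O] [CommRing L] [Algebra k O] [Algebra k L]
    (h : O →ₐ[k] L) : O ⊗[k] B →ₐ[k] L ⊗[k] B :=
  Algebra.TensorProduct.map h (AlgHom.id k B)

variable {O L : Type*} [CommRing O] [CommRing L] [Algebra k O] [Algebra k L]

theorem scalarMap_smul (h : O →ₐ[k] L) (o : O) (x : O ⊗[k] B) :
    scalarMap B h (o • x) = h o • scalarMap B h x := by
  induction x with
  | zero => simp
  | add x y hx hy => simp only [smul_add, map_add, hx, hy]
  | tmul p q => simp [TensorProduct.smul_tmul']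

theorem scalarMap_mem (h : O →ₐ[k] L) (I : LocallyFiniteIdeal k B) {x : O ⊗[k] B}
    (hx : x ∈ (I.baseChange O).carrier) : scalarMap B h x ∈ (I.baseChange L).carrier := by
  change x ∈ I.carrier.baseChange O at hx
  rw [Submodule.baseChange_eq_span] at hx
  induction hx using Submodule.span_induction with
  | zero => simp
  | add x y _ _ hx hy => rw [map_add]; exact add_mem hx hy
  | smul o x _ hx => rw [scalarMap_smul]; exact Submodule.smul_mem _ _ hx
  | mem x hx =>
    obtain ⟨b, hb, rfl⟩ := hx
    have : scalarMap B h ((TensorProduct.mk k O B) 1 b) = (1 : L) ⊗ₜ[k] b := by simp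
    rw [this]
    exact Submodule.tmul_mem_baseChange_of_mem (1 : L) hb

end BaseChange

/-- A field extension `L` of `K` and a ring `O` over `K`, with an infinitesimal element `t`, that
maps to `L` in two ways: one sends `t` to `s` and the other one to `1 - s`. Here `L = K(s)`, and
`O` is the localization of `K[t]` at the polynomials with constant coefficient `1`. -/
theorem exists_two_specializations.{u, v} (k : Type u) (K : Type v) [Field k] [Field K]
    [Algebra k K] :
    ∃ (O L : Type v) (_ : CommRing O) (_ : Field L) (_ : Algebra k O) (_ : Algebra k L)
      (i : K →ₐ[k] O) (h₀ h₁ : O →ₐ[k] L) (t : O), t ∈ Ideal.jacobson (⊥ : Ideal O) ∧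
        h₀.comp i = h₁.comp i ∧ h₀ t + h₁ t = 1 := by
  let M : Submonoid (Polynomial K) :=
    Submonoid.comap (Polynomial.constantCoeff (R := K) : Polynomial K →* K) ⊥
  have memM : ∀ p : Polynomial K, p ∈ M ↔ p.coeff 0 = 1 := fun p => by simp [M]
  let ι : Polynomial K →ₐ[k] FractionRing (Polynomial K) :=
    IsScalarTower.toAlgHom k (Polynomial K) (FractionRing (Polynomial K))
  have hι : ∀ p, p ≠ 0 → IsUnit (ι p) := fun p hp =>
    isUnit_iff_ne_zero.2 ((map_ne_zero_iff _ (IsFractionRing.injective _ _)).2 hp)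
  let r : Polynomial K →ₐ[k] Polynomial K :=
    (Polynomial.aeval (1 - Polynomial.X : Polynomial K)).restrictScalars k
  have hM₀ : ∀ p : M, IsUnit (ι p) := by
    rintro ⟨p, hp⟩
    refine hι p ?_
    rintro rfl
    simp [memM] at hp
  have hM₁ : ∀ p : M, IsUnit ((ι.comp r) p) := by
    rintro ⟨p, hp⟩
    refine hι (r p) fun h => ?_
    have h1 : (r p).eval 1 = 0 := by rw [h]; simp
    have h2 : (r p).eval 1 = p.eval 0 := by
      change (Polynomial.aeval (1 - Polynomial.X : Polynomial K) p).eval 1 = _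
      rw [← Polynomial.comp_eq_aeval, Polynomial.eval_comp]
      simp
    rw [h2, ← Polynomial.coeff_zero_eq_eval_zero, (memM p).1 hp] at h1
    exact one_ne_zero h1
  refine ⟨Localization M, FractionRing (Polynomial K), inferInstance, inferInstance, inferInstance,
    inferInstance, (IsScalarTower.toAlgHom k (Polynomial K) (Localization M)).comp
      (IsScalarTower.toAlgHom k K (Polynomial K)),
    IsLocalization.liftAlgHom (M := M) (f := ι) hM₀,
    IsLocalization.liftAlgHom (M := M) (f := ι.comp r) hM₁,
    algebraMap (Polynomial K) (Localization M) Polynomial.X, ?_, ?_, ?_⟩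
  · rw [Ideal.mem_jacobson_bot]
    intro y
    obtain ⟨p, q, rfl⟩ := IsLocalization.exists_mk'_eq M y
    have hq : Polynomial.X * p + (q : Polynomial K) ∈ M := by
      rw [memM]; simpa using (memM q).1 q.2
    have h : algebraMap (Polynomial K) (Localization M) (Polynomial.X * p + (q : Polynomial K)) =
        (algebraMap (Polynomial K) (Localization M) Polynomial.X *
          IsLocalization.mk' (Localization M) p q + 1) *
          algebraMap (Polynomial K) (Localization M) (q : Polynomial K) := by
      rw [add_mul, mul_assoc, IsLocalization.mk'_spec, map_add, map_mul, one_mul]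
    exact isUnit_of_mul_isUnit_left (h ▸ IsLocalization.map_units (Localization M) ⟨_, hq⟩)
  · ext x
    simp [r, IsScalarTower.coe_toAlgHom', ι]
  · simp [r, ι]

section Chain

variable {k A C : Type*} [Field k] [Ring A] [HopfAlgebra k A]
  [AddCommGroup C] [Module k C] [Coalgebra k C] [RightModuleCoalgebra k A C]
variable {O R : Type*} [CommRing O] [Ring R] [Algebra k R] [Algebra O R]
  [Algebra k O] [IsScalarTower k O R]

theorem ActAt.add_smul_sub {φ : A →ₐ[k] R} {n : ℕ} {x y : C →ₗ[k] R} (hx : ActAt φ n x)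
    (hy : ActAt φ n y) (t : O) : ActAt φ n (x + t • (y - x)) := by
  intro c a
  have h1 := hx c a
  have h2 := hy c a
  simp only [LinearMap.add_apply, LinearMap.smul_apply, LinearMap.sub_apply]
  rw [h1, h2]
  split_ifs
  · rw [add_mul, smul_mul_assoc, sub_mul]
  · rw [mul_add, mul_smul_comm, mul_sub]

/-- An infinitesimal perturbation of the last term of a finite chain of iterated inverses extends to
the whole chain. -/
theorem exists_chain_perturb [FiniteDimensional k C] {t : O}
    (ht : t ∈ Ideal.jacobson (⊥ : Ideal O)) (I : LocallyFiniteIdeal O R) (m : ℕ)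
    (x : ℕ → C →ₗ[k] R) (hx : ∀ n < m, InverseAt n (x n) (x (n + 1))) (Ψ : C →ₗ[k] R)
    (hΨ : ∀ c, Ψ c ∈ I.carrier) :
    ∃ y : ℕ → C →ₗ[k] R, y m = x m + t • Ψ ∧ ∀ n < m, InverseAt n (y n) (y (n + 1)) := by
  induction m generalizing Ψ with
  | zero => exact ⟨fun _ => x 0 + t • Ψ, rfl, by simp⟩
  | succ m ih =>
    obtain ⟨Ψ', hΨ', h⟩ := (hx m (Nat.lt_succ_self m)).exists_perturb ht I hΨ
    obtain ⟨y, hym, hy⟩ := ih (fun n hn => hx n (hn.trans (Nat.lt_succ_self m))) Ψ' hΨ'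
    refine ⟨Function.update y (m + 1) (x (m + 1) + t • Ψ), by simp, fun n hn => ?_⟩
    rw [Function.update_of_ne hn.ne]
    rcases Nat.lt_succ_iff_lt_or_eq.1 hn with hn' | rfl
    · rw [Function.update_of_ne (by omega)]
      exact hy n hn'
    · rw [Function.update_self, hym]
      exact h

end Chain

section Engine

universe u v

variable {k : Type u} {A C B : Type*} [Field k] [Ring A] [HopfAlgebra k A]
  [AddCommGroup C] [Module k C] [Coalgebra k C] [RightModuleCoalgebra k A C]
  [FiniteDimensional k C] [Ring B] [Algebra k B]

/-- Suppose that every term of a chain of iterated inverses modulo a locally finite ideal `I` lifts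
to an equivariant map `e n` that has an inverse `f n`. Then, after an extension of the base field,
there are chains of iterated inverses of arbitrary finite length.

Over the field of rational functions in `s` the last term `x m` of a chain moves along the line
`x m + s (e m - x m)`. Near `s = 0` this deforms `x m`, so the terms before it survive; near `s = 1`
it deforms `e m`, so it is invertible, which gives one more term. -/
theorem exists_finite_chain (I : LocallyFiniteIdeal k B) (φ : A →ₐ[k] B) (e f : ℕ → C →ₗ[k] B)
    (he : ∀ n, ActAt φ n (e n)) (hef : ∀ n, InverseAt n (e n) (f n))
    (hI : ∀ n c, f n c - e (n + 1) c ∈ I.carrier) (m : ℕ) :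
    ∃ (K : Type u) (_ : Field K) (_ : Algebra k K) (x : ℕ → C →ₗ[k] K ⊗[k] B),
      (∀ n < m, InverseAt n (x n) (x (n + 1))) ∧
      ActAt ((Algebra.TensorProduct.includeRight : B →ₐ[k] K ⊗[k] B).comp φ) m (x m) ∧
      ∀ c, x m c - (1 : K) ⊗ₜ[k] e m c ∈ (I.baseChange K).carrier := by
  induction m with
  | zero =>
    refine ⟨k, inferInstance, inferInstance, fun _ =>
      (Algebra.TensorProduct.includeRight : B →ₐ[k] k ⊗[k] B).toLinearMap ∘ₗ e 0, by simp,
      (he 0).algHom_comp _, fun c => ?_⟩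
    simp
  | succ m ih =>
    obtain ⟨K, _, _, x, hx, hxA, hxI⟩ := ih
    obtain ⟨O, L, _, _, _, _, i, h₀, h₁, t, ht, hi, hsum⟩ := exists_two_specializations k K
    let jO : B →ₐ[k] O ⊗[k] B := Algebra.TensorProduct.includeRight
    let jL : B →ₐ[k] L ⊗[k] B := Algebra.TensorProduct.includeRight
    let G := scalarMap B i
    let H₀ := scalarMap B h₀
    let H₁ := scalarMap B h₁
    have hH₀ : H₀.comp jO = jL := by ext; simp [H₀, jO, jL]
    have hH₁ : H₁.comp jO = jL := by ext; simp [H₁, jO, jL]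
    have hG : H₀.comp G = H₁.comp G := by
      apply Algebra.TensorProduct.ext'
      intro a b
      simpa [H₀, H₁, G] using congrArg (· ⊗ₜ[k] b) (DFunLike.congr_fun hi a)
    let δ : C →ₗ[k] O ⊗[k] B := jO.toLinearMap ∘ₗ e m - G.toLinearMap ∘ₗ x m
    have hδ : ∀ c, δ c ∈ (I.baseChange O).carrier := by
      intro c
      have h := neg_mem (scalarMap_mem i I (hxI c))
      rw [map_sub, neg_sub] at h
      convert h using 1
      change (1 : O) ⊗ₜ[k] e m c - _ = _
      congr 1
      simp
    -- the deformation of `x m`, together with the terms before it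
    obtain ⟨y, hym, hy⟩ := exists_chain_perturb ht (I.baseChange O) m
      (fun n => G.toLinearMap ∘ₗ x n) (fun n hn => (hx n hn).algHom_comp G) δ hδ
    -- the deformation of `e m`, together with its inverse
    obtain ⟨Ψ, hΨ, hz⟩ := ((hef m).algHom_comp jO).symm.exists_perturb ht (I.baseChange O)
      (Ψ := -δ) (fun c => by simpa using neg_mem (hδ c))
    have hmeet : H₀.toLinearMap ∘ₗ y m =
        H₁.toLinearMap ∘ₗ (jO.toLinearMap ∘ₗ e m + t • -δ) := by
      ext c
      have a1 : H₀ (jO (e m c)) = jL (e m c) := DFunLike.congr_fun hH₀ _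
      have a2 : H₁ (jO (e m c)) = jL (e m c) := DFunLike.congr_fun hH₁ _
      have a3 : H₀ (G (x m c)) = H₁ (G (x m c)) := DFunLike.congr_fun hG _
      have a4 : h₀ t = 1 - h₁ t := eq_sub_of_add_eq hsum
      rw [hym]
      simp only [LinearMap.comp_apply, LinearMap.add_apply, LinearMap.smul_apply,
        LinearMap.neg_apply, δ, LinearMap.sub_apply, AlgHom.toLinearMap_apply, map_add]
      rw [scalarMap_smul, scalarMap_smul]
      change H₀ (G (x m c)) + h₀ t • H₀ (jO (e m c) - G (x m c)) =
        H₁ (jO (e m c)) + h₁ t • H₁ (-(jO (e m c) - G (x m c)))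
      rw [map_sub, map_neg, map_sub, a1, a2, a3, a4, sub_smul, one_smul, smul_neg]
      abel
    let z : C →ₗ[k] L ⊗[k] B := H₁.toLinearMap ∘ₗ (jO.toLinearMap ∘ₗ f m + t • Ψ)
    have hzm : InverseAt m (H₀.toLinearMap ∘ₗ y m) z := by
      rw [hmeet]
      exact hz.symm.algHom_comp H₁
    refine ⟨L, inferInstance, inferInstance,
      Function.update (fun n => H₀.toLinearMap ∘ₗ y n) (m + 1) z, fun n hn => ?_, ?_, fun c => ?_⟩
    · rw [Function.update_of_ne hn.ne]
      rcases Nat.lt_succ_iff_lt_or_eq.1 hn with hn' | rfl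
      · rw [Function.update_of_ne (by omega)]
        exact (hy n hn').algHom_comp H₀
      · rw [Function.update_self]
        exact hzm
    · rw [Function.update_self, ActAt.succ_iff hzm]
      have h1 : ActAt (jO.comp φ) m (y m) := by
        rw [hym]
        refine ActAt.add_smul_sub ?_ ((he m).algHom_comp jO) t
        have := hxA.algHom_comp G
        have e1 : G.comp ((Algebra.TensorProduct.includeRight : B →ₐ[k] K ⊗[k] B).comp φ) =
            jO.comp φ := by ext; simp [G, jO]
        rwa [e1] at this
      have := h1.algHom_comp H₀
      rwa [← AlgHom.comp_assoc, hH₀] at this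
    · rw [Function.update_self]
      have a2 : H₁ (jO (f m c)) = jL (f m c) := DFunLike.congr_fun hH₁ _
      have : z c - (1 : L) ⊗ₜ[k] e (m + 1) c =
          (1 : L) ⊗ₜ[k] (f m c - e (m + 1) c) + h₁ t • H₁ (Ψ c) := by
        simp only [z, LinearMap.comp_apply, LinearMap.add_apply, LinearMap.smul_apply,
          AlgHom.toLinearMap_apply, map_add]
        rw [scalarMap_smul, a2, TensorProduct.tmul_sub]
        change (1 : L) ⊗ₜ[k] f m c + _ - _ = _
        abel
      rw [this]
      exact add_mem (Submodule.tmul_mem_baseChange_of_mem _ (hI m c))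
        (Submodule.smul_mem _ _ (scalarMap_mem h₁ I (hΨ c)))

end Engine

/-! ### From finite chains to the free Hopf algebra -/

section DualNumber

variable {k : Type*} [CommRing k] {D : Type*} [AddCommGroup D] [Module k D]
variable {R : Type*} [Ring R] [Algebra k R]

/-- The map `x + εδ` with values in the dual numbers over `R`. -/
def tangent (x δ : D →ₗ[k] R) : D →ₗ[k] TrivSqZeroExt R R :=
  (TrivSqZeroExt.inlAlgHom k R R).toLinearMap ∘ₗ x +
    ((TrivSqZeroExt.inrHom R R).restrictScalars k) ∘ₗ δ

@[simp]
theorem fst_tangent (x δ : D →ₗ[k] R) (d : D) : (tangent x δ d).fst = x d := by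
  simp [tangent]

@[simp]
theorem snd_tangent (x δ : D →ₗ[k] R) (d : D) : (tangent x δ d).snd = δ d := by
  simp [tangent]

variable [Coalgebra k D]

theorem tangent_conv (x δ y δ' : D →ₗ[k] R) :
    toConv (tangent x δ) * toConv (tangent y δ') =
      toConv (tangent (toConv x * toConv y).ofConv
        (toConv x * toConv δ' + toConv δ * toConv y).ofConv) := by
  have key : ∀ w : D ⊗[k] D, LinearMap.mul' k _ (TensorProduct.map (tangent x δ) (tangent y δ') w) =
      TrivSqZeroExt.inl (LinearMap.mul' k _ (TensorProduct.map x y w)) +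
      TrivSqZeroExt.inr (LinearMap.mul' k _ (TensorProduct.map x δ' w) +
        LinearMap.mul' k _ (TensorProduct.map δ y w)) := by
    intro w
    induction w with
    | zero => simp
    | add p q hp hq =>
      simp only [map_add, hp, hq, TrivSqZeroExt.inl_add, TrivSqZeroExt.inr_add]
      abel
    | tmul p q => ext <;> simp
  apply WithConv.ext
  ext d : 1
  exact (key _).trans rfl

theorem ConvInverse.exists_tangent {x y : D →ₗ[k] R} (h : ConvInverse x y) (δ : D →ₗ[k] R) :
    ∃ δ' : D →ₗ[k] R, ConvInverse (tangent x δ) (tangent y δ') := by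
  rw [convInverse_iff] at h
  obtain ⟨h1, h2⟩ := h
  refine ⟨(-(toConv y * toConv δ * toConv y)).ofConv, ?_⟩
  rw [convInverse_iff, tangent_conv, tangent_conv]
  have e : toConv (tangent (1 : WithConv (D →ₗ[k] R)).ofConv (0 : WithConv (D →ₗ[k] R)).ofConv) =
      1 := by
    apply WithConv.ext
    ext d : 1
    apply TrivSqZeroExt.ext
    · rw [fst_tangent]; rfl
    · rw [snd_tangent]; rfl
  rw [h1, h2, toConv_ofConv, ← e]
  constructor
  · congr 4
    rw [mul_neg, mul_assoc, ← mul_assoc (toConv x), h1, one_mul, neg_add_cancel]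
  · congr 4
    rw [neg_mul, mul_assoc _ _ (toConv x), h2, mul_one, add_neg_cancel]

theorem InverseAt.exists_tangent {n : ℕ} {x y : D →ₗ[k] R} (h : InverseAt n x y)
    (δ : D →ₗ[k] R) : ∃ δ' : D →ₗ[k] R, InverseAt n (tangent x δ) (tangent y δ') :=
  @ConvInverse.exists_tangent k _ D _ _ R _ _ (coalgAt k D n) x y h δ

end DualNumber

section Reduction

open RightModuleCoalgebra (act)

variable {k A C : Type*} [CommRing k] [Ring A] [HopfAlgebra k A]
  [AddCommGroup C] [Module k C] [Coalgebra k C] [RightModuleCoalgebra k A C]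

/-- An infinite chain of iterated inverses detects the injectivity of `A → H(C, A)`; that of
`C → H(C, A)` only needs in addition an equivariant injection, which serves as a tangent vector. -/
theorem FreeHopf.injective_of_chain {R : Type*} [Ring R] [Algebra k R] (φ : A →ₐ[k] R)
    (hφ : Function.Injective φ) (x : ℕ → C →ₗ[k] R) (hx : ∀ n, InverseAt n (x n) (x (n + 1)))
    (hact : ∀ c a, x 0 (act (c ⊗ₜ[k] a)) = x 0 c * φ a) (δ₀ : C →ₗ[k] R)
    (hδ₀ : Function.Injective δ₀) (hδact : ∀ c a, δ₀ (act (c ⊗ₜ[k] a)) = δ₀ c * φ a) :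
    Function.Injective (FreeHopf.X k A C 0) ∧ Function.Injective (FreeHopf.J k A C) := by
  have hstep : ∀ n (δ : C →ₗ[k] R), ∃ δ' : C →ₗ[k] R,
      InverseAt n (tangent (x n) δ) (tangent (x (n + 1)) δ') := fun n δ => (hx n).exists_tangent δ
  choose g hg using hstep
  let δ : ℕ → C →ₗ[k] R := fun n => Nat.rec δ₀ g n
  let T := FreeHopf.lift (fun n => tangent (x n) (δ n)) ((TrivSqZeroExt.inlAlgHom k R R).comp φ)
    (by
      intro c a
      apply TrivSqZeroExt.ext
      · simp [hact]
      · simp [δ, hδact])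
    (fun n => hg n (δ n))
  constructor
  · intro c d h
    have := congrArg T h
    rw [FreeHopf.lift_X, FreeHopf.lift_X] at this
    have := congrArg TrivSqZeroExt.snd this
    simp only [snd_tangent] at this
    exact hδ₀ this
  · intro a b h
    have := congrArg T h
    rw [FreeHopf.lift_J, FreeHopf.lift_J] at this
    exact hφ (TrivSqZeroExt.inl_injective this)

/-- The congruence of eventual equality on a product of rings. -/
def eventualCon (R : ℕ → Type*) [∀ m, Ring (R m)] : RingCon (∀ m, R m) where
  r f g := ∀ᶠ m in Filter.atTop, f m = g m
  iseqv := ⟨fun _ => .of_forall fun _ => rfl, fun h => h.mono fun _ h => h.symm,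
    fun h h' => (h.and h').mono fun _ h => h.1.trans h.2⟩
  mul' h h' := (h.and h').mono fun _ h => congrArg₂ (· * ·) h.1 h.2
  add' h h' := (h.and h').mono fun _ h => congrArg₂ (· + ·) h.1 h.2

theorem eventualCon_mk_eq {R : ℕ → Type*} [∀ m, Ring (R m)] [∀ m, Algebra k (R m)]
    {f g : ∀ m, R m} :
    (eventualCon R).mkₐ (α := k) f = (eventualCon R).mkₐ (α := k) g ↔
      ∀ᶠ m in Filter.atTop, f m = g m :=
  RingCon.eq _

theorem mkₐ_pi_injective {R : ℕ → Type*} [∀ m, Ring (R m)] [∀ m, Algebra k (R m)]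
    {M : Type*} [AddCommGroup M] [Module k M]
    {x : ∀ m, M →ₗ[k] R m} (hx : ∀ m, Function.Injective (x m)) :
    Function.Injective ((((eventualCon R).mkₐ (α := k)).toLinearMap ∘ₗ LinearMap.pi x)) := by
  intro c d h
  obtain ⟨m, hm⟩ := ((eventualCon_mk_eq (k := k)).1 h).exists
  exact hx m hm

/-- Convolution inverses, in the quotient by eventual equality, can be checked at almost all
indices. -/
theorem inverseAt_mkₐ_pi {R : ℕ → Type*} [∀ m, Ring (R m)] [∀ m, Algebra k (R m)] {n : ℕ}
    {x y : ∀ m, C →ₗ[k] R m} (h : ∀ᶠ m in Filter.atTop, InverseAt n (x m) (y m)) :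
    InverseAt n (((eventualCon R).mkₐ (α := k)).toLinearMap ∘ₗ LinearMap.pi x)
      (((eventualCon R).mkₐ (α := k)).toLinearMap ∘ₗ LinearMap.pi y) := by
  have key : ∀ (x y : ∀ m, C →ₗ[k] R m) (w : C ⊗[k] C),
      LinearMap.mul' k _ (TensorProduct.map
        (((eventualCon R).mkₐ (α := k)).toLinearMap ∘ₗ LinearMap.pi x)
        (((eventualCon R).mkₐ (α := k)).toLinearMap ∘ₗ LinearMap.pi y) w) =
      (eventualCon R).mkₐ (α := k)
        fun m => LinearMap.mul' k _ (TensorProduct.map (x m) (y m) w) := by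
    intro x y w
    induction w with
    | zero => simp only [map_zero]; exact (map_zero ((eventualCon R).mkₐ (α := k))).symm
    | add p q hp hq => simp only [map_add, hp, hq]; exact (map_add _ _ _).symm
    | tmul p q =>
      simp only [TensorProduct.map_tmul, LinearMap.mul'_apply]
      exact (map_mul ((eventualCon R).mkₐ (α := k)) _ _).symm
  have hr : ∀ r : k, algebraMap k (eventualCon R).Quotient r =
      (eventualCon R).mkₐ (α := k) fun m => algebraMap k (R m) r := fun r =>
    (AlgHom.commutes ((eventualCon R).mkₐ (α := k)) r).symm
  refine ⟨fun c => ?_, fun c => ?_⟩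
  · refine (key x y _).trans (Eq.trans ?_ (hr _).symm)
    exact (eventualCon_mk_eq (k := k)).2 (h.mono fun m hm => hm.1 c)
  · refine (key y x _).trans (Eq.trans ?_ (hr _).symm)
    exact (eventualCon_mk_eq (k := k)).2 (h.mono fun m hm => hm.2 c)

/-- Finite chains of iterated inverses of unbounded length give an infinite one, in the product of
the target algebras modulo eventual equality. -/
theorem FreeHopf.injective_of_finite_chains {R : ℕ → Type*} [∀ m, Ring (R m)]
    [∀ m, Algebra k (R m)] (φ : ∀ m, A →ₐ[k] R m) (hφ : ∀ m, Function.Injective (φ m))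
    (x : ∀ m, ℕ → C →ₗ[k] R m) (hx : ∀ m, ∀ n < m, InverseAt n (x m n) (x m (n + 1)))
    (hact : ∀ m, ActAt (φ m) m (x m m)) (δ : ∀ m, C →ₗ[k] R m)
    (hδ : ∀ m, Function.Injective (δ m))
    (hδact : ∀ m c a, δ m (act (c ⊗ₜ[k] a)) = δ m c * φ m a) :
    Function.Injective (FreeHopf.X k A C 0) ∧ Function.Injective (FreeHopf.J k A C) := by
  have hact' : ∀ m n, n ≤ m → ActAt (φ m) (m - n) (x m (m - n)) := by
    intro m n
    induction n with
    | zero => exact fun _ => hact m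
    | succ n ih =>
      intro h
      have h1 := ih (by omega)
      rw [show m - n = m - (n + 1) + 1 by omega] at h1
      exact (ActAt.succ_iff (hx m _ (by omega))).1 h1
  have hact₀ : ∀ m c a, x m 0 (act (c ⊗ₜ[k] a)) = x m 0 c * φ m a := by
    intro m c a
    have := hact' m m le_rfl c a
    simpa using this
  refine FreeHopf.injective_of_chain (((eventualCon R).mkₐ (α := k)).comp (AlgHom.pi φ)) ?_
    (fun n => ((eventualCon R).mkₐ (α := k)).toLinearMap ∘ₗ LinearMap.pi fun m => x m n)
    (fun n => inverseAt_mkₐ_pi ?_) (fun c a => ?_)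
    (((eventualCon R).mkₐ (α := k)).toLinearMap ∘ₗ LinearMap.pi δ) (mkₐ_pi_injective hδ)
    (fun c a => ?_)
  · exact mkₐ_pi_injective (x := fun m => (φ m).toLinearMap) hφ
  · exact (Filter.eventually_gt_atTop n).mono fun m hm => hx m n hm
  · refine Eq.trans ?_ (map_mul ((eventualCon R).mkₐ (α := k)) _ _)
    exact congrArg _ (funext fun m => hact₀ m c a)
  · refine Eq.trans ?_ (map_mul ((eventualCon R).mkₐ (α := k)) _ _)
    exact congrArg _ (funext fun m => hδact m c a)

end Reduction

section Antiendomorphism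

open RightModuleCoalgebra (act)

universe u

variable {k : Type u} {A C B : Type*} [Field k] [Ring A] [HopfAlgebra k A]
  [AddCommGroup C] [Module k C] [Coalgebra k C] [RightModuleCoalgebra k A C]
  [FiniteDimensional k C] [Ring B] [Algebra k B]

/-- It suffices to find an invertible equivariant map `e` whose inverse `f` agrees with `τ ∘ e`
modulo a locally finite ideal, where `τ` is an antiendomorphism extending the antipode of `A`: the
sequence `e, τ e, τ² e, …` is then a chain of iterated inverses modulo that ideal. -/
theorem FreeHopf.injective_of_antiendomorphism (I : LocallyFiniteIdeal k B) (φ : A →ₐ[k] B)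
    (hφ : Function.Injective φ) (τ : B →ₗ[k] B) (τ_mul : ∀ a b, τ (a * b) = τ b * τ a)
    (τ_one : τ 1 = 1) (τ_φ : ∀ a, τ (φ a) = φ (HopfAlgebra.antipode k a))
    (τ_mem : ∀ x ∈ I.carrier, τ x ∈ I.carrier) (e f : C →ₗ[k] B)
    (he : ∀ c a, e (act (c ⊗ₜ[k] a)) = e c * φ a) (hef : ConvInverse e f)
    (hI : ∀ c, f c - τ (e c) ∈ I.carrier) (δ : C →ₗ[k] B) (hδ : Function.Injective δ)
    (hδact : ∀ c a, δ (act (c ⊗ₜ[k] a)) = δ c * φ a) :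
    Function.Injective (FreeHopf.X k A C 0) ∧ Function.Injective (FreeHopf.J k A C) := by
  have hE : ∀ n, ActAt φ n ((τ ^ n) ∘ₗ e) := by
    intro n
    induction n with
    | zero => intro c a; simpa using he c a
    | succ n ih =>
      rw [pow_succ', Module.End.mul_eq_comp, LinearMap.comp_assoc]
      exact ih.anti τ τ_mul τ_φ
  have hEF : ∀ n, InverseAt n ((τ ^ n) ∘ₗ e) ((τ ^ n) ∘ₗ f) := by
    intro n
    induction n with
    | zero => simpa [inverseAt_of_even, Module.End.one_eq_id] using hef
    | succ n ih =>
      rw [pow_succ', Module.End.mul_eq_comp, LinearMap.comp_assoc, LinearMap.comp_assoc]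
      exact ih.anti τ τ_mul τ_one
  have hEI : ∀ n c, ((τ ^ n) ∘ₗ f) c - ((τ ^ (n + 1)) ∘ₗ e) c ∈ I.carrier := by
    intro n c
    rw [pow_succ, LinearMap.comp_apply, LinearMap.comp_apply, Module.End.mul_apply, ← map_sub]
    induction n with
    | zero => simpa using hI c
    | succ n ih => rw [pow_succ', Module.End.mul_apply]; exact τ_mem _ ih
  choose K i₁ i₂ x hx hact _ using exists_finite_chain I φ _ _ hE hEF hEI
  have hinj : ∀ m, Function.Injective (Algebra.TensorProduct.includeRight : B →ₐ[k] K m ⊗[k] B) :=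
    fun m => Algebra.TensorProduct.includeRight_injective (algebraMap k (K m)).injective
  refine FreeHopf.injective_of_finite_chains (R := fun m => K m ⊗[k] B)
    (fun m => Algebra.TensorProduct.includeRight.comp φ) (fun m => (hinj m).comp hφ) x hx hact
    (fun m => (Algebra.TensorProduct.includeRight : B →ₐ[k] K m ⊗[k] B).toLinearMap ∘ₗ δ)
    (fun m => (hinj m).comp hδ) (fun m c a => ?_)
  rw [LinearMap.comp_apply, hδact]
  exact map_mul (Algebra.TensorProduct.includeRight : B →ₐ[k] K m ⊗[k] B) _ _

end Antiendomorphism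

/-! ### Finite-dimensional Hopf algebras are Frobenius algebras -/

section Frobenius

open HopfAlgebra (antipode)
open Coalgebra (comul counit)

variable (k : Type*) {A : Type*} [Field k] [Ring A] [HopfAlgebra k A]

theorem comul_antipode (a : A) : comul (R := k) (antipode k a) =
    TensorProduct.map (antipode k) (antipode k) (TensorProduct.comm k A A (comul a)) := by
  have h1 := (convInverse_antipode k A).algHom_comp (Bialgebra.comulAlgHom k A)
  have h2 := (convInverse_antipode k A).tensor
  rw [TensorProduct.map_id] at h2
  exact LinearMap.congr_fun (h1.unique h2) a

/-- `∑ Δ(S a₁) (a₂ ⊗ 1) = 1 ⊗ S a`. -/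
theorem sum_comul_antipode_mul (a : A) :
    LinearMap.mul' k (A ⊗[k] A) (TensorProduct.map (comul ∘ₗ antipode k)
      (Algebra.TensorProduct.includeLeft : A →ₐ[k] A ⊗[k] A).toLinearMap (comul a)) =
    1 ⊗ₜ antipode k a := by
  let i₁ : WithConv (A →ₗ[k] A ⊗[k] A) :=
    toConv (Algebra.TensorProduct.includeLeft : A →ₐ[k] A ⊗[k] A).toLinearMap
  let i₂ : WithConv (A →ₗ[k] A ⊗[k] A) :=
    toConv (Algebra.TensorProduct.includeRight : A →ₐ[k] A ⊗[k] A).toLinearMap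
  have hΔ : toConv (comul : A →ₗ[k] A ⊗[k] A) = i₁ * i₂ := by
    have : ∀ w : A ⊗[k] A, w = LinearMap.mul' k (A ⊗[k] A) (TensorProduct.map
        (Algebra.TensorProduct.includeLeft : A →ₐ[k] A ⊗[k] A).toLinearMap
        (Algebra.TensorProduct.includeRight : A →ₐ[k] A ⊗[k] A).toLinearMap w) := by
      intro w
      induction w with
      | zero => simp
      | tmul p q => simp
      | add p q hp hq => rw [map_add, map_add, ← hp, ← hq]
    apply WithConv.ext
    ext a : 1
    exact this _
  have h1 := (convInverse_iff _ _).1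
    ((convInverse_antipode k A).algHom_comp (Bialgebra.comulAlgHom k A))
  have h2 := (convInverse_iff _ _).1 ((convInverse_antipode k A).algHom_comp
    (Algebra.TensorProduct.includeRight : A →ₐ[k] A ⊗[k] A))
  have e1 : toConv (comul ∘ₗ antipode k : A →ₗ[k] A ⊗[k] A) * toConv comul = 1 := h1.2
  have e2 : i₂ * toConv ((Algebra.TensorProduct.includeRight : A →ₐ[k] A ⊗[k] A).toLinearMap ∘ₗ
    antipode k) = 1 := h2.1
  have : toConv (comul ∘ₗ antipode k : A →ₗ[k] A ⊗[k] A) * i₁ = toConv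
      ((Algebra.TensorProduct.includeRight : A →ₐ[k] A ⊗[k] A).toLinearMap ∘ₗ antipode k) := by
    rw [← mul_one (_ * i₁), ← e2, mul_assoc, ← mul_assoc i₁, ← hΔ, ← mul_assoc, e1, one_mul]
  exact congrArg (fun F : WithConv (A →ₗ[k] A ⊗[k] A) => F a) this

variable {k}

/-- The map `a ↦ ∑ f(a₂) a₁`. -/
def sliceRight (f : Module.Dual k A) : A →ₗ[k] A :=
  (TensorProduct.rid k A).toLinearMap ∘ₗ LinearMap.lTensor A f ∘ₗ comul

/-- The map `a ↦ ∑ f(a₁) a₂`. -/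
def sliceLeft (f : Module.Dual k A) : A →ₗ[k] A :=
  (TensorProduct.lid k A).toLinearMap ∘ₗ LinearMap.rTensor A f ∘ₗ comul

theorem sliceLeft_zero : sliceLeft (0 : Module.Dual k A) = 0 := by
  ext; simp [sliceLeft]

theorem sliceRight_zero : sliceRight (0 : Module.Dual k A) = 0 := by
  ext; simp [sliceRight]

theorem sliceLeft_add (f g : Module.Dual k A) : sliceLeft (f + g) = sliceLeft f + sliceLeft g := by
  ext; simp [sliceLeft]

theorem sliceLeft_smul (r : k) (f : Module.Dual k A) : sliceLeft (r • f) = r • sliceLeft f := by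
  ext; simp [sliceLeft]

theorem sliceRight_add (f g : Module.Dual k A) :
    sliceRight (f + g) = sliceRight f + sliceRight g := by
  ext; simp [sliceRight]

theorem sliceRight_smul (r : k) (f : Module.Dual k A) : sliceRight (r • f) = r • sliceRight f := by
  ext; simp [sliceRight]

/-- A nonzero left integral `l` of the dual of `A` has the property that `a ↦ l(· S(a))` is
injective. -/
theorem injective_of_integral [FiniteDimensional k A] {l : Module.Dual k A} (hl0 : l ≠ 0)
    (hl : ∀ b, sliceRight l b = l b • (1 : A)) (a : A) (ha : ∀ b, l (b * antipode k a) = 0) :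
    a = 0 := by
  let Q : A ⊗[k] A →ₗ[k] A := (TensorProduct.rid k A).toLinearMap ∘ₗ LinearMap.lTensor A l
  have hQ : ∀ (z : A ⊗[k] A) (p : A), Q (z * (p ⊗ₜ 1)) = Q z * p := by
    intro z p
    induction z with
    | zero => simp
    | add x y hx hy => rw [add_mul, map_add, hx, hy, map_add, add_mul]
    | tmul x y => simp [Q]
  have hQ' : ∀ z : A ⊗[k] A, Q (z * (1 ⊗ₜ antipode k a)) = 0 := by
    intro z
    induction z with
    | zero => simp
    | add x y hx hy => rw [add_mul, map_add, hx, hy, add_zero]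
    | tmul x y => simp [Q, ha]
  have h1 : ∀ b, TensorProduct.lid k A (LinearMap.rTensor A
      (l ∘ₗ LinearMap.mulLeft k b ∘ₗ antipode k) (comul a)) = 0 := by
    intro b
    have : ∀ w : A ⊗[k] A, TensorProduct.lid k A (LinearMap.rTensor A
        (l ∘ₗ LinearMap.mulLeft k b ∘ₗ antipode k) w) =
        Q (comul b * LinearMap.mul' k (A ⊗[k] A) (TensorProduct.map (comul ∘ₗ antipode k)
          (Algebra.TensorProduct.includeLeft : A →ₐ[k] A ⊗[k] A).toLinearMap w)) := by
      intro w
      induction w with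
      | zero => simp
      | add x y hx hy => simp only [map_add, mul_add, hx, hy]
      | tmul x y =>
        simp only [LinearMap.rTensor_tmul, TensorProduct.lid_tmul, TensorProduct.map_tmul,
          LinearMap.mul'_apply, LinearMap.comp_apply, LinearMap.mulLeft_apply,
          AlgHom.toLinearMap_apply, Algebra.TensorProduct.includeLeft_apply]
        rw [← mul_assoc, ← Bialgebra.comul_mul, hQ]
        have := hl (b * antipode k x)
        change Q _ = _ at this
        rw [this, smul_mul_assoc, one_mul]
    rw [this, sum_comul_antipode_mul, hQ']
  let F : A →ₗ[k] Module.Dual k A := (LinearMap.llcomp k A A k l) ∘ₗ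
    (LinearMap.mul k A).flip ∘ₗ antipode k
  have hF : ∀ p b, F p b = l (b * antipode k p) := fun p b => rfl
  have h2 : LinearMap.rTensor A F (comul a) = 0 := by
    apply (dualTensorHomEquiv k A A).injective
    rw [map_zero]
    ext b
    refine Eq.trans ?_ (h1 b)
    generalize (comul a : A ⊗[k] A) = w
    induction w with
    | zero => simp
    | add x y hx hy => simp only [map_add, LinearMap.add_apply, hx, hy]
    | tmul x y => simp [hF]
  obtain ⟨b, hb⟩ : ∃ b, l b ≠ 0 := by
    by_contra! h
    exact hl0 (LinearMap.ext h)
  let E : Module.Dual k A ⊗[k] A →ₗ[k] k :=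
    contractLeft k A ∘ₗ LinearMap.lTensor _ (LinearMap.mulLeft k b ∘ₗ antipode k ∘ₗ antipode k)
  let Φ : Module.Dual k A ⊗[k] A →ₗ[k] A := (TensorProduct.lid k A).toLinearMap ∘ₗ
    LinearMap.rTensor A E ∘ₗ (TensorProduct.assoc k _ A A).symm.toLinearMap ∘ₗ
    LinearMap.lTensor _ comul
  have nat : ∀ w : A ⊗[k] A, (TensorProduct.assoc k _ A A).symm
      (LinearMap.lTensor _ comul (LinearMap.rTensor A F w)) = LinearMap.rTensor A
        (LinearMap.rTensor A F) ((TensorProduct.assoc k _ A A).symm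
          (LinearMap.lTensor _ comul w)) := by
    intro w
    induction w with
    | zero => simp
    | add x y hx hy => simp only [map_add, hx, hy]
    | tmul x y =>
      simp only [LinearMap.rTensor_tmul, LinearMap.lTensor_tmul]
      generalize (comul y : A ⊗[k] A) = z
      induction z with
      | zero => simp
      | add x y hx hy => simp only [map_add, TensorProduct.tmul_add, hx, hy]
      | tmul p q => simp
  have hE : (E ∘ₗ LinearMap.rTensor A F) ∘ₗ comul = l b • counit := by
    have : ∀ w : A ⊗[k] A, E (LinearMap.rTensor A F w) =
        l (b * antipode k (LinearMap.mul' k A (LinearMap.lTensor A (antipode k) w))) := by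
      intro w
      induction w with
      | zero => simp
      | add x y hx hy => simp only [map_add, mul_add, hx, hy]
      | tmul x y => simp [E, hF, HopfAlgebra.antipode_mul_antidistrib, mul_assoc]
    ext c
    refine (this _).trans ?_
    rw [HopfAlgebra.mul_antipode_lTensor_comul_apply]
    simp [Algebra.algebraMap_eq_smul_one, mul_comm]
  have h3 : Φ (LinearMap.rTensor A F (comul a)) = l b • a := by
    change TensorProduct.lid k A (LinearMap.rTensor A E ((TensorProduct.assoc k _ A A).symm
      (LinearMap.lTensor _ comul (LinearMap.rTensor A F (comul a))))) = _
    rw [nat, Coalgebra.coassoc_symm_apply, ← LinearMap.comp_apply (LinearMap.rTensor A E),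
      ← LinearMap.rTensor_comp, ← LinearMap.comp_apply (LinearMap.rTensor A _),
      ← LinearMap.rTensor_comp, hE, LinearMap.rTensor_smul, LinearMap.smul_apply,
      Coalgebra.rTensor_counit_comul]
    simp
  rw [h2, map_zero] at h3
  exact (smul_eq_zero.1 h3.symm).resolve_left hb

end Frobenius

section Frobenius

open HopfAlgebra (antipode)
open Coalgebra (comul counit)

variable {k A : Type*} [Field k] [Ring A] [HopfAlgebra k A]

/-- The functional `b ↦ tr(x ↦ ∑ f(x₂) b S²(x₁))`. -/
def traceIntegral (f : Module.Dual k A) : Module.Dual k A :=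
  LinearMap.trace k A ∘ₗ LinearMap.lcomp k A (antipode k ∘ₗ antipode k ∘ₗ sliceRight f) ∘ₗ
    LinearMap.mul k A

theorem traceIntegral_apply (f : Module.Dual k A) (b : A) :
    traceIntegral f b = LinearMap.trace k A
      (LinearMap.mulLeft k b ∘ₗ antipode k ∘ₗ antipode k ∘ₗ sliceRight f) := rfl

theorem comul_sliceRight (f : Module.Dual k A) (x : A) :
    comul (R := k) (sliceRight f x) = LinearMap.lTensor A (sliceRight f) (comul x) := by
  have h1 : ∀ w : A ⊗[k] A, comul (R := k) (TensorProduct.rid k A (LinearMap.lTensor A f w)) =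
      TensorProduct.rid k _ (LinearMap.lTensor _ f (LinearMap.rTensor A comul w)) := by
    intro w
    induction w with
    | zero => simp
    | add x y hx hy => simp only [map_add, hx, hy]
    | tmul p q => simp
  have h2 : ∀ w : A ⊗[k] A, LinearMap.lTensor A (sliceRight f) w = TensorProduct.rid k _
      (LinearMap.lTensor _ f
        ((TensorProduct.assoc k A A A).symm (LinearMap.lTensor A comul w))) := by
    intro w
    induction w with
    | zero => simp
    | add x y hx hy => simp only [map_add, hx, hy]
    | tmul p q =>
      simp only [LinearMap.lTensor_tmul, sliceRight, LinearMap.comp_apply]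
      generalize (comul q : A ⊗[k] A) = z
      induction z with
      | zero => simp
      | add x y hx hy => simp only [map_add, TensorProduct.tmul_add, hx, hy]
      | tmul x y => simp
  rw [h2, Coalgebra.coassoc_symm_apply, ← h1]
  rfl

/-- `∑ Δ(S² y₂) (S(y₁) ⊗ 1) = 1 ⊗ S² y`. -/
theorem sum_comul_antipode_antipode_mul (y : A) :
    LinearMap.mul' k (A ⊗[k] A) (TensorProduct.map (comul ∘ₗ antipode k ∘ₗ antipode k)
      ((Algebra.TensorProduct.includeLeft : A →ₐ[k] A ⊗[k] A).toLinearMap ∘ₗ antipode k)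
        (TensorProduct.comm k A A (comul y))) =
    1 ⊗ₜ antipode k (antipode k y) := by
  rw [← sum_comul_antipode_mul, comul_antipode, ← LinearMap.comp_apply (TensorProduct.map _ _),
    ← TensorProduct.map_comp]
  rfl

theorem sliceLeft_comp_sliceLeft (h : Module.Dual k A) {ι : Type*} (s : Finset ι)
    (α β : ι → Module.Dual k A)
    (hs : ∀ u v, ∑ j ∈ s, α j u * β j v = h (u * antipode k v)) :
    ∑ j ∈ s, sliceLeft (β j) ∘ₗ sliceLeft (α j) = h 1 • LinearMap.id := by
  have h1 : ∀ (p q : Module.Dual k A) (w : A ⊗[k] A),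
      sliceLeft q (TensorProduct.lid k A (LinearMap.rTensor A p w)) =
      TensorProduct.lid k A (LinearMap.rTensor A (LinearMap.mul' k k ∘ₗ TensorProduct.map p q)
        ((TensorProduct.assoc k A A A).symm (LinearMap.lTensor A comul w))) := by
    intro p q w
    induction w with
    | zero => simp
    | add x y hx hy => simp only [map_add, hx, hy]
    | tmul x y =>
      simp only [LinearMap.lTensor_tmul, LinearMap.rTensor_tmul, sliceLeft, LinearMap.comp_apply,
        TensorProduct.lid_tmul, map_smul, LinearEquiv.coe_coe]
      generalize (comul y : A ⊗[k] A) = z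
      induction z with
      | zero => simp
      | add x y hx hy => simp only [map_add, TensorProduct.tmul_add, smul_add, hx, hy]
      | tmul y z => simp [mul_smul]
  have h2 : ∑ j ∈ s, LinearMap.mul' k k ∘ₗ TensorProduct.map (α j) (β j) =
      h ∘ₗ LinearMap.mul' k A ∘ₗ LinearMap.lTensor A (antipode k) := by
    apply TensorProduct.ext'
    intro u v
    simp [LinearMap.sum_apply, hs]
  ext z
  rw [LinearMap.sum_apply]
  have h3 : ∀ j, (sliceLeft (β j) ∘ₗ sliceLeft (α j)) z = _ := fun j => h1 (α j) (β j) (comul z)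
  simp only [h3]
  rw [← map_sum, ← LinearMap.sum_apply]
  have h4 : ∑ j ∈ s, LinearMap.rTensor A (LinearMap.mul' k k ∘ₗ TensorProduct.map (α j) (β j)) =
      LinearMap.rTensor A (∑ j ∈ s, LinearMap.mul' k k ∘ₗ TensorProduct.map (α j) (β j)) :=
    (map_sum (LinearMap.rTensorHom A) _ _).symm
  rw [h4, h2, Coalgebra.coassoc_symm_apply, ← LinearMap.comp_apply (LinearMap.rTensor A _),
    ← LinearMap.rTensor_comp]
  have h5 : (h ∘ₗ LinearMap.mul' k A ∘ₗ LinearMap.lTensor A (antipode k)) ∘ₗ comul =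
      h 1 • counit := by
    ext c
    simp only [LinearMap.comp_apply]
    rw [HopfAlgebra.mul_antipode_lTensor_comul_apply]
    simp [Algebra.algebraMap_eq_smul_one, mul_comm]
  rw [h5, LinearMap.rTensor_smul, LinearMap.smul_apply, Coalgebra.rTensor_counit_comul]
  simp

theorem sliceRight_sliceLeft (f g : Module.Dual k A) (x : A) :
    sliceRight f (sliceLeft g x) = sliceLeft g (sliceRight f x) := by
  have : ∀ w : A ⊗[k] A, sliceRight f (TensorProduct.lid k A (LinearMap.rTensor A g w)) =
      TensorProduct.lid k A (LinearMap.rTensor A g (LinearMap.lTensor A (sliceRight f) w)) := by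
    intro w
    induction w with
    | zero => simp
    | add x y hx hy => simp only [map_add, hx, hy]
    | tmul p q => simp
  refine (this _).trans ?_
  rw [← comul_sliceRight]
  rfl

variable [FiniteDimensional k A]

theorem traceIntegral_integral (f : Module.Dual k A) (b : A) :
    sliceRight (traceIntegral f) b = traceIntegral f b • (1 : A) := by
  -- it suffices to apply an arbitrary functional `h`
  rw [← sub_eq_zero, ← Module.forall_dual_apply_eq_zero_iff k]
  intro h
  rw [map_sub, sub_eq_zero, map_smul]
  obtain ⟨s, hs⟩ := TensorProduct.exists_finset ((TensorProduct.dualDistribEquiv k A A).symm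
    (h ∘ₗ LinearMap.mul' k A ∘ₗ LinearMap.lTensor A (antipode k)))
  have hs' : ∀ u v, ∑ j ∈ s, j.1 u * j.2 v = h (u * antipode k v) := by
    intro u v
    have := congrArg (fun w => TensorProduct.dualDistribEquiv k A A w (u ⊗ₜ v)) hs
    simp only [LinearEquiv.apply_symm_apply] at this
    rw [map_sum, LinearMap.sum_apply] at this
    exact this.symm
  let X : A →ₗ[k] Module.End k A :=
    LinearMap.lcomp k A (antipode k ∘ₗ antipode k ∘ₗ sliceRight f) ∘ₗ
    LinearMap.mul k A
  have hX : ∀ b x, X b x = b * antipode k (antipode k (sliceRight f x)) := fun _ _ => rfl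
  have key : X (sliceLeft h b) = ∑ j ∈ s, sliceLeft j.1 ∘ₗ X b ∘ₗ sliceLeft j.2 := by
    let H : A ⊗[k] A →ₗ[k] A := (TensorProduct.lid k A).toLinearMap ∘ₗ LinearMap.rTensor A h
    have h1 : ∀ (p : A) (z : A ⊗[k] A), ∑ j ∈ s, j.2 p •
        TensorProduct.lid k A (LinearMap.rTensor A j.1 z) = H (z * (antipode k p ⊗ₜ 1)) := by
      intro p z
      induction z with
      | zero => simp
      | add x y hx hy => simp only [map_add, smul_add, add_mul, Finset.sum_add_distrib, hx, hy]
      | tmul u v => simp [H, ← hs', Finset.sum_smul, smul_smul, mul_comm]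
    have h2 : ∀ w : A ⊗[k] A, ∑ j ∈ s, sliceLeft j.1 (b * antipode k (antipode k
          (TensorProduct.lid k A (LinearMap.rTensor A j.2 w)))) =
        H (comul b * LinearMap.mul' k (A ⊗[k] A) (TensorProduct.map
          (comul ∘ₗ antipode k ∘ₗ antipode k)
          ((Algebra.TensorProduct.includeLeft : A →ₐ[k] A ⊗[k] A).toLinearMap ∘ₗ antipode k)
          (TensorProduct.comm k A A w))) := by
      intro w
      induction w with
      | zero => simp
      | add x y hx hy => simp only [map_add, mul_add, Finset.sum_add_distrib, hx, hy]
      | tmul p q =>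
        simp only [LinearMap.rTensor_tmul, TensorProduct.lid_tmul, map_smul, mul_smul_comm,
          TensorProduct.comm_tmul, TensorProduct.map_tmul, LinearMap.mul'_apply,
          LinearMap.comp_apply, AlgHom.toLinearMap_apply,
          Algebra.TensorProduct.includeLeft_apply]
        rw [← mul_assoc, ← Bialgebra.comul_mul, ← h1]
        rfl
    have h3 : ∀ (z : A ⊗[k] A) (y : A), H (z * (1 ⊗ₜ y)) = H z * y := by
      intro z y
      induction z with
      | zero => simp
      | add x y hx hy => rw [add_mul, map_add, hx, hy, map_add, add_mul]
      | tmul u v => simp [H]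
    ext x
    rw [LinearMap.sum_apply, hX]
    simp only [LinearMap.comp_apply, hX, sliceRight_sliceLeft]
    refine Eq.trans ?_ (h2 _).symm
    rw [sum_comul_antipode_antipode_mul, h3]
    rfl
  have e1 : h (sliceRight (traceIntegral f) b) = traceIntegral f (sliceLeft h b) := by
    simp only [sliceRight, sliceLeft, LinearMap.comp_apply]
    generalize (comul b : A ⊗[k] A) = w
    induction w with
    | zero => simp
    | add x y hx hy => simp only [map_add, hx, hy]
    | tmul x y => simp [mul_comm]
  have e2 : traceIntegral f (sliceLeft h b) = LinearMap.trace k A (X (sliceLeft h b)) := rfl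
  have e3 : traceIntegral f b = LinearMap.trace k A (X b) := rfl
  rw [e1, e2, e3, key, map_sum]
  have : ∀ j ∈ s, LinearMap.trace k A (sliceLeft j.1 ∘ₗ X b ∘ₗ sliceLeft j.2) =
      LinearMap.trace k A (X b ∘ₗ sliceLeft j.2 ∘ₗ sliceLeft j.1) := fun j _ =>
    LinearMap.trace_mul_comm k (sliceLeft j.1) (X b ∘ₗ sliceLeft j.2)
  rw [Finset.sum_congr rfl this, ← map_sum]
  have hsum : ∑ j ∈ s, X b ∘ₗ sliceLeft j.2 ∘ₗ sliceLeft j.1 =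
      X b ∘ₗ ∑ j ∈ s, sliceLeft j.2 ∘ₗ sliceLeft j.1 :=
    (map_sum (LinearMap.llcomp k A A A (X b)) _ _).symm
  rw [hsum, sliceLeft_comp_sliceLeft h s _ _ hs', LinearMap.comp_smul, LinearMap.comp_id, map_smul]
  simp [mul_comm]

theorem exists_traceIntegral_ne_zero : ∃ f : Module.Dual k A, traceIntegral f ≠ 0 := by
  by_contra! h
  let e := Module.finBasis k A
  have key : ∑ j, LinearMap.mulLeft k (antipode k (e j)) ∘ₗ antipode k ∘ₗ antipode k ∘ₗ
      sliceRight (e.coord j) = Algebra.linearMap k A ∘ₗ counit := by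
    have : ∀ w : A ⊗[k] A, ∑ j, antipode k (e j) * antipode k (antipode k
        (TensorProduct.rid k A (LinearMap.lTensor A (e.coord j) w))) =
        antipode k (LinearMap.mul' k A (LinearMap.rTensor A (antipode k) w)) := by
      intro w
      induction w with
      | zero => simp
      | add x y hx hy => simp only [map_add, mul_add, Finset.sum_add_distrib, hx, hy]
      | tmul p q =>
        simp only [LinearMap.lTensor_tmul, TensorProduct.rid_tmul, map_smul, LinearMap.rTensor_tmul,
          LinearMap.mul'_apply, HopfAlgebra.antipode_mul_antidistrib, mul_smul_comm]
        conv_rhs => rw [← e.sum_repr q]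
        simp only [map_sum, map_smul, Finset.sum_mul, smul_mul_assoc, Module.Basis.coord_apply]
    ext x
    rw [LinearMap.sum_apply]
    refine (this _).trans ?_
    rw [HopfAlgebra.mul_antipode_rTensor_comul_apply]
    simp [Algebra.algebraMap_eq_smul_one]
  have h1 := congrArg (LinearMap.trace k A) key
  rw [map_sum, LinearMap.trace_comp_comm'] at h1
  have h2 : (counit ∘ₗ Algebra.linearMap k A : k →ₗ[k] k) = LinearMap.id := by ext; simp
  rw [h2, LinearMap.trace_id, Finset.sum_eq_zero] at h1
  · simp at h1
  · intro j _
    rw [← traceIntegral_apply, h, LinearMap.zero_apply]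

variable (k A) in
/-- A finite-dimensional Hopf algebra is a Frobenius algebra, and its antipode is bijective. -/
theorem exists_frobenius : Function.Bijective (antipode k : A →ₗ[k] A) ∧
    ∃ l : Module.Dual k A, ∀ a, (∀ b, l (b * a) = 0) → a = 0 := by
  obtain ⟨f, hf⟩ := exists_traceIntegral_ne_zero (k := k) (A := A)
  have h := injective_of_integral hf (traceIntegral_integral f)
  have hinj : Function.Injective (antipode k : A →ₗ[k] A) := by
    rw [injective_iff_map_eq_zero]
    intro a ha
    exact h a fun b => by rw [ha, mul_zero, map_zero]
  have hsurj := LinearMap.injective_iff_surjective.1 hinj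
  refine ⟨⟨hinj, hsurj⟩, traceIntegral f, fun a ha => ?_⟩
  obtain ⟨a, rfl⟩ := hsurj a
  rw [h a ha, map_zero]

/-- A cyclic vector with zero annihilator of a module over a Frobenius algebra generates a direct
summand. -/
theorem exists_retraction {V : Type*} [AddCommGroup V] [Module k V] [Module A V]
    [IsScalarTower k A V] {l : Module.Dual k A} (hl : ∀ a, (∀ b, l (b * a) = 0) → a = 0)
    {v : V} (hv : ∀ a : A, a • v = 0 → a = 0) :
    ∃ ρ : V →ₗ[k] A, (∀ (a : A) w, ρ (a • w) = a * ρ w) ∧ ∀ a : A, ρ (a • v) = a := by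
  let β : A →ₗ[k] Module.Dual k A := LinearMap.llcomp k A A k l ∘ₗ (LinearMap.mul k A).flip
  have hβ : ∀ a b, β a b = l (b * a) := fun a b => rfl
  have hinj : Function.Injective β := by
    rw [injective_iff_map_eq_zero]
    intro a ha
    exact hl a fun b => by rw [← hβ, ha, LinearMap.zero_apply]
  let e : A ≃ₗ[k] Module.Dual k A :=
    LinearEquiv.ofInjectiveOfFinrankEq β hinj Subspace.dual_finrank_eq.symm
  have he : ∀ f b, l (b * e.symm f) = f b := fun f b => by
    rw [← hβ]; exact LinearMap.congr_fun (e.apply_symm_apply f) b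
  let o : A →ₗ[k] V := (LinearMap.toSpanSingleton A V v).restrictScalars k
  obtain ⟨g, hg⟩ := LinearMap.exists_leftInverse_of_injective o
    (LinearMap.ker_eq_bot'.2 fun a ha => hv a ha)
  let T : V →ₗ[k] Module.Dual k A :=
    LinearMap.llcomp k A V k (l ∘ₗ g) ∘ₗ (Algebra.lsmul k k V).toLinearMap.flip
  have hT : ∀ w b, T w b = l (g (b • w)) := fun w b => rfl
  have hρ : ∀ w b, l (b * e.symm (T w)) = l (g (b • w)) := fun w b => (he _ _).trans (hT w b)
  have ext : ∀ a a', (∀ b, l (b * a) = l (b * a')) → a = a' := fun a a' h =>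
    sub_eq_zero.1 (hl _ fun b => by rw [mul_sub, map_sub, h, sub_self])
  refine ⟨e.symm.toLinearMap ∘ₗ T, fun a w => ext _ _ fun b => ?_, fun a => ext _ _ fun b => ?_⟩
  · simp only [LinearMap.comp_apply, LinearEquiv.coe_coe]
    rw [hρ, ← mul_assoc, hρ, mul_smul]
  · simp only [LinearMap.comp_apply, LinearEquiv.coe_coe]
    rw [hρ, ← mul_smul]
    exact congrArg l (LinearMap.congr_fun hg (b * a))

end Frobenius

/-! ### Operators of a space of countable dimension that have an adjoint -/

section Adjointable

variable (k : Type*) [Field k]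

/-- The vector space of finitely supported sequences. -/
def FinSeq : Type _ := ℕ →₀ k

instance : AddCommGroup (FinSeq k) := inferInstanceAs (AddCommGroup (ℕ →₀ k))
instance : Module k (FinSeq k) := inferInstanceAs (Module k (ℕ →₀ k))

/-- The standard basis of the space of finitely supported sequences. -/
def FinSeq.basis : Module.Basis ℕ k (FinSeq k) := ⟨LinearEquiv.refl k (ℕ →₀ k)⟩

/-- The standard symmetric bilinear form on the space of finitely supported sequences. -/
def dot : FinSeq k →ₗ[k] FinSeq k →ₗ[k] k := (FinSeq.basis k).toDual

variable {k}

theorem dot_comm (x y : FinSeq k) : dot k x y = dot k y x := by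
  have : dot k = (dot k).flip := by
    refine (FinSeq.basis k).ext fun m => (FinSeq.basis k).ext fun n => ?_
    simp [dot, Module.Basis.toDual_apply, eq_comm]
  exact LinearMap.congr_fun₂ this x y

theorem dot_ext {x y : FinSeq k} (h : ∀ z, dot k z x = dot k z y) : x = y := by
  refine (FinSeq.basis k).toDual_injective (LinearMap.ext fun z => ?_)
  have := h z
  rwa [dot_comm, dot_comm z] at this

variable (k) in
/-- The algebra of all operators on the space of finitely supported sequences that have an
adjoint with respect to `dot`. -/
def Adjointable : Subalgebra k (Module.End k (FinSeq k)) where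
  carrier := {T | ∃ T' : Module.End k (FinSeq k), ∀ x y, dot k (T x) y = dot k x (T' y)}
  mul_mem' := by
    rintro S T ⟨S', hS⟩ ⟨T', hT⟩
    exact ⟨T' * S', fun x y => by simp [hS, hT]⟩
  add_mem' := by
    rintro S T ⟨S', hS⟩ ⟨T', hT⟩
    exact ⟨S' + T', fun x y => by simp [hS, hT]⟩
  algebraMap_mem' r := ⟨algebraMap k _ r, fun x y => by simp⟩

namespace Adjointable

theorem ext {b c : Adjointable k} (h : ∀ x, b.1 x = c.1 x) : b = c :=
  Subtype.ext (LinearMap.ext h)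

theorem mul_apply (b c : Adjointable k) (x : FinSeq k) : (b * c).1 x = b.1 (c.1 x) := rfl

theorem add_apply (b c : Adjointable k) (x : FinSeq k) : (b + c).1 x = b.1 x + c.1 x := rfl

theorem smul_apply (r : k) (b : Adjointable k) (x : FinSeq k) : (r • b).1 x = r • b.1 x := rfl

theorem one_apply (x : FinSeq k) : (1 : Adjointable k).1 x = x := rfl

theorem sum_apply {ι : Type*} (s : Finset ι) (b : ι → Adjointable k) (x : FinSeq k) :
    (∑ i ∈ s, b i).1 x = ∑ i ∈ s, (b i).1 x := by
  rw [AddSubmonoidClass.coe_finsetSum, LinearMap.sum_apply]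

theorem exists_transpose (b : Adjointable k) :
    ∃ c : Adjointable k, ∀ x y, dot k (b.1 x) y = dot k x (c.1 y) := by
  obtain ⟨T, hT⟩ := b.2
  exact ⟨⟨T, b.1, fun x y => by rw [dot_comm, ← hT, dot_comm]⟩, hT⟩

/-- The adjoint of an operator, as a linear map. -/
def transpose : Adjointable k →ₗ[k] Adjointable k where
  toFun b := (exists_transpose b).choose
  map_add' b c := by
    refine ext fun x => dot_ext fun z => ?_
    rw [← (exists_transpose (b + c)).choose_spec, add_apply, add_apply, map_add, map_add,
      LinearMap.add_apply, (exists_transpose b).choose_spec, (exists_transpose c).choose_spec]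
  map_smul' r b := by
    refine ext fun x => dot_ext fun z => ?_
    rw [← (exists_transpose (r • b)).choose_spec, RingHom.id_apply, smul_apply, smul_apply,
      map_smul,
      map_smul, LinearMap.smul_apply, (exists_transpose b).choose_spec]

theorem dot_transpose (b : Adjointable k) (x y : FinSeq k) :
    dot k x ((transpose b).1 y) = dot k (b.1 x) y :=
  ((exists_transpose b).choose_spec x y).symm

theorem transpose_eq {b c : Adjointable k} (h : ∀ x y, dot k (b.1 x) y = dot k x (c.1 y)) :
    transpose b = c :=
  ext fun x => dot_ext fun z => by rw [dot_transpose, h]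

theorem transpose_mul (b c : Adjointable k) : transpose (b * c) = transpose c * transpose b :=
  transpose_eq fun x y => by rw [mul_apply, mul_apply, dot_transpose, dot_transpose]

theorem transpose_one : transpose (1 : Adjointable k) = 1 := transpose_eq fun _ _ => rfl

/-- The operator `y ↦ ⟨t, y⟩ x` of rank one. -/
def ket (x t : FinSeq k) : Adjointable k :=
  ⟨(dot k t).smulRight x, (dot k x).smulRight t, fun y z => by
    simp only [LinearMap.smulRight_apply, map_smul, LinearMap.smul_apply, smul_eq_mul]
    rw [dot_comm t y, mul_comm]⟩

theorem ket_apply (x t y : FinSeq k) : (ket x t).1 y = dot k t y • x := rfl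

theorem transpose_ket (x t : FinSeq k) : transpose (ket x t) = ket t x :=
  transpose_eq fun y z => by
    rw [ket_apply, ket_apply, map_smul, map_smul, LinearMap.smul_apply, smul_eq_mul, smul_eq_mul,
      dot_comm t y, mul_comm]

theorem mul_ket (b : Adjointable k) (x t : FinSeq k) : b * ket x t = ket (b.1 x) t :=
  ext fun y => by rw [mul_apply, ket_apply, ket_apply, map_smul]

theorem ket_mul (b : Adjointable k) (x t : FinSeq k) : ket x t * b = ket x ((transpose b).1 t) :=
  ext fun y => by
    rw [mul_apply, ket_apply, ket_apply, dot_comm _ y, dot_transpose, dot_comm]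

theorem ket_mul_ket (x t x' t' : FinSeq k) : ket x t * ket x' t' = dot k t x' • ket x t' :=
  ext fun y => by
    rw [mul_apply, smul_apply, ket_apply, ket_apply, ket_apply, map_smul, smul_eq_mul, smul_smul,
      mul_comm]

variable (k) in
/-- The operators of finite rank form a locally finite ideal: finitely many of them lie in the
span of the `|u⟩⟨t|` with `u` and `t` in a finite set. -/
def finiteRank : LocallyFiniteIdeal k (Adjointable k) where
  carrier := Submodule.span k (Set.range fun p : FinSeq k × FinSeq k => ket p.1 p.2)
  mul_left b x hx := by
    induction hx using Submodule.span_induction with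
    | zero => rw [mul_zero]; exact zero_mem _
    | add x y _ _ hx hy => rw [mul_add]; exact add_mem hx hy
    | smul r x _ hx => rw [mul_smul_comm]; exact Submodule.smul_mem _ _ hx
    | mem x hx =>
      obtain ⟨p, rfl⟩ := hx
      rw [mul_ket]
      exact Submodule.subset_span ⟨(_, _), rfl⟩
  mul_right b x hx := by
    induction hx using Submodule.span_induction with
    | zero => rw [zero_mul]; exact zero_mem _
    | add x y _ _ hx hy => rw [add_mul]; exact add_mem hx hy
    | smul r x _ hx => rw [smul_mul_assoc]; exact Submodule.smul_mem _ _ hx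
    | mem x hx =>
      obtain ⟨p, rfl⟩ := hx
      rw [ket_mul]
      exact Submodule.subset_span ⟨(_, _), rfl⟩
  exists_fg s hs := by
    classical
    obtain ⟨T, hsT⟩ : ∃ T : Finset (FinSeq k × FinSeq k), (s : Set (Adjointable k)) ⊆
        Submodule.span k ((fun p : FinSeq k × FinSeq k => ket p.1 p.2) '' (T : Set _)) := by
      induction s using Finset.induction_on with
      | empty => exact ⟨∅, by simp⟩
      | insert a s _ ih =>
        obtain ⟨T, hT⟩ := ih fun x hx => hs (by simp_all)
        have ha := hs (show a ∈ ((insert a s : Finset _) : Set _) by simp)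
        obtain ⟨T', hT', haT⟩ := Submodule.mem_span_finite_of_mem_span ha
        rw [← Set.image_univ] at hT'
        obtain ⟨T', -, rfl⟩ := Finset.subset_set_image_iff.1 hT'
        rw [Finset.coe_image] at haT
        refine ⟨T ∪ T', fun x hx => ?_⟩
        rw [Finset.coe_insert] at hx
        rcases hx with rfl | hx
        · exact Submodule.span_mono (Set.image_mono (by simp)) haT
        · exact Submodule.span_mono (Set.image_mono (by simp)) (hT hx)
    let W : Finset (FinSeq k) := T.image Prod.fst ∪ T.image Prod.snd
    refine ⟨Submodule.span k ((fun p : FinSeq k × FinSeq k => ket p.1 p.2) ''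
      ((W ×ˢ W : Finset _) : Set _)), Submodule.span_mono (Set.image_subset_range _ _),
      Submodule.fg_span ((Finset.finite_toSet _).image _),
      hsT.trans (Submodule.span_mono (Set.image_mono ?_)), fun x hx y hy => ?_⟩
    · intro p hp
      rw [Finset.coe_product]
      exact ⟨by simp only [W, Finset.coe_union, Finset.coe_image]; exact .inl ⟨p, hp, rfl⟩,
        by simp only [W, Finset.coe_union, Finset.coe_image]; exact .inr ⟨p, hp, rfl⟩⟩
    · induction hx using Submodule.span_induction with
      | zero => rw [zero_mul]; exact zero_mem _
      | add x z _ _ hx hz => rw [add_mul]; exact add_mem hx hz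
      | smul r x _ hx => rw [smul_mul_assoc]; exact Submodule.smul_mem _ _ hx
      | mem x hx =>
        obtain ⟨p, hp, rfl⟩ := hx
        induction hy using Submodule.span_induction with
        | zero => rw [mul_zero]; exact zero_mem _
        | add x z _ _ hx hz => rw [mul_add]; exact add_mem hx hz
        | smul r x _ hx => rw [mul_smul_comm]; exact Submodule.smul_mem _ _ hx
        | mem y hy =>
          obtain ⟨q, hq, rfl⟩ := hy
          simp only [ket_mul_ket]
          refine Submodule.smul_mem _ _ (Submodule.subset_span ⟨(p.1, q.2), ?_, rfl⟩)
          rw [Finset.mem_coe, Finset.mem_product] at hp hq ⊢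
          exact ⟨hp.1, hq.2⟩

theorem ket_mem (x t : FinSeq k) : ket x t ∈ (finiteRank k).carrier :=
  Submodule.subset_span ⟨(x, t), rfl⟩

theorem transpose_mem {b : Adjointable k} (hb : b ∈ (finiteRank k).carrier) :
    transpose b ∈ (finiteRank k).carrier := by
  change b ∈ Submodule.span _ _ at hb
  induction hb using Submodule.span_induction with
  | zero => rw [map_zero]; exact zero_mem _
  | add x y _ _ hx hy => rw [map_add]; exact add_mem hx hy
  | smul r x _ hx => rw [map_smul]; exact Submodule.smul_mem _ _ hx
  | mem x hx =>
    obtain ⟨p, rfl⟩ := hx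
    simp only [transpose_ket]
    exact ket_mem _ _

end Adjointable

end Adjointable

/-! ### Splitting off finite-dimensional subspaces -/

section Splitting

variable {k : Type*} [Field k]

/-- An isometric embedding of the space `FinSeq k` of finitely supported sequences into itself,
with an orthogonal complement identified with `F`: an isomorphism `F ⊕ FinSeq k ≃ FinSeq k` whose
restriction to the second summand is adjoint to the second component of its inverse. -/
structure Splitting (k F : Type*) [Field k] [AddCommGroup F] [Module k F] where
  /-- The isomorphism. -/
  equiv : (F × FinSeq k) ≃ₗ[k] FinSeq k
  dot_equiv : ∀ x y, dot k (equiv (0, x)) y = dot k x (equiv.symm y).2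

variable {F : Type*} [AddCommGroup F] [Module k F]

theorem nonempty_splitting [FiniteDimensional k F] : Nonempty (Splitting k F) := by
  let b := (Module.finBasis k F).prod (FinSeq.basis k)
  let e : Fin (Module.finrank k F) ⊕ ℕ ≃ ℕ := Classical.choice (Cardinal.eq.1 (by simp))
  let E : (F × FinSeq k) ≃ₗ[k] FinSeq k := b.equiv (FinSeq.basis k) e
  refine ⟨⟨E, fun x y => ?_⟩⟩
  obtain ⟨y, rfl⟩ := E.surjective y
  rw [E.symm_apply_apply]
  have : ((dot k) ∘ₗ E.toLinearMap ∘ₗ LinearMap.inr k F _).compl₂ E.toLinearMap =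
      (dot k).compl₂ (LinearMap.snd k F _) := by
    refine (FinSeq.basis k).ext fun m => b.ext fun n => ?_
    have h1 : ((0 : F), FinSeq.basis k m) = b (Sum.inr m) := by simp [b]
    simp only [LinearMap.compl₂_apply, LinearMap.comp_apply, LinearEquiv.coe_coe,
      LinearMap.inr_apply, LinearMap.snd_apply]
    rw [h1]
    simp only [E, Module.Basis.equiv_apply, dot, Module.Basis.toDual_apply, e.injective.eq_iff]
    rcases n with n | n <;> simp [b, Module.Basis.toDual_apply]
  exact LinearMap.congr_fun₂ this x y

end Splitting

namespace Splitting

variable {k : Type*} [Field k] {F : Type*} [AddCommGroup F] [Module k F] (s : Splitting k F)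

/-- The inclusion of the complement `F`. -/
def incl : F →ₗ[k] FinSeq k := s.equiv.toLinearMap ∘ₗ LinearMap.inl k F _

/-- The isometric embedding of `FinSeq k` as a linear map. -/
def emb : FinSeq k →ₗ[k] FinSeq k := s.equiv.toLinearMap ∘ₗ LinearMap.inr k F _

/-- The projection to the complement `F`. -/
def proj : FinSeq k →ₗ[k] F := LinearMap.fst k F _ ∘ₗ s.equiv.symm.toLinearMap

/-- The left inverse, and adjoint, of the isometric embedding. -/
def unemb : FinSeq k →ₗ[k] FinSeq k := LinearMap.snd k F _ ∘ₗ s.equiv.symm.toLinearMap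

@[simp] theorem proj_incl (a : F) : s.proj (s.incl a) = a := by simp [proj, incl]
@[simp] theorem proj_emb (x : FinSeq k) : s.proj (s.emb x) = 0 := by simp [proj, emb]
@[simp] theorem unemb_incl (a : F) : s.unemb (s.incl a) = 0 := by simp [unemb, incl]
@[simp] theorem unemb_emb (x : FinSeq k) : s.unemb (s.emb x) = x := by simp [unemb, emb]

theorem incl_proj_add_emb_unemb (y : FinSeq k) : s.incl (s.proj y) + s.emb (s.unemb y) = y := by
  simp [proj, incl, unemb, emb, ← map_add]

theorem incl_injective : Function.Injective s.incl :=
  Function.LeftInverse.injective s.proj_incl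

theorem dot_equiv_equiv (a b : F) (x y : FinSeq k) :
    dot k (s.equiv (a, x)) (s.equiv (b, y)) =
      dot k (s.equiv (a, 0)) (s.equiv (b, 0)) + dot k x y := by
  have h1 : s.equiv (a, x) = s.equiv (a, 0) + s.equiv (0, x) := by rw [← map_add]; simp
  have h2 : s.equiv (b, y) = s.equiv (b, 0) + s.equiv (0, y) := by rw [← map_add]; simp
  have h3 : ∀ (x : FinSeq k) (b : F) y, dot k (s.equiv (0, x)) (s.equiv (b, y)) = dot k x y := by
    intro x b y
    rw [s.dot_equiv, s.equiv.symm_apply_apply]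
  rw [h1, map_add, LinearMap.add_apply, h3, h2, map_add, dot_comm (s.equiv (a, 0)) (s.equiv (0, y)),
    h3, map_zero, add_zero]

theorem ext {b c : Adjointable k} (h : ∀ a x, b.1 (s.equiv (a, x)) = c.1 (s.equiv (a, x))) :
    b = c := by
  refine Adjointable.ext fun y => ?_
  obtain ⟨⟨a, x⟩, rfl⟩ := s.equiv.surjective y
  exact h a x

/-- The restriction of the form to the complement `F`. -/
def form : F →ₗ[k] Module.Dual k F :=
  (dot k).compl₁₂ (s.equiv.toLinearMap ∘ₗ LinearMap.inl k F _)
    (s.equiv.toLinearMap ∘ₗ LinearMap.inl k F _)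

theorem form_apply (a b : F) : s.form a b = dot k (s.equiv (a, 0)) (s.equiv (b, 0)) := rfl

theorem dot_equiv_left (a : F) (y : FinSeq k) :
    dot k (s.equiv (a, 0)) y = s.form a (s.equiv.symm y).1 := by
  obtain ⟨⟨b, y⟩, rfl⟩ := s.equiv.surjective y
  rw [s.dot_equiv_equiv, map_zero, LinearMap.zero_apply, add_zero, s.equiv.symm_apply_apply,
    form_apply]

theorem form_comm (a b : F) : s.form a b = s.form b a := dot_comm _ _

theorem form_injective : Function.Injective s.form := by
  rw [injective_iff_map_eq_zero]
  intro a ha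
  have : s.equiv (a, 0) = 0 := dot_ext fun z => by
    rw [dot_comm, dot_equiv_left, ha, LinearMap.zero_apply, map_zero]
  simpa using this

/-- The isometric embedding of `FinSeq k` given by a splitting. -/
def shift : Adjointable k :=
  ⟨s.equiv.toLinearMap ∘ₗ LinearMap.inr k F _, LinearMap.snd k F _ ∘ₗ s.equiv.symm.toLinearMap,
    s.dot_equiv⟩

theorem shift_apply (x : FinSeq k) : s.shift.1 x = s.equiv (0, x) := rfl

theorem transpose_shift_apply (x : FinSeq k) :
    (Adjointable.transpose s.shift).1 x = (s.equiv.symm x).2 := by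
  refine dot_ext fun z => ?_
  rw [Adjointable.dot_transpose]
  exact s.dot_equiv z x

theorem transpose_transpose_shift :
    Adjointable.transpose (Adjointable.transpose s.shift) = s.shift :=
  Adjointable.transpose_eq fun x y => by
    rw [dot_comm, Adjointable.dot_transpose, dot_comm]

theorem shift_eq_emb (x : FinSeq k) :
    s.shift.1 x = s.emb x := rfl

variable [FiniteDimensional k F]

/-- The isomorphism of `F` with its dual given by the restriction of the form. -/
def riesz : F ≃ₗ[k] Module.Dual k F :=
  LinearEquiv.ofInjectiveOfFinrankEq s.form s.form_injective Subspace.dual_finrank_eq.symm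

theorem riesz_symm (θ : Module.Dual k F) : s.form (s.riesz.symm θ) = θ :=
  s.riesz.apply_symm_apply θ

/-- The operator of finite rank that maps `(a, x)` to `T a`. -/
def ofLinear : (F →ₗ[k] FinSeq k) →ₗ[k] Adjointable k where
  toFun T := ∑ i, Adjointable.ket (T (Module.finBasis k F i))
    (s.equiv (s.riesz.symm ((Module.finBasis k F).coord i), 0))
  map_add' T T' := by
    rw [← Finset.sum_add_distrib]
    refine Finset.sum_congr rfl fun i _ => Adjointable.ext fun x => ?_
    simp only [Adjointable.add_apply, Adjointable.ket_apply, LinearMap.add_apply, smul_add]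
  map_smul' r T := by
    rw [RingHom.id_apply, Finset.smul_sum]
    refine Finset.sum_congr rfl fun i _ => Adjointable.ext fun x => ?_
    simp only [Adjointable.smul_apply, Adjointable.ket_apply, LinearMap.smul_apply, smul_comm r]

theorem ofLinear_apply (T : F →ₗ[k] FinSeq k) (y : FinSeq k) :
    (s.ofLinear T).1 y = T (s.equiv.symm y).1 := by
  change (∑ i, Adjointable.ket (T (Module.finBasis k F i))
    (s.equiv (s.riesz.symm ((Module.finBasis k F).coord i), 0)) : Adjointable k).1 y = _
  rw [Adjointable.sum_apply]
  conv_rhs => rw [← (Module.finBasis k F).sum_repr (s.equiv.symm y).1, map_sum]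
  refine Finset.sum_congr rfl fun i _ => ?_
  rw [Adjointable.ket_apply, dot_equiv_left, riesz_symm, map_smul, Module.Basis.coord_apply]

theorem ofLinear_mem (T : F →ₗ[k] FinSeq k) :
    s.ofLinear T ∈ (Adjointable.finiteRank k).carrier := by
  change ∑ i, Adjointable.ket (T (Module.finBasis k F i))
    (s.equiv (s.riesz.symm ((Module.finBasis k F).coord i), 0)) ∈ _
  exact Submodule.sum_mem _ fun _ _ => Adjointable.ket_mem _ _

/-- The operator `T ⊕ r`, which acts on the complement `F` by `T` and on its orthogonal by the
scalar `r`. -/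
def block : (Module.End k F × k) →ₐ[k] Adjointable k :=
  AlgHom.ofLinearMap
    (s.ofLinear ∘ₗ LinearMap.llcomp k F F (FinSeq k) (s.equiv.toLinearMap ∘ₗ LinearMap.inl k F _) ∘ₗ
        LinearMap.fst k _ _ +
      (LinearMap.snd k (Module.End k F) k).smulRight (s.shift * Adjointable.transpose s.shift))
    (s.ext fun a x => by
      change (s.ofLinear _ + (1 : k) • (s.shift * Adjointable.transpose s.shift)).1 _ = _
      rw [Adjointable.add_apply, Adjointable.smul_apply, Adjointable.mul_apply, shift_apply,
        transpose_shift_apply, ofLinear_apply, s.equiv.symm_apply_apply, one_smul,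
        Adjointable.one_apply]
      change s.equiv (a, 0) + s.equiv (0, x) = _
      rw [← map_add]; simp)
    (fun p q => s.ext fun a x => by
      change (s.ofLinear _ + (p.2 * q.2) • (s.shift * Adjointable.transpose s.shift)).1 _ =
        ((s.ofLinear _ + p.2 • (s.shift * Adjointable.transpose s.shift)) *
        (s.ofLinear _ + q.2 • (s.shift * Adjointable.transpose s.shift)) : Adjointable k).1 _
      simp only [Adjointable.add_apply, Adjointable.smul_apply, Adjointable.mul_apply, shift_apply,
        transpose_shift_apply, ofLinear_apply, s.equiv.symm_apply_apply]
      change s.equiv (p.1 (q.1 a), 0) + _ =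
        s.equiv (p.1 (s.equiv.symm (s.equiv (q.1 a, 0) + _)).1, 0) +
          p.2 • s.equiv (0, (s.equiv.symm (s.equiv (q.1 a, 0) + _)).2)
      simp only [← map_add, ← map_smul, s.equiv.symm_apply_apply]
      simp [mul_smul])

theorem block_apply (T : Module.End k F) (r : k) (a : F) (x : FinSeq k) :
    (s.block (T, r)).1 (s.equiv (a, x)) = s.equiv (T a, r • x) := by
  change (s.ofLinear _ + r • (s.shift * Adjointable.transpose s.shift)).1 _ = _
  simp only [Adjointable.add_apply, Adjointable.smul_apply, Adjointable.mul_apply, shift_apply,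
    transpose_shift_apply, ofLinear_apply, s.equiv.symm_apply_apply]
  change s.equiv (T a, 0) + _ = _
  simp only [← map_add, ← map_smul]
  simp

theorem block_zero_mem (T : Module.End k F) :
    s.block (T, 0) ∈ (Adjointable.finiteRank k).carrier := by
  have : s.block (T, 0) = s.ofLinear (s.equiv.toLinearMap ∘ₗ LinearMap.inl k F _ ∘ₗ T) :=
    s.ext fun a x => by
      rw [block_apply, ofLinear_apply, s.equiv.symm_apply_apply, zero_smul]
      rfl
  rw [this]
  exact s.ofLinear_mem _

theorem transpose_shift_eq_unemb
    (x : FinSeq k) : (Adjointable.transpose s.shift).1 x = s.unemb x := s.transpose_shift_apply x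

theorem ofLinear_eq_proj (T : F →ₗ[k] FinSeq k) (x : FinSeq k) :
    (s.ofLinear T).1 x = T (s.proj x) := s.ofLinear_apply T x

theorem proj_block (T : Module.End k F) (r : k) (y : FinSeq k) :
    s.proj ((s.block (T, r)).1 y) = T (s.proj y) := by
  obtain ⟨⟨a, x⟩, rfl⟩ := s.equiv.surjective y
  rw [s.block_apply]
  simp [Splitting.proj]

theorem unemb_block (T : Module.End k F) (r : k) (y : FinSeq k) :
    s.unemb ((s.block (T, r)).1 y) = r • s.unemb y := by
  obtain ⟨⟨a, x⟩, rfl⟩ := s.equiv.surjective y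
  rw [s.block_apply]
  simp [Splitting.unemb]

/-! ### Twisting the adjoint by a bilinear form -/

/-- The adjoint with respect to the bilinear form `⟨x, (g ⊕ 1) y⟩`, where `g` is an automorphism of
the complement `F`. -/
def twistedTranspose (g : (Module.End k F)ˣ) : Adjointable k →ₗ[k] Adjointable k :=
  LinearMap.mulRight k (s.block (g, 1)) ∘ₗ LinearMap.mulLeft k
    (s.block ((g⁻¹ : (Module.End k F)ˣ), 1)) ∘ₗ
    Adjointable.transpose

theorem twistedTranspose_apply (g : (Module.End k F)ˣ) (b : Adjointable k) :
    s.twistedTranspose g b =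
      s.block ((g⁻¹ : (Module.End k F)ˣ), 1) * Adjointable.transpose b * s.block (g, 1) := rfl

theorem block_mul_block_inv (g : (Module.End k F)ˣ) :
    s.block (g, 1) * s.block ((g⁻¹ : (Module.End k F)ˣ), 1) = 1 := by
  rw [← map_mul, ← map_one s.block]; simp [-map_one, Prod.one_eq_mk]

theorem block_inv_mul_block (g : (Module.End k F)ˣ) :
    s.block ((g⁻¹ : (Module.End k F)ˣ), 1) * s.block (g, 1) = 1 := by
  rw [← map_mul, ← map_one s.block]; simp [-map_one, Prod.one_eq_mk]

theorem twistedTranspose_mul (g : (Module.End k F)ˣ) (b c : Adjointable k) :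
    s.twistedTranspose g (b * c) = s.twistedTranspose g c * s.twistedTranspose g b := by
  simp only [twistedTranspose_apply, Adjointable.transpose_mul, mul_assoc]
  rw [← mul_assoc (s.block (g, 1)), block_mul_block_inv, one_mul]

theorem twistedTranspose_one (g : (Module.End k F)ˣ) : s.twistedTranspose g 1 = 1 := by
  rw [twistedTranspose_apply, Adjointable.transpose_one, mul_one, block_inv_mul_block]

theorem twistedTranspose_mem (g : (Module.End k F)ˣ) {b : Adjointable k}
    (hb : b ∈ (Adjointable.finiteRank k).carrier) :
    s.twistedTranspose g b ∈ (Adjointable.finiteRank k).carrier :=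
  (Adjointable.finiteRank k).mul_right _ _ ((Adjointable.finiteRank k).mul_left _ _
    (Adjointable.transpose_mem hb))

/-- The twist is trivial modulo operators of finite rank. -/
theorem transpose_sub_twistedTranspose_mem (g : (Module.End k F)ˣ) (b : Adjointable k) :
    Adjointable.transpose b - s.twistedTranspose g b ∈ (Adjointable.finiteRank k).carrier := by
  have h : ∀ T : Module.End k F, s.block (T, 1) = 1 + s.block (T - 1, 0) := by
    intro T
    have := map_add s.block 1 (T - 1, 0)
    rw [map_one] at this
    rw [← this]
    simp [Prod.one_eq_mk]
  rw [twistedTranspose_apply, h, h, mul_add, mul_one, add_mul, one_mul, add_assoc,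
    sub_add_cancel_left]
  refine neg_mem (add_mem ?_ ?_)
  · exact (Adjointable.finiteRank k).mul_right _ _ (s.block_zero_mem _)
  · exact (Adjointable.finiteRank k).mul_left _ _ (s.block_zero_mem _)

theorem twistedTranspose_eq (g : (Module.End k F)ˣ) {b c : Adjointable k}
    (h : ∀ x y, dot k (b.1 x) ((s.block (g, 1)).1 y) = dot k x ((s.block (g, 1)).1 (c.1 y))) :
    s.twistedTranspose g b = c := by
  have : Adjointable.transpose b * s.block (g, 1) = s.block (g, 1) * c :=
    Adjointable.ext fun y => dot_ext fun x => by
      rw [Adjointable.mul_apply, Adjointable.mul_apply, Adjointable.dot_transpose, h]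
  rw [twistedTranspose_apply, mul_assoc, this, ← mul_assoc, block_inv_mul_block, one_mul]

end Splitting

/-! ### Matrix coefficients -/

section MatrixCoefficient

open Coalgebra (comul counit)

variable {k V : Type*} [Field k] [AddCommGroup V] [Module k V]

/-- The matrix coefficient `β ↦ ξ (β v)` in `Coend V`. -/
def matrixCoeff : Module.Dual k V →ₗ[k] V →ₗ[k] Coend k V :=
  LinearMap.mk₂ k (fun ξ v => (Coend.toDual k V).symm (ξ ∘ₗ LinearMap.applyₗ v))
    (fun _ _ _ => rfl) (fun _ _ _ => rfl)
    (fun ξ v w => by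
      rw [← map_add, map_add]
      congr 1
      ext β : 1
      simp)
    (fun r ξ v => by
      rw [← map_smul, map_smul]
      congr 1
      ext β : 1
      simp)

theorem toDual_matrixCoeff (ξ : Module.Dual k V) (v : V) (β : Module.End k V) :
    Coend.toDual k V (matrixCoeff ξ v) β = ξ (β v) := rfl

section Orbit

variable {A : Type*} [Ring A] [Algebra k A] [Module A V] [IsScalarTower k A V]

variable (k) in
/-- The map `a ↦ a • v`. -/
def orbit : V →ₗ[k] A →ₗ[k] V := (Algebra.lsmul k k V).toLinearMap.flip

@[simp] theorem orbit_apply (v : V) (a : A) : orbit k v a = a • v := rfl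

/-- The right action of `A` on the dual space of `V`. -/
def dualAct : Module.Dual k V →ₗ[k] A →ₗ[k] Module.Dual k V :=
  (LinearMap.lcomp k (V →ₗ[k] k) (Algebra.lsmul k k V).toLinearMap) ∘ₗ LinearMap.llcomp k V V k

@[simp] theorem dualAct_apply (ξ : Module.Dual k V) (a : A) (v : V) :
    dualAct ξ a v = ξ (a • v) := rfl

end Orbit

variable [FiniteDimensional k V]

instance : FiniteDimensional k (Coend k V) :=
  inferInstanceAs (FiniteDimensional k (Module.Dual k (Module.End k V)))

theorem sum_coord_smul {M : Type*} [AddCommGroup M] [Module k M] (G : V →ₗ[k] M) (u : V) :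
    ∑ i, (Module.finBasis k V).coord i u • G (Module.finBasis k V i) = G u := by
  conv_rhs => rw [← (Module.finBasis k V).sum_repr u, map_sum]
  simp only [map_smul, Module.Basis.coord_apply]

theorem sum_apply_smul_coord {M : Type*} [AddCommGroup M] [Module k M] (G : Module.Dual k V →ₗ[k] M)
    (η : Module.Dual k V) :
    ∑ i, η (Module.finBasis k V i) • G ((Module.finBasis k V).coord i) = G η := by
  conv_rhs => rw [← (Module.finBasis k V).sum_dual_apply_smul_coord η, map_sum]
  simp only [map_smul]

theorem comul_matrixCoeff (ξ : Module.Dual k V) (v : V) :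
    comul (R := k) (matrixCoeff ξ v) = ∑ i, matrixCoeff ξ (Module.finBasis k V i) ⊗ₜ[k]
      matrixCoeff ((Module.finBasis k V).coord i) v := by
  refine Coend.ext_tensor k V fun x y => ?_
  rw [Coend.dualTensor_comul, map_sum, LinearMap.sum_apply]
  simp only [Coend.dualTensor_tmul, toDual_matrixCoeff]
  refine (sum_coord_smul (ξ ∘ₗ x) (y v)).symm.trans ?_
  simp [mul_comm]

/-- The coefficients `ξ i` in `c = ∑ matrixCoeff (ξ i) (w i)`, for a basis `w` of `V`. -/
def dualCoord (i : Fin (Module.finrank k V)) : Coend k V →ₗ[k] Module.Dual k V :=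
  LinearMap.lcomp k k (LinearMap.smulRightₗ ((Module.finBasis k V).coord i)) ∘ₗ
    (Coend.toDual k V).toLinearMap

theorem dualCoord_apply (i : Fin (Module.finrank k V)) (c : Coend k V) (v : V) :
    dualCoord i c v = Coend.toDual k V c (((Module.finBasis k V).coord i).smulRight v) := rfl

theorem sum_matrixCoeff_dualCoord (c : Coend k V) :
    ∑ i, matrixCoeff (dualCoord i c) (Module.finBasis k V i) = c := by
  apply (Coend.toDual k V).injective
  ext β : 1
  rw [map_sum, LinearMap.sum_apply]
  simp only [toDual_matrixCoeff, dualCoord_apply]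
  rw [← map_sum]
  congr 1
  ext u
  rw [LinearMap.sum_apply]
  exact sum_coord_smul β u

theorem dualCoord_matrixCoeff (i : Fin (Module.finrank k V)) (ξ : Module.Dual k V) (v : V) :
    dualCoord i (matrixCoeff ξ v) = (Module.finBasis k V).coord i v • ξ := by
  ext u
  rw [dualCoord_apply, toDual_matrixCoeff]
  simp

/-- The linear map on `Coend V ≃ V* ⊗ V` given by a bilinear map. -/
def coendLift {M : Type*} [AddCommGroup M] [Module k M] (E : Module.Dual k V →ₗ[k] V →ₗ[k] M) :
    Coend k V →ₗ[k] M :=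
  ∑ i, E.flip (Module.finBasis k V i) ∘ₗ dualCoord i

theorem coendLift_apply {M : Type*} [AddCommGroup M] [Module k M]
    (E : Module.Dual k V →ₗ[k] V →ₗ[k] M) (c : Coend k V) :
    coendLift E c = ∑ i, E (dualCoord i c) (Module.finBasis k V i) := by
  simp [coendLift, LinearMap.sum_apply]

@[simp]
theorem coendLift_matrixCoeff {M : Type*} [AddCommGroup M] [Module k M]
    (E : Module.Dual k V →ₗ[k] V →ₗ[k] M) (ξ : Module.Dual k V) (v : V) :
    coendLift E (matrixCoeff ξ v) = E ξ v := by
  rw [coendLift_apply]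
  simp only [dualCoord_matrixCoeff, map_smul, LinearMap.smul_apply]
  exact sum_coord_smul (E ξ) v

theorem coend_hom_ext {M : Type*} [AddCommGroup M] [Module k M] {f g : Coend k V →ₗ[k] M}
    (h : ∀ ξ v, f (matrixCoeff ξ v) = g (matrixCoeff ξ v)) : f = g := by
  ext c
  rw [← sum_matrixCoeff_dualCoord c, map_sum, map_sum]
  exact Finset.sum_congr rfl fun i _ => h _ _

theorem convInverse_coendLift {R : Type*} [Ring R] [Algebra k R]
    {E F : Module.Dual k V →ₗ[k] V →ₗ[k] R}
    (h : ∀ ξ v, ∑ i, E ξ (Module.finBasis k V i) * F ((Module.finBasis k V).coord i) v = ξ v • 1)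
    (h' : ∀ ξ v, ∑ i, F ξ (Module.finBasis k V i) * E ((Module.finBasis k V).coord i) v = ξ v • 1) :
    ConvInverse (coendLift E) (coendLift F) := by
  have key : ∀ E F : Module.Dual k V →ₗ[k] V →ₗ[k] R, (∀ ξ v,
      ∑ i, E ξ (Module.finBasis k V i) * F ((Module.finBasis k V).coord i) v = ξ v • 1) →
      LinearMap.mul' k R ∘ₗ TensorProduct.map (coendLift E) (coendLift F) ∘ₗ comul =
        Algebra.linearMap k R ∘ₗ counit := by
    intro E F h
    refine coend_hom_ext fun ξ v => ?_
    simp only [LinearMap.comp_apply]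
    rw [comul_matrixCoeff, map_sum, map_sum]
    simp only [TensorProduct.map_tmul, LinearMap.mul'_apply, coendLift_matrixCoeff]
    rw [h, Coend.counit_apply, toDual_matrixCoeff, Algebra.linearMap_apply,
      Algebra.algebraMap_eq_smul_one]
    rfl
  exact ⟨LinearMap.congr_fun (key E F h), LinearMap.congr_fun (key F E h')⟩

variable {A : Type*} [Ring A] [HopfAlgebra k A] [Module A V] [IsScalarTower k A V]

theorem act_matrixCoeff (ξ : Module.Dual k V) (v : V) (a : A) :
    RightModuleCoalgebra.act (matrixCoeff ξ v ⊗ₜ[k] a) = TensorProduct.lift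
      (matrixCoeff.compl₁₂ (dualAct ξ) (orbit k v ∘ₗ HopfAlgebra.antipode k)) (comul a) := by
  apply (Coend.toDual k V).injective
  ext β : 1
  refine (coendAct_apply (matrixCoeff ξ v) a β).trans ?_
  change Coend.toDual k V (matrixCoeff ξ v) (sandwich k V A (comul a) β) = _
  generalize (comul a : A ⊗[k] A) = w
  induction w with
  | zero => simp
  | add x y hx hy => simp only [map_add, LinearMap.add_apply, hx, hy]
  | tmul p q =>
    rw [sandwich_tmul]
    rfl

end MatrixCoefficient

/-! ### An invertible equivariant map on `Coend V` -/

section Equivariant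

open HopfAlgebra (antipode)
open Coalgebra (comul counit)

variable {k A V : Type*} [Field k] [Ring A] [HopfAlgebra k A] [AddCommGroup V] [Module k V]
  [Module A V] [IsScalarTower k A V]

/-- The map `a ↦ ∑ ξ(a₁ v₀) S(a₂) v`. -/
def evalMap (v₀ : V) : Module.Dual k V →ₗ[k] V →ₗ[k] A →ₗ[k] V :=
  LinearMap.mk₂ k (fun ξ v => orbit k v ∘ₗ antipode k ∘ₗ sliceLeft (ξ ∘ₗ orbit k v₀))
    (fun ξ η v => by ext; simp [LinearMap.add_comp, sliceLeft_add, add_smul])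
    (fun r ξ v => by ext; simp [LinearMap.smul_comp, sliceLeft_smul])
    (fun ξ v w => by ext; simp)
    (fun r ξ v => by ext; simp)

theorem evalMap_apply (v₀ : V) (ξ : Module.Dual k V) (v : V) (a : A) :
    evalMap v₀ ξ v a = antipode k (sliceLeft (ξ ∘ₗ orbit k v₀) a) • v := rfl

/-- The map `w ↦ ∑ ξ(b₂ w) b₁`, where `b = ρ v`. -/
def coevalMap (ρ : V →ₗ[k] A) : Module.Dual k V →ₗ[k] V →ₗ[k] V →ₗ[k] A :=
  LinearMap.mk₂ k (fun ξ v =>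
    { toFun := fun w => sliceRight (ξ ∘ₗ orbit k w) (ρ v)
      map_add' := fun w w' => by simp [LinearMap.comp_add, sliceRight_add]
      map_smul' := fun r w => by simp [LinearMap.comp_smul, sliceRight_smul] })
    (fun ξ η v => by ext; simp [LinearMap.add_comp, sliceRight_add])
    (fun r ξ v => by ext; simp [LinearMap.smul_comp, sliceRight_smul])
    (fun ξ v w => by ext; simp)
    (fun r ξ v => by ext; simp)

theorem coevalMap_apply (ρ : V →ₗ[k] A) (ξ : Module.Dual k V) (v w : V) :
    coevalMap ρ ξ v w = sliceRight (ξ ∘ₗ orbit k w) (ρ v) := rfl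

theorem counit_sliceLeft (f : Module.Dual k A) (a : A) : counit (R := k) (sliceLeft f a) = f a := by
  have : ∀ w : A ⊗[k] A, counit (R := k) (TensorProduct.lid k A (LinearMap.rTensor A f w)) =
      f (TensorProduct.rid k A (LinearMap.lTensor A counit w)) := by
    intro w
    induction w with
    | zero => simp
    | add x y hx hy => simp only [map_add, hx, hy]
    | tmul p q => simp [mul_comm]
  refine (this _).trans ?_
  rw [Coalgebra.lTensor_counit_comul]
  simp

/-- The map `p ⊗ q ↦ ∑ ξ(p₂ S(q) v) p₁`. -/
def sliceAntipode (ξ : Module.Dual k V) (v : V) : A ⊗[k] A →ₗ[k] A :=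
  TensorProduct.lift (LinearMap.mk₂ k
    (fun p q : A => sliceRight (ξ ∘ₗ orbit k (antipode k q • v)) p)
    (fun _ _ _ => by simp) (fun _ _ _ => by simp)
    (fun _ _ _ => by simp [add_smul, LinearMap.comp_add, sliceRight_add])
    (fun _ _ _ => by simp [LinearMap.comp_smul, sliceRight_smul]))

theorem sliceAntipode_tmul (ξ : Module.Dual k V) (v : V) (p q : A) :
    sliceAntipode ξ v (p ⊗ₜ[k] q) = sliceRight (ξ ∘ₗ orbit k (antipode k q • v)) p := rfl

theorem sliceAntipode_comul (ξ : Module.Dual k V) (v : V) (a : A) :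
    sliceAntipode ξ v (comul a) = ξ v • a := by
  let g : A ⊗[k] A →ₗ[k] k := (ξ ∘ₗ orbit k v) ∘ₗ LinearMap.mul' k A ∘ₗ
    LinearMap.lTensor A (antipode k)
  have h1 : ∀ w : A ⊗[k] A, sliceAntipode ξ v w =
      TensorProduct.rid k A (LinearMap.lTensor A g
        (TensorProduct.assoc k A A A (LinearMap.rTensor A comul w))) := by
    intro w
    induction w with
    | zero => simp
    | add x y hx hy => simp only [map_add, hx, hy]
    | tmul p q =>
      rw [sliceAntipode_tmul, LinearMap.rTensor_tmul]
      simp only [sliceRight, LinearMap.comp_apply]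
      generalize (comul p : A ⊗[k] A) = z
      induction z with
      | zero => simp
      | add x y hx hy => simp only [map_add, TensorProduct.add_tmul, hx, hy]
      | tmul x y => simp [g, mul_smul]
  have hg : g ∘ₗ comul = ξ v • counit := by
    ext c
    simp only [g, LinearMap.comp_apply]
    rw [HopfAlgebra.mul_antipode_lTensor_comul_apply]
    simp [Algebra.algebraMap_eq_smul_one, mul_comm]
  rw [h1, Coalgebra.coassoc_apply, ← LinearMap.comp_apply (LinearMap.lTensor A g),
    ← LinearMap.lTensor_comp, hg, LinearMap.lTensor_smul, LinearMap.smul_apply,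
    Coalgebra.lTensor_counit_comul]
  simp

variable [FiniteDimensional k V]

theorem sum_evalMap_coevalMap (v₀ : V) (ρ : V →ₗ[k] A) (ξ : Module.Dual k V) (v w : V) :
    ∑ i, evalMap v₀ ξ (Module.finBasis k V i)
      (coevalMap ρ ((Module.finBasis k V).coord i) v w) = ξ (ρ v • v₀) • w := by
  simp only [evalMap_apply, coevalMap_apply]
  simp only [← sliceRight_sliceLeft]
  have : ∀ z : A ⊗[k] A, ∑ i, antipode k (TensorProduct.rid k A (LinearMap.lTensor A
      ((Module.finBasis k V).coord i ∘ₗ orbit k w) z)) • Module.finBasis k V i =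
      LinearMap.mul' k A (LinearMap.rTensor A (antipode k) z) • w := by
    intro z
    induction z with
    | zero => simp
    | add x y hx hy => simp only [map_add, add_smul, Finset.sum_add_distrib, hx, hy]
    | tmul p q =>
      simp only [LinearMap.lTensor_tmul, LinearMap.rTensor_tmul, TensorProduct.rid_tmul, map_smul,
        LinearMap.mul'_apply, LinearMap.comp_apply, orbit_apply, mul_smul, smul_assoc]
      exact sum_coord_smul ((Algebra.lsmul k k V) (antipode k p)) (q • w)
  refine (this _).trans ?_
  rw [HopfAlgebra.mul_antipode_rTensor_comul_apply, counit_sliceLeft]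
  simp

theorem sum_coevalMap_evalMap {v₀ : V} {ρ : V →ₗ[k] A} (hρ₀ : ∀ a : A, ρ (a • v₀) = a)
    (ξ : Module.Dual k V) (v : V) (a : A) :
    ∑ i, coevalMap ρ ξ (Module.finBasis k V i)
      (evalMap v₀ ((Module.finBasis k V).coord i) v a) = ξ v • a := by
  rw [← sliceAntipode_comul]
  simp only [evalMap_apply, coevalMap_apply, sliceLeft, LinearMap.comp_apply]
  generalize (comul a : A ⊗[k] A) = w
  induction w with
  | zero => simp [sliceRight_zero]
  | add x y hx hy =>
    simp only [map_add, add_smul, LinearMap.comp_add, sliceRight_add, LinearMap.add_apply,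
      Finset.sum_add_distrib, hx, hy]
  | tmul p q =>
    simp only [LinearMap.rTensor_tmul, LinearEquiv.coe_coe, TensorProduct.lid_tmul, map_smul,
      smul_assoc, LinearMap.comp_smul, sliceRight_smul, LinearMap.smul_apply,
      sliceAntipode_tmul, LinearMap.comp_apply, orbit_apply]
    refine (sum_coord_smul (sliceRight (ξ ∘ₗ orbit k (antipode k q • v)) ∘ₗ ρ) (p • v₀)).trans ?_
    rw [LinearMap.comp_apply, hρ₀]

theorem sum_evalMap_of_orthogonal {v₀ : V} {η : Module.Dual k V} (hη : ∀ a : A, η (a • v₀) = 0)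
    (v : V) (a : A) :
    ∑ i, η (Module.finBasis k V i) • evalMap v₀ ((Module.finBasis k V).coord i) v a = 0 := by
  refine (sum_apply_smul_coord ((evalMap v₀).flip v |>.flip a) η).trans ?_
  have : η ∘ₗ orbit k v₀ = (0 : A →ₗ[k] k) := LinearMap.ext hη
  rw [LinearMap.flip_apply, LinearMap.flip_apply, evalMap_apply, this, sliceLeft_zero]
  simp

end Equivariant

section Cyclic

open HopfAlgebra (antipode)
open Coalgebra (comul counit)
open Adjointable

variable {k A V : Type*} [Field k] [Ring A] [HopfAlgebra k A] [AddCommGroup V] [Module k V]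
  [Module A V] [IsScalarTower k A V]
variable (s : Splitting k A) (t : Splitting k V) (ρ : V →ₗ[k] A) (v₀ : V)

/-- The endomorphism `v ↦ ρ(v) v₀` of `V`. -/
def projCyclic : V →ₗ[k] V := orbit k v₀ ∘ₗ ρ

/-- The endomorphism `v ↦ v - ρ(v) v₀` of `V`. -/
def projCompl : V →ₗ[k] V := LinearMap.id - projCyclic ρ v₀

theorem projCyclic_apply (v : V) : projCyclic ρ v₀ v = ρ v • v₀ := rfl

theorem projCompl_apply (v : V) : projCompl ρ v₀ v = v - ρ v • v₀ := rfl

/-- The bilinear map `(ξ, v) ↦ e (matrixCoeff ξ v)`, where `e` is the equivariant map under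
construction. In terms of the decomposition of `FinSeq k` by `s`, it is the operator
`(a, x) ↦ t (∑ ξ(a₁ v₀) S(a₂) v, ξ(π v) x) + ξ(π' v) x`, where `π v = ρ(v) v₀` and
`π' v = v - π v`. -/
def equivMap [FiniteDimensional k A] : Module.Dual k V →ₗ[k] V →ₗ[k] Adjointable k :=
  LinearMap.mk₂ k (fun ξ v => s.ofLinear (t.incl ∘ₗ evalMap v₀ ξ v) +
      ξ (projCyclic ρ v₀ v) • (t.shift * transpose s.shift) +
      ξ (projCompl ρ v₀ v) • transpose s.shift)
    (fun ξ η v => by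
      simp only [map_add, LinearMap.add_apply, LinearMap.comp_add, add_smul]; abel)
    (fun r ξ v => by
      simp only [map_smul, LinearMap.smul_apply, LinearMap.comp_smul, smul_eq_mul, mul_smul,
        smul_add])
    (fun ξ v w => by
      simp only [map_add, LinearMap.comp_add, add_smul]; abel)
    (fun r ξ v => by
      simp only [map_smul, LinearMap.comp_smul, smul_eq_mul, mul_smul, smul_add])

/-- The bilinear map `(ξ, v) ↦ f (matrixCoeff ξ v)`, where `f` is the convolution inverse of the
equivariant map under construction. -/
def equivMapInv [FiniteDimensional k V] : Module.Dual k V →ₗ[k] V →ₗ[k] Adjointable k :=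
  LinearMap.mk₂ k (fun ξ v => t.ofLinear (s.incl ∘ₗ coevalMap ρ ξ v) +
      ξ (projCyclic ρ v₀ v) • (s.shift * transpose t.shift) +
      ξ (projCompl ρ v₀ v) • s.shift)
    (fun ξ η v => by
      simp only [map_add, LinearMap.add_apply, LinearMap.comp_add, add_smul]; abel)
    (fun r ξ v => by
      simp only [map_smul, LinearMap.smul_apply, LinearMap.comp_smul, smul_eq_mul, mul_smul,
        smul_add])
    (fun ξ v w => by
      simp only [map_add, LinearMap.comp_add, add_smul]; abel)
    (fun r ξ v => by
      simp only [map_smul, LinearMap.comp_smul, smul_eq_mul, mul_smul, smul_add])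

theorem equivMap_apply [FiniteDimensional k A] (ξ : Module.Dual k V) (v : V) (y : FinSeq k) :
    (equivMap s t ρ v₀ ξ v).1 y = t.incl (evalMap v₀ ξ v (s.proj y)) +
      ξ (projCyclic ρ v₀ v) • t.emb (s.unemb y) + ξ (projCompl ρ v₀ v) • s.unemb y := by
  change (s.ofLinear (t.incl ∘ₗ evalMap v₀ ξ v) +
      ξ (projCyclic ρ v₀ v) • (t.shift * transpose s.shift) +
      ξ (projCompl ρ v₀ v) • transpose s.shift).1 y = _
  simp only [Adjointable.add_apply, Adjointable.smul_apply, Adjointable.mul_apply,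
    Splitting.shift_eq_emb, Splitting.transpose_shift_eq_unemb, Splitting.ofLinear_eq_proj,
    LinearMap.comp_apply]

theorem equivMapInv_apply [FiniteDimensional k V] (ξ : Module.Dual k V) (v : V) (y : FinSeq k) :
    (equivMapInv s t ρ v₀ ξ v).1 y = s.incl (coevalMap ρ ξ v (t.proj y)) +
      ξ (projCyclic ρ v₀ v) • s.emb (t.unemb y) + ξ (projCompl ρ v₀ v) • s.emb y := by
  change (t.ofLinear (s.incl ∘ₗ coevalMap ρ ξ v) +
      ξ (projCyclic ρ v₀ v) • (s.shift * transpose t.shift) +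
      ξ (projCompl ρ v₀ v) • s.shift).1 y = _
  simp only [Adjointable.add_apply, Adjointable.smul_apply, Adjointable.mul_apply,
    Splitting.shift_eq_emb, Splitting.transpose_shift_eq_unemb, Splitting.ofLinear_eq_proj,
    LinearMap.comp_apply]

theorem equivMapInv_sub_mem [FiniteDimensional k A] [FiniteDimensional k V] (g : (Module.End k A)ˣ)
    (c : Coend k V) :
    coendLift (equivMapInv s t ρ v₀) c - s.twistedTranspose g (coendLift (equivMap s t ρ v₀) c) ∈
      (finiteRank k).carrier := by
  have h : ∀ ξ v, equivMapInv s t ρ v₀ ξ v - transpose (equivMap s t ρ v₀ ξ v) ∈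
      (finiteRank k).carrier := by
    intro ξ v
    have : equivMapInv s t ρ v₀ ξ v - transpose (equivMap s t ρ v₀ ξ v) =
        t.ofLinear (s.incl ∘ₗ coevalMap ρ ξ v) -
          transpose (s.ofLinear (t.incl ∘ₗ evalMap v₀ ξ v)) := by
      change (t.ofLinear (s.incl ∘ₗ coevalMap ρ ξ v) +
        ξ (projCyclic ρ v₀ v) • (s.shift * transpose t.shift) +
        ξ (projCompl ρ v₀ v) • s.shift) - transpose (s.ofLinear (t.incl ∘ₗ evalMap v₀ ξ v) +
        ξ (projCyclic ρ v₀ v) • (t.shift * transpose s.shift) +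
        ξ (projCompl ρ v₀ v) • transpose s.shift) = _
      rw [map_add, map_add, map_smul, map_smul, transpose_mul,
        Splitting.transpose_transpose_shift]
      abel
    rw [this]
    exact sub_mem (t.ofLinear_mem _) (transpose_mem (s.ofLinear_mem _))
  have h' : ∀ ξ v, equivMapInv s t ρ v₀ ξ v - s.twistedTranspose g (equivMap s t ρ v₀ ξ v) ∈
      (finiteRank k).carrier := by
    intro ξ v
    rw [← sub_add_sub_cancel _ (transpose (equivMap s t ρ v₀ ξ v))]
    exact add_mem (h ξ v) (s.transpose_sub_twistedTranspose_mem g _)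
  rw [coendLift_apply, coendLift_apply, map_sum, ← Finset.sum_sub_distrib]
  exact Submodule.sum_mem _ fun i _ => h' _ _

variable {ρ v₀}

theorem convInverse_equivMap [FiniteDimensional k A] [FiniteDimensional k V]
    (hρ₀ : ∀ a : A, ρ (a • v₀) = a) :
    ConvInverse (coendLift (equivMap s t ρ v₀)) (coendLift (equivMapInv s t ρ v₀)) := by
  -- contraction of the sums over dual bases
  have hc : ∀ (ξ : Module.Dual k V) (f : V →ₗ[k] V) (u : V),
      ∑ i, (Module.finBasis k V).coord i u * ξ (f (Module.finBasis k V i)) = ξ (f u) :=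
    fun ξ f u => sum_coord_smul (ξ ∘ₗ f) u
  have h11 : ∀ v, projCyclic ρ v₀ (projCyclic ρ v₀ v) = projCyclic ρ v₀ v := by
    simp [projCyclic_apply, hρ₀]
  have h12 : ∀ v, projCyclic ρ v₀ (projCompl ρ v₀ v) = 0 := by
    simp [projCyclic_apply, projCompl_apply, hρ₀]
  have h21 : ∀ v, projCompl ρ v₀ (projCyclic ρ v₀ v) = 0 := by
    simp [projCyclic_apply, projCompl_apply, hρ₀]
  have h22 : ∀ v, projCompl ρ v₀ (projCompl ρ v₀ v) = projCompl ρ v₀ v := by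
    simp [projCompl_apply, hρ₀]
  have hadd : ∀ (ξ : Module.Dual k V) v, ξ v = ξ (projCyclic ρ v₀ v) + ξ (projCompl ρ v₀ v) := by
    intro ξ v
    rw [← map_add, projCyclic_apply, projCompl_apply, add_sub_cancel]
  refine convInverse_coendLift (fun ξ v => Adjointable.ext fun y => ?_)
    (fun ξ v => Adjointable.ext fun y => ?_)
  · have h1 : _ = ξ (projCyclic ρ v₀ v) • t.proj y := sum_evalMap_coevalMap v₀ ρ ξ v (t.proj y)
    rw [Adjointable.sum_apply]
    simp only [Adjointable.mul_apply, equivMapInv_apply, equivMap_apply, map_add, map_smul,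
      Splitting.proj_incl, Splitting.proj_emb, Splitting.unemb_incl, Splitting.unemb_emb,
      smul_zero, add_zero, smul_add, smul_smul, Finset.sum_add_distrib]
    simp only [← Finset.sum_smul, hc, h11, h12, h21, h22, map_zero, zero_smul, smul_zero,
      Finset.sum_const_zero, add_zero, zero_add]
    rw [← map_sum, h1, Adjointable.smul_apply, Adjointable.one_apply, hadd ξ v, add_smul, map_smul,
      ← smul_add, t.incl_proj_add_emb_unemb]
  · have h1 := sum_coevalMap_evalMap hρ₀ ξ v (s.proj y)
    have h2 := sum_evalMap_of_orthogonal (v₀ := v₀) (η := ξ ∘ₗ projCompl ρ v₀)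
      (fun a => by simp [projCompl_apply, hρ₀]) v (s.proj y)
    have h3 : ∀ w, coevalMap ρ ξ (projCompl ρ v₀ v) w = 0 := by
      intro w
      simp [coevalMap_apply, projCompl_apply, hρ₀]
    have h4 : ∀ w, ∑ i, (Module.finBasis k V).coord i (projCompl ρ v₀ v) •
        coevalMap ρ ξ (Module.finBasis k V i) w = 0 := fun w =>
      (sum_coord_smul ((coevalMap ρ ξ).flip w) _).trans (h3 w)
    rw [Adjointable.sum_apply]
    simp only [Adjointable.mul_apply, equivMapInv_apply, equivMap_apply, map_add, map_smul,
      Splitting.proj_incl, Splitting.proj_emb, Splitting.unemb_incl, Splitting.unemb_emb,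
      smul_add, smul_smul, Finset.sum_add_distrib]
    simp only [← Finset.sum_smul, hc, h11, h12, h21, h22, map_zero, zero_smul, smul_zero,
      Finset.sum_const_zero, add_zero, zero_add]
    have e1 := congrArg s.incl h1
    have e2 := congrArg (s.emb ∘ₗ t.incl) h2
    have e3 := congrArg s.incl (h4 (t.proj (s.unemb y)))
    simp only [map_sum, map_smul, map_zero, LinearMap.comp_apply] at e1 e2 e3
    rw [e1, e2, e3, add_zero, zero_add, add_assoc, ← add_smul, ← hadd, ← smul_add,
      s.incl_proj_add_emb_unemb]
    rfl

theorem equivMap_act [FiniteDimensional k A] [FiniteDimensional k V]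
    (hρ : ∀ (a : A) w, ρ (a • w) = a * ρ w) (c : Coend k V) (a : A) :
    coendLift (equivMap s t ρ v₀) (RightModuleCoalgebra.act (c ⊗ₜ[k] a)) =
      coendLift (equivMap s t ρ v₀) c *
        s.block (LinearMap.mulLeft k a, counit (R := k) a) := by
  have hp : ∀ (b : A) v, projCyclic ρ v₀ (b • v) = b • projCyclic ρ v₀ v := by
    simp [projCyclic_apply, hρ, mul_smul]
  have hp' : ∀ (b : A) v, projCompl ρ v₀ (b • v) = b • projCompl ρ v₀ v := by
    simp [projCompl_apply, hρ, mul_smul, smul_sub]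
  have key : ∀ (ξ : Module.Dual k V) (v : V) (y : FinSeq k) (w : A ⊗[k] A),
      (coendLift (equivMap s t ρ v₀) (TensorProduct.lift
        (matrixCoeff.compl₁₂ (dualAct ξ) (orbit k v ∘ₗ antipode k)) w)).1 y =
      t.incl (antipode k (TensorProduct.lid k A (LinearMap.rTensor A (ξ ∘ₗ orbit k v₀)
        (w * comul (s.proj y)))) • v) +
      ξ (LinearMap.mul' k A (LinearMap.lTensor A (antipode k) w) • projCyclic ρ v₀ v) •
        t.emb (s.unemb y) +
      ξ (LinearMap.mul' k A (LinearMap.lTensor A (antipode k) w) • projCompl ρ v₀ v) •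
        s.unemb y := by
    intro ξ v y w
    induction w with
    | zero => simp
    | add w w' hw hw' =>
      rw [map_add, map_add, Adjointable.add_apply, hw, hw']
      simp only [add_mul, map_add, add_smul]
      abel
    | tmul p q =>
      have h : ∀ z : A ⊗[k] A, antipode k (TensorProduct.lid k A (LinearMap.rTensor A
          (dualAct ξ p ∘ₗ orbit k v₀) z)) * antipode k q =
          antipode k (TensorProduct.lid k A (LinearMap.rTensor A (ξ ∘ₗ orbit k v₀)
            ((p ⊗ₜ[k] q) * z))) := by
        intro z
        induction z with
        | zero => simp
        | add x y hx hy => simp only [map_add, add_mul, mul_add, hx, hy]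
        | tmul x y => simp [mul_smul, HopfAlgebra.antipode_mul_antidistrib]
      rw [TensorProduct.lift.tmul, LinearMap.compl₁₂_apply, coendLift_matrixCoeff, equivMap_apply,
        evalMap_apply, LinearMap.comp_apply, orbit_apply, smul_smul, hp, hp', dualAct_apply,
        dualAct_apply, smul_smul, smul_smul]
      rw [← h]
      rfl
  have : coendLift (equivMap s t ρ v₀) ∘ₗ
      (RightModuleCoalgebra.act : Coend k V ⊗[k] A →ₗc[k] Coend k V).toLinearMap ∘ₗ
        (TensorProduct.mk k (Coend k V) A).flip a =
      LinearMap.mulRight k (s.block (LinearMap.mulLeft k a, counit (R := k) a)) ∘ₗ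
        coendLift (equivMap s t ρ v₀) := by
    refine coend_hom_ext fun ξ v => Adjointable.ext fun y => ?_
    change (coendLift (equivMap s t ρ v₀)
      (RightModuleCoalgebra.act (matrixCoeff ξ v ⊗ₜ[k] a))).1 y =
      (coendLift (equivMap s t ρ v₀) (matrixCoeff ξ v) *
        s.block (LinearMap.mulLeft k a, counit (R := k) a)).1 y
    rw [act_matrixCoeff, key, coendLift_matrixCoeff, Adjointable.mul_apply, equivMap_apply,
      Splitting.proj_block, Splitting.unemb_block, HopfAlgebra.mul_antipode_lTensor_comul_apply,
      evalMap_apply,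
      ← Bialgebra.comul_mul, map_smul t.emb, algebraMap_smul, algebraMap_smul, map_smul ξ,
      map_smul ξ,
      smul_smul, smul_smul, smul_eq_mul, smul_eq_mul, mul_comm (counit a), mul_comm (counit a)]
    rfl
  exact LinearMap.congr_fun this c

/-- An automorphism `g` of `A` such that `⟨a, g b⟩ = l(S(a) b)`. -/
theorem exists_unit_form [FiniteDimensional k A] {l : Module.Dual k A}
    (hl : ∀ a, (∀ b, l (b * a) = 0) → a = 0)
    (hS : Function.Surjective (antipode k : A →ₗ[k] A)) :
    ∃ g : (Module.End k A)ˣ, ∀ a b, s.form a (g.1 b) = l (antipode k a * b) := by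
  let N : A →ₗ[k] Module.Dual k A :=
    LinearMap.lcomp k k (antipode k) ∘ₗ LinearMap.llcomp k A A k l ∘ₗ (LinearMap.mul k A).flip
  have hN : ∀ a b, N b a = l (antipode k a * b) := fun a b => rfl
  let g : Module.End k A := s.riesz.symm.toLinearMap ∘ₗ N
  have hg : Function.Injective g := by
    refine s.riesz.symm.injective.comp ?_
    rw [injective_iff_map_eq_zero]
    intro b hb
    refine hl b fun c => ?_
    obtain ⟨a, rfl⟩ := hS c
    rw [← hN, hb, LinearMap.zero_apply]
  obtain ⟨u, hu⟩ := (LinearMap.isUnit_iff_ker_eq_bot g).2 (LinearMap.ker_eq_bot.2 hg)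
  refine ⟨u, fun a b => ?_⟩
  rw [s.form_comm, hu]
  exact (LinearMap.congr_fun (s.riesz_symm (N b)) a).trans (hN a b)

theorem twistedTranspose_block [FiniteDimensional k A] {g : (Module.End k A)ˣ} {l : Module.Dual k A}
    (hg : ∀ a b, s.form a (g.1 b) = l (antipode k a * b)) (a : A) :
    s.twistedTranspose g (s.block (LinearMap.mulLeft k a, counit (R := k) a)) =
      s.block (LinearMap.mulLeft k (antipode k a), counit (R := k) (antipode k a)) := by
  refine s.twistedTranspose_eq g fun x y => ?_
  obtain ⟨⟨b, x⟩, rfl⟩ := s.equiv.surjective x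
  obtain ⟨⟨c, y⟩, rfl⟩ := s.equiv.surjective y
  simp only [s.block_apply]
  rw [s.dot_equiv_equiv, s.dot_equiv_equiv b, ← s.form_apply, ← s.form_apply]
  change s.form (a * b) (g.1 c) + _ = s.form b (g.1 (antipode k a * c)) + _
  rw [hg, hg, HopfAlgebra.antipode_mul_antidistrib, mul_assoc]
  simp

/-- An injective equivariant map from a right module coalgebra `C` to the algebra of operators: it
maps `c` to the operator `(a, x) ↦ ca` of finite rank, for an embedding of the vector space `C`.
-/
def orbitMap [FiniteDimensional k A] {C : Type*} [AddCommGroup C] [Module k C] [Coalgebra k C]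
    [RightModuleCoalgebra k A C]
    (u : Splitting k C) : C →ₗ[k] Adjointable k :=
  s.ofLinear ∘ₗ LinearMap.llcomp k A C (FinSeq k) u.incl ∘ₗ
    TensorProduct.curry (RightModuleCoalgebra.act : C ⊗[k] A →ₗc[k] C).toLinearMap

theorem orbitMap_apply [FiniteDimensional k A] {C : Type*} [AddCommGroup C] [Module k C]
    [Coalgebra k C]
    [RightModuleCoalgebra k A C] (u : Splitting k C) (c : C) (y : FinSeq k) :
    (orbitMap s u c).1 y = u.incl (RightModuleCoalgebra.act (c ⊗ₜ[k] s.proj y)) :=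
  Splitting.ofLinear_eq_proj s _ y

theorem orbitMap_injective [FiniteDimensional k A] {C : Type*} [AddCommGroup C] [Module k C]
    [Coalgebra k C]
    [RightModuleCoalgebra k A C] (u : Splitting k C) : Function.Injective (orbitMap s u) := by
  intro c d h
  have := congrArg (fun b : Adjointable k => b.1 (s.incl 1)) h
  simp only [orbitMap_apply, Splitting.proj_incl, RightModuleCoalgebra.act_one] at this
  exact u.incl_injective this

theorem orbitMap_act [FiniteDimensional k A] {C : Type*} [AddCommGroup C] [Module k C]
    [Coalgebra k C]
    [RightModuleCoalgebra k A C] (u : Splitting k C) (c : C) (a : A) :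
    orbitMap s u (RightModuleCoalgebra.act (c ⊗ₜ[k] a)) =
      orbitMap s u c * s.block (LinearMap.mulLeft k a, counit (R := k) a) :=
  Adjointable.ext fun y => by
    rw [Adjointable.mul_apply, orbitMap_apply, orbitMap_apply, Splitting.proj_block,
      ← RightModuleCoalgebra.act_mul]
    rfl

/-- The operators constructed above satisfy the hypotheses of
`FreeHopf.injective_of_antiendomorphism`. -/
theorem FreeHopf.injective_of_cyclic [FiniteDimensional k A] [FiniteDimensional k V]
    (hV : ∃ v : V, ∀ a : A, a • v = 0 → a = 0) :
    Function.Injective (FreeHopf.X k A (Coend k V) 0) ∧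
      Function.Injective (FreeHopf.J k A (Coend k V)) := by
  obtain ⟨v₀, hv₀⟩ := hV
  obtain ⟨hS, l, hl⟩ := exists_frobenius k A
  obtain ⟨ρ, hρ, hρ₀⟩ := exists_retraction hl hv₀
  obtain ⟨s⟩ := nonempty_splitting (k := k) (F := A)
  obtain ⟨t⟩ := nonempty_splitting (k := k) (F := V)
  obtain ⟨u⟩ := nonempty_splitting (k := k) (F := Coend k V)
  obtain ⟨g, hg⟩ := exists_unit_form s hl hS.2
  let φ : A →ₐ[k] Adjointable k := s.block.comp
    ((Algebra.lmul k A).prod (Bialgebra.counitAlgHom k A))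
  have hφ : ∀ a, φ a = s.block (LinearMap.mulLeft k a, Coalgebra.counit (R := k) a) := fun a => rfl
  have hφ_inj : Function.Injective φ := by
    intro a b h
    have := congrArg (fun b : Adjointable k => s.proj (b.1 (s.incl 1))) h
    simpa only [hφ, Splitting.proj_block, Splitting.proj_incl, LinearMap.mulLeft_apply, mul_one]
        using this
  exact FreeHopf.injective_of_antiendomorphism (Adjointable.finiteRank k) φ hφ_inj
    (s.twistedTranspose g) (s.twistedTranspose_mul g) (s.twistedTranspose_one g)
    (twistedTranspose_block s hg) (fun _ hb => s.twistedTranspose_mem g hb)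
    (coendLift (equivMap s t ρ v₀)) (coendLift (equivMapInv s t ρ v₀)) (equivMap_act s t hρ)
    (convInverse_equivMap s t hρ₀) (equivMapInv_sub_mem s t ρ v₀ g) (orbitMap s u)
    (orbitMap_injective s u) (orbitMap_act s u)

end Cyclic

end HopfFree

end

theorem proposition3p1 (k A V : Type*) [Field k] [Ring A] [HopfAlgebra k A]
    [FiniteDimensional k A] [AddCommGroup V] [Module k V] [Module A V] [IsScalarTower k A V]
    [FiniteDimensional k V] (hV : ∃ v : V, ∀ a : A, a • v = 0 → a = 0) :
    Function.Injective (HopfFree.FreeHopf.ofCoalgebra k A (HopfFree.Coend k V)) ∧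
      Function.Injective (HopfFree.FreeHopf.ofHopf k A (HopfFree.Coend k V)) := by
  exact HopfFree.FreeHopf.injective_of_cyclic hV
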